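/- Let $t \ge 4$ be an integer, and let $\mathcal{C}_t$ be the class of finite simple graphs that contain no cycle of length at least $t$ as an induced subgraph. For a graph $G$ with a weight function $\mathbf{w}\colon V(G)\to\mathbb{N}$ write $\mathbf{w}(X)=\sum_{x\in X}\mathbf{w}(x)$ and $n=|V(G)|$; a set $I\subseteq V(G)$ is an $\alpha$-approximation to Maximum Weight Independent Set (MWIS) on $(G,\mathbf{w})$ if $I$ is independent and $\mathbf{w}(I)\ge\alpha\,\mathbf{w}(I')$ for every independent set $I'$ of $G$. Running times are numbers of steps of a random access machine whose registers and memory cells hold natural numbers and whose unit-cost operations are assignment, addition, truncated subtraction, comparison with zero, indirect addressing and subroutine call. Then: (1) There are an algorithm and a polynomial $P$ in two variables, both depending only on $t$, such that the algorithm, given a graph $G\in\mathcal{C}_t$, a weight function $\mathbf{w}\colon V(G)\to\mathbb{N}$ and a rational accuracy parameter $\varepsilon=p/q>0$ (given by positive integers $p,q$), computes a $(1-\varepsilon)$-approximation to MWIS on $(G,\mathbf{w})$ in at most $\exp\bigl(P(\log n,\varepsilon^{-1})\bigr)$ steps (with $\log 0$ read as $0$). In other words, MWIS on $\mathcal{C}_t$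 admits a quasi-polynomial time approximation scheme. (2) There are an algorithm and a constant $C$, both depending only on $t$, such that the algorithm, given a graph $G\in\mathcal{C}_t$ and a weight function $\mathbf{w}\colon V(G)\to\mathbb{N}$, computes an independent set of maximum weight in at most $C\cdot 2^{C\sqrt{n}\,\log n}$ steps, that is, in time $2^{\mathcal{O}(\sqrt{n}\log n)}$ (again with $\log 0$ read as $0$). -/

import Mathlib

/-! Random access machines with a step count -/

namespace RAM

/-- The store of a random access machine: registers `reg 0, reg 1, …`, which a program names
directly, and arrays `arr 0, arr 1, …`, whose cells are addressed by the contents of registers.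
Every register and every cell holds a natural number. A program, being a finite text, names only
finitely many registers and arrays. -/
structure Store where
  reg : ℕ → ℕ
  arr : ℕ → ℕ → ℕ

/-- `r := x`. -/
def Store.setReg (s : Store) (r x : ℕ) : Store :=
  { s with reg := Function.update s.reg r x }

/-- `a[i] := x`. -/
def Store.setArr (s : Store) (a i x : ℕ) : Store :=
  { s with arr := Function.update s.arr a (Function.update (s.arr a) i x) }

/-- Commands. The only arithmetic is addition and truncated subtraction. -/
inductive Cmd where
  /-- do nothing -/
  | skip : Cmd
  /-- `const r c`: put the constant `c` into register `r` -/
  | const (r c : ℕ) : Cmd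
  /-- `copy r x`: put the content of register `x` into register `r` -/
  | copy (r x : ℕ) : Cmd
  /-- `add r x y`: put the sum of registers `x` and `y` into register `r` -/
  | add (r x y : ℕ) : Cmd
  /-- `sub r x y`: put the truncated difference of registers `x` and `y` into register `r` -/
  | sub (r x y : ℕ) : Cmd
  /-- `load r a x`: put into register `r` the cell of array `a` at the index held by `x` -/
  | load (r a x : ℕ) : Cmd
  /-- `store a x r`: put register `r` into the cell of array `a` at the index held by `x` -/
  | store (a x r : ℕ) : Cmd
  /-- sequential composition -/
  | seq (P Q : Cmd) : Cmd
  /-- `ite r P Q`: if register `r` is nonzero then `P` else `Q` -/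
  | ite (r : ℕ) (P Q : Cmd) : Cmd
  /-- `loop r P`: while register `r` is nonzero do `P` -/
  | loop (r : ℕ) (P : Cmd) : Cmd
  /-- `call f`: run the subroutine number `f` (possibly recursively) on the common store -/
  | call (f : ℕ) : Cmd

/-- A program: a main command and a finite list of subroutines. -/
structure Program where
  main : Cmd
  subs : List Cmd

/-- `Exec subs P s k s'`: with the subroutines `subs`, the command `P` started on the store `s`
halts after exactly `k` steps with the store `s'`. Every elementary instruction, every test of a
conditional or of a loop, and every call costs one step. -/
inductive Exec (subs : List Cmd) : Cmd → Store → ℕ → Store → Prop where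
  | skip (s : Store) : Exec subs .skip s 1 s
  | const (s : Store) (r c : ℕ) : Exec subs (.const r c) s 1 (s.setReg r c)
  | copy (s : Store) (r x : ℕ) : Exec subs (.copy r x) s 1 (s.setReg r (s.reg x))
  | add (s : Store) (r x y : ℕ) :
      Exec subs (.add r x y) s 1 (s.setReg r (s.reg x + s.reg y))
  | sub (s : Store) (r x y : ℕ) :
      Exec subs (.sub r x y) s 1 (s.setReg r (s.reg x - s.reg y))
  | load (s : Store) (r a x : ℕ) :
      Exec subs (.load r a x) s 1 (s.setReg r (s.arr a (s.reg x)))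
  | store (s : Store) (a x r : ℕ) :
      Exec subs (.store a x r) s 1 (s.setArr a (s.reg x) (s.reg r))
  | seq {P Q : Cmd} {s s' s'' : Store} {k l : ℕ} (hP : Exec subs P s k s')
      (hQ : Exec subs Q s' l s'') : Exec subs (.seq P Q) s (k + l) s''
  | ite_true {r : ℕ} {P Q : Cmd} {s s' : Store} {k : ℕ} (hr : s.reg r ≠ 0)
      (hP : Exec subs P s k s') : Exec subs (.ite r P Q) s (k + 1) s'
  | ite_false {r : ℕ} {P Q : Cmd} {s s' : Store} {k : ℕ} (hr : s.reg r = 0)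
      (hQ : Exec subs Q s k s') : Exec subs (.ite r P Q) s (k + 1) s'
  | loop_stop {r : ℕ} {P : Cmd} {s : Store} (hr : s.reg r = 0) :
      Exec subs (.loop r P) s 1 s
  | loop_step {r : ℕ} {P : Cmd} {s s' s'' : Store} {k l : ℕ} (hr : s.reg r ≠ 0)
      (hP : Exec subs P s k s') (hL : Exec subs (.loop r P) s' l s'') :
      Exec subs (.loop r P) s (k + l + 1) s''
  | call {f : ℕ} {P : Cmd} {s s' : Store} {k : ℕ} (hf : subs[f]? = some P)
      (hP : Exec subs P s k s') : Exec subs (.call f) s (k + 1) s'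

/-- The program `A`, started on the store `s`, halts after exactly `k` steps with the store `s'`. -/
def Program.HaltsIn (A : Program) (s : Store) (k : ℕ) (s' : Store) : Prop :=
  Exec A.subs A.main s k s'

end RAM

/-! Maximum weight independent set -/

namespace MWIS

/-- `G` has no induced cycle of length at least `t`. -/
def HoleFree (t : ℕ) {V : Type*} (G : SimpleGraph V) : Prop :=
  ∀ l : ℕ, t ≤ l → ¬ (SimpleGraph.cycleGraph l).IsIndContained G

open Classical in
/-- The input store for a graph `G` on the vertices `0, …, n - 1`, a weight function `w` and two
further numbers `p`, `q`: registers `0, 1, 2` hold `n`, `p`, `q`; array `0` holds the adjacency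
matrix of `G`, row by row; array `1` holds the weights; everything else is zero. -/
noncomputable def input {n : ℕ} (G : SimpleGraph (Fin n)) (w : Fin n → ℕ) (p q : ℕ) :
    RAM.Store where
  reg r := if r = 0 then n else if r = 1 then p else if r = 2 then q else 0
  arr a i :=
    if a = 0 then (if ∃ u v : Fin n, G.Adj u v ∧ i = n * (u : ℕ) + (v : ℕ) then 1 else 0)
    else if a = 1 then (if h : i < n then w ⟨i, h⟩ else 0)
    else 0

/-- The set of vertices whose characteristic vector is in array `2` at the end of a run. -/
def output (n : ℕ) (s : RAM.Store) : Finset (Fin n) :=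
  Finset.univ.filter fun v => s.arr 2 (v : ℕ) ≠ 0

/-- `I` is an `α`-approximation: an independent set with `w(I) ≥ α · w(J)` for every independent
set `J`. A `1`-approximation is an independent set of maximum weight. -/
def IsApprox {n : ℕ} (G : SimpleGraph (Fin n)) (w : Fin n → ℕ) (α : ℝ) (I : Finset (Fin n)) :
    Prop :=
  G.IsIndepSet (I : Set (Fin n)) ∧
    ∀ J : Finset (Fin n), G.IsIndepSet (J : Set (Fin n)) →
      α * ((∑ v ∈ J, w v : ℕ) : ℝ) ≤ ((∑ v ∈ I, w v : ℕ) : ℝ)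

end MWIS

/-! The algorithm is a branching recursion on a vertex set `A` with fuel `k`; it does not depend on
the class of graphs except through the initial fuel. For every vertex `u` it solves `A` without the
closed neighbourhood of `u` and adds `u` back if `u ∈ A`. For every `i` it solves the part of `A` of
degree at most `i`. It also solves the components of `A` separately and unites the results. The
heaviest set found is returned. There are three calls per vertex, so fuel `k` costs at most `(320 (n
+ 1)⁵)ᵏ⁺¹` steps (`callOK`), and the question is how little fuel suffices. `val` is the weight that
these branches guarantee. To bound it below by a multiple of the weight of an independent set `J`,
it is enough to exhibit one good sequence of branches, which may depend on `J`.

The structural input is a Gyárfás path argument (`exists_separator`): some `X ⊆ A` with at most `t`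
vertices has a closed neighbourhood `N[X]` whose removal leaves only components of at most half the
size of `A`. Otherwise an induced path can be prolonged for ever (`PathState.step`). The large
component left by the last `t` path vertices either avoids the neighbourhood of the whole path, and
the path grows towards it, or it touches the neighbourhood of an old path vertex and closes a long
induced cycle.

Exact solutions (`le_val_exact`): take members of `J` of degree at least about `√|A|` until none is
left, which happens at most `√|A|` times, and discard all other vertices of high degree. Then `N[X]`
contains at most `t√|A|` members of `J`. Take these, delete `N[X]` and split. The sizes halve, so
the fuel is a geometric sum of order `t√n`.

Approximation (`le_val_approx`): a greedy choice of few members of `J` dominates all vertices that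
see more than a `1 / B` fraction of the weight of `J` (`exists_dominating`). Once these members are
taken, deleting `N[X]` loses at most a `t / B` fraction. There are about `log n` rounds of halving,
so `B` of order `t log n / ε` is right, and the fuel is of order `t log³ n / ε`. -/

namespace RAM

/-! ### Running a command within a time bound -/

/-- Started on `s`, the command `P` halts within `T` steps on a store that satisfies `Q`. -/
def Runs (subs : List Cmd) (P : Cmd) (s : Store) (T : ℕ) (Q : Store → Prop) : Prop :=
  ∃ k s', Exec subs P s k s' ∧ k ≤ T ∧ Q s'

/-- Loop-free and call-free commands. -/
def Cmd.straight : Cmd → Bool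
  | .seq P Q => P.straight && Q.straight
  | .ite _ P Q => P.straight && Q.straight
  | .loop _ _ => false
  | .call _ => false
  | _ => true

/-- The effect of a loop-free and call-free command. -/
def Cmd.eval : Cmd → Store → Store
  | .skip, s => s
  | .const r c, s => s.setReg r c
  | .copy r x, s => s.setReg r (s.reg x)
  | .add r x y, s => s.setReg r (s.reg x + s.reg y)
  | .sub r x y, s => s.setReg r (s.reg x - s.reg y)
  | .load r a x, s => s.setReg r (s.arr a (s.reg x))
  | .store a x r, s => s.setArr a (s.reg x) (s.reg r)
  | .seq P Q, s => Q.eval (P.eval s)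
  | .ite r P Q, s => if s.reg r = 0 then Q.eval s else P.eval s
  | .loop _ _, s => s
  | .call _, s => s

/-- A bound for the running time of a loop-free and call-free command. -/
def Cmd.len : Cmd → ℕ
  | .seq P Q => P.len + Q.len
  | .ite _ P Q => P.len + Q.len + 1
  | _ => 1

/-- Commands without subroutine calls. -/
def Cmd.callFree : Cmd → Bool
  | .seq P Q => P.callFree && Q.callFree
  | .ite _ P Q => P.callFree && Q.callFree
  | .loop _ P => P.callFree
  | .call _ => false
  | _ => true

/-- The registers that a command may write. -/
def Cmd.writes : Cmd → List ℕ
  | .const r _ => [r]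
  | .copy r _ => [r]
  | .add r _ _ => [r]
  | .sub r _ _ => [r]
  | .load r _ _ => [r]
  | .seq P Q => P.writes ++ Q.writes
  | .ite _ P Q => P.writes ++ Q.writes
  | .loop _ P => P.writes
  | _ => []

/-- The arrays that a command may write. -/
def Cmd.stores : Cmd → List ℕ
  | .store a _ _ => [a]
  | .seq P Q => P.stores ++ Q.stores
  | .ite _ P Q => P.stores ++ Q.stores
  | .loop _ P => P.stores
  | _ => []

/-- The stores differ only in the registers `W` and the arrays `S`. -/
structure Frame (W S : List ℕ) (s s' : Store) : Prop where
  reg : ∀ r, r ∉ W → s'.reg r = s.reg r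
  arr : ∀ a, a ∉ S → s'.arr a = s.arr a

theorem Frame.refl (W S : List ℕ) (s : Store) : Frame W S s s := ⟨fun _ _ => rfl, fun _ _ => rfl⟩

theorem Frame.trans {W S : List ℕ} {s s' s'' : Store} (h : Frame W S s s')
    (h' : Frame W S s' s'') : Frame W S s s'' :=
  ⟨fun r hr => (h'.reg r hr).trans (h.reg r hr), fun a ha => (h'.arr a ha).trans (h.arr a ha)⟩

theorem Frame.mono {W S W' S' : List ℕ} {s s' : Store} (h : Frame W S s s')
    (hW : ∀ r ∈ W, r ∈ W') (hS : ∀ a ∈ S, a ∈ S') : Frame W' S' s s' :=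
  ⟨fun r hr => h.reg r fun h' => hr (hW r h'), fun a ha => h.arr a fun h' => ha (hS a h')⟩

@[simp] theorem setReg_arr (s : Store) (r x : ℕ) : (s.setReg r x).arr = s.arr := rfl

@[simp] theorem setArr_reg (s : Store) (a i x : ℕ) : (s.setArr a i x).reg = s.reg := rfl

theorem setReg_reg (s : Store) (r x y : ℕ) :
    (s.setReg r x).reg y = if y = r then x else s.reg y := by
  simp [Store.setReg, Function.update_apply]

theorem setArr_arr (s : Store) (a i x b j : ℕ) :
    (s.setArr a i x).arr b j = if b = a ∧ j = i then x else s.arr b j := by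
  simp only [Store.setArr, Function.update_apply]
  by_cases h : b = a <;> by_cases h' : j = i <;> simp [h, h']

theorem ite_reg (c : Prop) [Decidable c] (s s' : Store) (r : ℕ) :
    (if c then s else s').reg r = if c then s.reg r else s'.reg r := by
  split_ifs <;> rfl

theorem frame_setReg {W S : List ℕ} (s : Store) {r : ℕ} (x : ℕ) (hr : r ∈ W) :
    Frame W S s (s.setReg r x) :=
  ⟨fun y hy => by rw [setReg_reg, if_neg]; rintro rfl; exact hy hr, fun _ _ => rfl⟩

theorem frame_setArr {W S : List ℕ} (s : Store) {a : ℕ} (i x : ℕ) (ha : a ∈ S) :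
    Frame W S s (s.setArr a i x) :=
  ⟨fun _ _ => rfl, fun b hb => by
    funext j; rw [setArr_arr, if_neg]; rintro ⟨rfl, -⟩; exact hb ha⟩

/-- Registers and arrays are named by constants, so what may be written can be read off the text;
only a call would hide writes. Correctness proofs can therefore state the one value of interest and
recover the rest from the frame, mostly by `decide`. -/
theorem Exec.frame {subs : List Cmd} {P : Cmd} {s s' : Store} {k : ℕ} (h : Exec subs P s k s')
    (hP : P.callFree = true) : Frame P.writes P.stores s s' := by
  induction h with
  | skip s => exact .refl _ _ _
  | const s r c => exact frame_setReg _ _ (by simp [Cmd.writes])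
  | copy s r x => exact frame_setReg _ _ (by simp [Cmd.writes])
  | add s r x y => exact frame_setReg _ _ (by simp [Cmd.writes])
  | sub s r x y => exact frame_setReg _ _ (by simp [Cmd.writes])
  | load s r a x => exact frame_setReg _ _ (by simp [Cmd.writes])
  | store s a x r => exact frame_setArr _ _ _ (by simp [Cmd.stores])
  | seq _ _ ihP ihQ =>
    simp only [Cmd.callFree, Bool.and_eq_true] at hP
    exact ((ihP hP.1).mono (by simp +contextual [Cmd.writes])
      (by simp +contextual [Cmd.stores])).trans ((ihQ hP.2).mono
        (by simp +contextual [Cmd.writes]) (by simp +contextual [Cmd.stores]))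
  | ite_true _ _ ih =>
    simp only [Cmd.callFree, Bool.and_eq_true] at hP
    exact (ih hP.1).mono (by simp +contextual [Cmd.writes]) (by simp +contextual [Cmd.stores])
  | ite_false _ _ ih =>
    simp only [Cmd.callFree, Bool.and_eq_true] at hP
    exact (ih hP.2).mono (by simp +contextual [Cmd.writes]) (by simp +contextual [Cmd.stores])
  | loop_stop _ => exact .refl _ _ _
  | loop_step _ _ _ ihP ihL => exact (ihP hP).trans (ihL hP)
  | call _ _ _ => simp [Cmd.callFree] at hP

variable {subs : List Cmd}

theorem Runs.mono {P : Cmd} {s : Store} {T T' : ℕ} {Q Q' : Store → Prop}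
    (h : Runs subs P s T Q) (hT : T ≤ T') (hQ : ∀ s', Q s' → Q' s') : Runs subs P s T' Q' := by
  obtain ⟨k, s', h₁, h₂, h₃⟩ := h
  exact ⟨k, s', h₁, h₂.trans hT, hQ _ h₃⟩

theorem Runs.frame {P : Cmd} {s : Store} {T : ℕ} {Q : Store → Prop}
    (h : Runs subs P s T Q) (hP : P.callFree = true) :
    Runs subs P s T fun s' => Q s' ∧ Frame P.writes P.stores s s' := by
  obtain ⟨k, s', h₁, h₂, h₃⟩ := h
  exact ⟨k, s', h₁, h₂, h₃, h₁.frame hP⟩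

theorem Runs.seq {P P' : Cmd} {s : Store} {T T' : ℕ} {Q Q' : Store → Prop}
    (h : Runs subs P s T Q) (h' : ∀ s', Q s' → Runs subs P' s' T' Q') :
    Runs subs (.seq P P') s (T + T') Q' := by
  obtain ⟨k, s', h₁, h₂, h₃⟩ := h
  obtain ⟨l, s'', h₄, h₅, h₆⟩ := h' s' h₃
  exact ⟨k + l, s'', .seq h₁ h₄, by omega, h₆⟩

theorem Runs.ite {P P' : Cmd} {r : ℕ} {s : Store} {T : ℕ} {Q : Store → Prop}
    (h : s.reg r ≠ 0 → Runs subs P s T Q) (h' : s.reg r = 0 → Runs subs P' s T Q) :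
    Runs subs (.ite r P P') s (T + 1) Q := by
  by_cases hr : s.reg r = 0
  · obtain ⟨k, s', h₁, h₂, h₃⟩ := h' hr
    exact ⟨k + 1, s', .ite_false hr h₁, by omega, h₃⟩
  · obtain ⟨k, s', h₁, h₂, h₃⟩ := h hr
    exact ⟨k + 1, s', .ite_true hr h₁, by omega, h₃⟩

theorem Runs.call {f : ℕ} {P : Cmd} {s : Store} {T : ℕ} {Q : Store → Prop}
    (hf : subs[f]? = some P) (h : Runs subs P s T Q) : Runs subs (.call f) s (T + 1) Q := by
  obtain ⟨k, s', h₁, h₂, h₃⟩ := h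
  exact ⟨k + 1, s', .call hf h₁, by omega, h₃⟩

/-- Straight-line code is verified by computing `Cmd.eval` with `simp` instead of building
derivations of `Exec`. Since `Cmd.len` counts both branches of a conditional, the bound does not
depend on the store. -/
theorem runs_eval (P : Cmd) (hP : P.straight = true) (s : Store) :
    Runs subs P s P.len fun s' => s' = P.eval s := by
  induction P generalizing s with
  | skip => exact ⟨1, s, .skip s, le_rfl, rfl⟩
  | const r c => exact ⟨1, _, .const s r c, le_rfl, rfl⟩
  | copy r x => exact ⟨1, _, .copy s r x, le_rfl, rfl⟩
  | add r x y => exact ⟨1, _, .add s r x y, le_rfl, rfl⟩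
  | sub r x y => exact ⟨1, _, .sub s r x y, le_rfl, rfl⟩
  | load r a x => exact ⟨1, _, .load s r a x, le_rfl, rfl⟩
  | store a x r => exact ⟨1, _, .store s a x r, le_rfl, rfl⟩
  | seq P Q ihP ihQ =>
    simp only [Cmd.straight, Bool.and_eq_true] at hP
    refine (ihP hP.1 s).seq fun s' hs' => ?_
    subst hs'
    exact ihQ hP.2 _
  | ite r P Q ihP ihQ =>
    simp only [Cmd.straight, Bool.and_eq_true] at hP
    refine Runs.mono (T := P.len + Q.len + 1) (Q := fun s' => s' = (Cmd.ite r P Q).eval s)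
      (Runs.ite (fun hr => ?_) fun hr => ?_) le_rfl fun _ h => h
    · exact (ihP hP.1 s).mono (by omega) fun s' h => by simp [Cmd.eval, hr, h]
    · exact (ihQ hP.2 s).mono (by omega) fun s' h => by simp [Cmd.eval, hr, h]
  | loop r P _ => simp [Cmd.straight] at hP
  | call f => simp [Cmd.straight] at hP

/-- A straight-line command followed by another one. -/
theorem Runs.straight_seq {P P' : Cmd} {s : Store} {T : ℕ} {Q : Store → Prop}
    (hP : P.straight = true) (h : Runs subs P' (P.eval s) T Q) :
    Runs subs (.seq P P') s (P.len + T) Q :=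
  (runs_eval P hP s).seq fun _ hs => hs ▸ h

theorem Runs.straight {P : Cmd} {s : Store} {Q : Store → Prop}
    (hP : P.straight = true) (h : Q (P.eval s)) : Runs subs P s P.len Q :=
  (runs_eval P hP s).mono le_rfl fun _ hs => hs ▸ h

/-- A loop whose test register is positive while the counter `j` of the invariant is positive. -/
theorem Runs.loop {r : ℕ} {P : Cmd} {T : ℕ} (Inv : ℕ → Store → Prop)
    (hr : ∀ j s, Inv j s → (s.reg r = 0 ↔ j = 0))
    (step : ∀ j s, Inv (j + 1) s → Runs subs P s T (Inv j)) {m : ℕ} {s : Store} (h : Inv m s) :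
    Runs subs (.loop r P) s (m * (T + 1) + 1) (Inv 0) := by
  induction m generalizing s with
  | zero => exact ⟨1, s, Exec.loop_stop ((hr 0 s h).2 rfl), by omega, h⟩
  | succ m ih =>
    obtain ⟨k, s', h₁, h₂, h₃⟩ := step m s h
    obtain ⟨l, s'', h₄, h₅, h₆⟩ := ih h₃
    refine ⟨k + l + 1, s'', .loop_step (fun h0 => ?_) h₁ h₄, ?_, h₆⟩
    · exact absurd ((hr _ _ h).1 h0) (by omega)
    · rw [Nat.succ_mul]; omega

/-- `for r P`: with register `3` holding `1`, run `P` with `r` holding `m - 1, …, 0`, where `m` is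
the initial content of `r`. -/
def forDown (r : ℕ) (P : Cmd) : Cmd := .loop r (.seq (.sub r r 3) P)

/-- `Inv j` describes the store once the indices `≥ j` have been treated. The decrement comes before
the body, so the body sees the counter at `j`; `hI` makes the invariant insensitive to that
decrement. -/
theorem Runs.forDown {r : ℕ} {P : Cmd} {T m : ℕ} {s : Store} (Inv : ℕ → Store → Prop)
    (hP : P.callFree = true) (hrP : r ∉ P.writes) (h3P : 3 ∉ P.writes) (hr3 : r ≠ 3)
    (h1 : s.reg 3 = 1) (hm : s.reg r = m) (h0 : Inv m s)
    (hI : ∀ j s x, Inv j s → Inv j (s.setReg r x))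
    (step : ∀ j < m, ∀ s', Frame (r :: P.writes) P.stores s s' → s'.reg r = j → Inv (j + 1) s' →
      Runs subs P s' T (Inv j)) :
    Runs subs (forDown r P) s (m * (T + 2) + 1) (Inv 0) := by
  have := Runs.loop (subs := subs) (r := r) (P := .seq (.sub r r 3) P) (T := 1 + T)
    (fun j s' => Frame (r :: P.writes) P.stores s s' ∧ s'.reg r = j ∧ j ≤ m ∧ Inv j s')
    (by rintro j s' ⟨-, h, -, -⟩; rw [h]) ?_ (m := m) (s := s) ⟨.refl _ _ _, hm, le_rfl, h0⟩
  · exact this.mono (by ring_nf; omega) fun _ h => h.2.2.2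
  · rintro j s' ⟨hf, hj, hjm, hi⟩
    have h3 : s'.reg 3 = 1 := by
      rw [hf.reg 3 (by simp only [List.mem_cons, not_or]; exact ⟨fun h => hr3 h.symm, h3P⟩), h1]
    have hf' := hf.trans (frame_setReg (W := r :: P.writes) (S := P.stores) s' (r := r) j
      (by simp))
    refine Runs.straight_seq (P := .sub r r 3) rfl ?_
    have he : (Cmd.sub r r 3).eval s' = s'.setReg r j := by simp [Cmd.eval, hj, h3]
    rw [he]
    refine ((step j (by omega) _ hf' (by simp [setReg_reg]) (hI _ _ _ hi)).frame hP).mono le_rfl ?_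
    rintro s'' ⟨hi', hf''⟩
    refine ⟨hf'.trans (hf''.mono (by simp +contextual) (by simp)), ?_, by omega, hi'⟩
    rw [hf''.reg r hrP]; simp [setReg_reg]

end RAM

/-! ### Neighbourhoods, components, and the value guaranteed by the branching procedure -/

namespace MWIS

open Relation

set_option linter.unusedSectionVars false

section Graph

variable {V : Type*} [Fintype V] [DecidableEq V] (G : SimpleGraph V)

/-- No two vertices of `R` are adjacent. -/
def Indep (R : Finset V) : Prop := ∀ u ∈ R, ∀ v ∈ R, ¬ G.Adj u v

theorem isIndepSet_iff (R : Finset V) : G.IsIndepSet (R : Set V) ↔ Indep G R := by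
  constructor
  · intro h u hu v hv huv
    exact h hu hv huv.ne huv
  · intro h u hu v hv _
    exact h u hu v hv

theorem Indep.mono {R S : Finset V} (h : Indep G R) (hS : S ⊆ R) : Indep G S :=
  fun u hu v hv => h u (hS hu) v (hS hv)

open Classical in
/-- Delete the closed neighbourhood of `u` from `A`. -/
noncomputable def del (A : Finset V) (u : V) : Finset V :=
  A.filter fun v => v ≠ u ∧ ¬ G.Adj u v

open Classical in
/-- The members of `A` with at most `i` neighbours in `A`. -/
noncomputable def lowDeg (A : Finset V) (i : ℕ) : Finset V :=
  A.filter fun v => (A.filter fun y => G.Adj v y).card ≤ i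

/-- Adjacency inside `A`. -/
def AdjIn (A : Finset V) (x y : V) : Prop := x ∈ A ∧ y ∈ A ∧ G.Adj x y

open Classical in
/-- The vertex set of the component of `u` in the subgraph induced by `A`, empty if `u ∉ A`. -/
noncomputable def comp (A : Finset V) (u : V) : Finset V :=
  A.filter fun v => u ∈ A ∧ ReflTransGen (AdjIn G A) u v

variable {G}

theorem mem_del {A : Finset V} {u v : V} : v ∈ del G A u ↔ v ∈ A ∧ v ≠ u ∧ ¬ G.Adj u v := by
  simp [del]

theorem mem_comp {A : Finset V} {u v : V} :
    v ∈ comp G A u ↔ v ∈ A ∧ u ∈ A ∧ ReflTransGen (AdjIn G A) u v := by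
  simp [comp]

theorem comp_subset (A : Finset V) (u : V) : comp G A u ⊆ A :=
  fun _ h => (mem_comp.1 h).1

theorem del_subset (A : Finset V) (u : V) : del G A u ⊆ A :=
  fun _ h => (mem_del.1 h).1

theorem lowDeg_subset (A : Finset V) (i : ℕ) : lowDeg G A i ⊆ A := Finset.filter_subset _ _

theorem AdjIn.symm {A : Finset V} {x y : V} (h : AdjIn G A x y) : AdjIn G A y x :=
  ⟨h.2.1, h.1, h.2.2.symm⟩

theorem reach_symm {A : Finset V} {x y : V} (h : ReflTransGen (AdjIn G A) x y) :
    ReflTransGen (AdjIn G A) y x := by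
  induction h with
  | refl => exact .refl
  | tail _ h ih => exact .head h.symm ih

theorem mem_comp_self {A : Finset V} {u : V} (h : u ∈ A) : u ∈ comp G A u :=
  mem_comp.2 ⟨h, h, .refl⟩

theorem comp_eq_of_mem {A : Finset V} {u v : V} (h : v ∈ comp G A u) : comp G A v = comp G A u := by
  obtain ⟨hv, hu, huv⟩ := mem_comp.1 h
  ext x
  simp only [mem_comp]
  exact ⟨fun ⟨hx, _, h'⟩ => ⟨hx, hu, huv.trans h'⟩,
    fun ⟨hx, _, h'⟩ => ⟨hx, hv, (reach_symm huv).trans h'⟩⟩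

theorem comp_closed {A : Finset V} {u x y : V} (hx : x ∈ comp G A u) (hy : y ∈ A)
    (h : G.Adj x y) : y ∈ comp G A u := by
  obtain ⟨hxA, hu, hux⟩ := mem_comp.1 hx
  exact mem_comp.2 ⟨hy, hu, hux.tail ⟨hxA, hy, h⟩⟩

theorem comp_empty_of_notMem {A : Finset V} {u : V} (h : u ∉ A) : comp G A u = ∅ := by
  ext x; simp [mem_comp, h]

/-- A closed set that contains `u` contains the component of `u`. -/
theorem comp_subset_of_closed {A D : Finset V} {u : V} (hu : u ∈ A → u ∈ D)
    (hD : ∀ x ∈ D, ∀ y ∈ A, G.Adj x y → y ∈ D) : comp G A u ⊆ D := by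
  intro v hv
  obtain ⟨-, huA, h⟩ := mem_comp.1 hv
  clear hv
  induction h with
  | refl => exact hu huA
  | tail _ h ih => exact hD _ ih _ h.2.1 h.2.2

theorem comp_mono {A B : Finset V} (h : A ⊆ B) (u : V) : comp G A u ⊆ comp G B u := by
  intro v hv
  obtain ⟨hv, hu, huv⟩ := mem_comp.1 hv
  exact mem_comp.2 ⟨h hv, h hu, ReflTransGen.mono (r := AdjIn G A)
    (fun x y (hxy : AdjIn G A x y) => (⟨h hxy.1, h hxy.2.1, hxy.2.2⟩ : AdjIn G B x y)) _ _ huv⟩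

variable (G) (w : V → ℕ)

/-- The weight that the branching procedure with fuel `k` guarantees on the subgraph induced by
`A`. -/
noncomputable def val : ℕ → Finset V → ℕ
  | 0, _ => 0
  | k + 1, A =>
    max (Finset.univ.sup fun u => val k (del G A u) + if u ∈ A then w u else 0)
      (max ((Finset.range (Fintype.card V)).sup fun i => val k (lowDeg G A i))
        (∑ D ∈ A.image (comp G A), val k D))

variable {G w}

/-- The branch exists also for `u ∉ A`, where it only deletes neighbours and gains nothing. This
matters when the neighbourhoods of a set are deleted one vertex at a time, since earlier deletions
may remove later members of the set. -/
theorem val_del (k : ℕ) (A : Finset V) (u : V) :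
    val G w k (del G A u) + (if u ∈ A then w u else 0) ≤ val G w (k + 1) A :=
  (Finset.le_sup (f := fun u => val G w k (del G A u) + if u ∈ A then w u else 0)
    (Finset.mem_univ u)).trans (le_max_left _ _)

theorem val_lowDeg (k : ℕ) (A : Finset V) {i : ℕ} (hi : i < Fintype.card V) :
    val G w k (lowDeg G A i) ≤ val G w (k + 1) A :=
  (Finset.le_sup (f := fun i => val G w k (lowDeg G A i)) (Finset.mem_range.2 hi)).trans
    ((le_max_left _ _).trans (le_max_right _ _))

theorem val_split (k : ℕ) (A : Finset V) :
    ∑ D ∈ A.image (comp G A), val G w k D ≤ val G w (k + 1) A :=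
  (le_max_right _ _).trans (le_max_right _ _)

variable (G w) in
/-- `R` is an independent subset of `A` with at least the weight that fuel `k` guarantees. -/
def Sol (k : ℕ) (A R : Finset V) : Prop :=
  R ⊆ A ∧ Indep G R ∧ val G w k A ≤ ∑ v ∈ R, w v

/-- Sets that solve the components are put together to a set that solves `A`. -/
theorem indep_of_comp {A R : Finset V} (hR : R ⊆ A)
    (h : ∀ v ∈ A, Indep G (R ∩ comp G A v)) : Indep G R := by
  intro x hx y hy hxy
  have hc := mem_comp_self (G := G) (hR hx)
  exact h x (hR hx) x (Finset.mem_inter.2 ⟨hx, hc⟩) y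
    (Finset.mem_inter.2 ⟨hy, comp_closed hc (hR hy) hxy⟩) hxy

/-- The components partition `A`, and passing to the image of `comp` counts each of them once
although every one of its vertices produces it. -/
theorem sum_comp {A R : Finset V} (hR : R ⊆ A) (f : V → ℕ) :
    ∑ D ∈ A.image (comp G A), ∑ v ∈ R ∩ D, f v = ∑ v ∈ R, f v := by
  rw [← Finset.sum_biUnion]
  · congr 1
    ext x
    simp only [Finset.mem_biUnion, Finset.mem_image, Finset.mem_inter]
    constructor
    · rintro ⟨D, -, hx, -⟩; exact hx
    · intro hx
      exact ⟨_, ⟨x, hR hx, rfl⟩, hx, mem_comp_self (hR hx)⟩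
  · intro D hD E hE hDE
    simp only [Finset.coe_image, Set.mem_image, Finset.mem_coe] at hD hE
    obtain ⟨d, -, rfl⟩ := hD
    obtain ⟨e, -, rfl⟩ := hE
    rw [Function.onFun, Finset.disjoint_left]
    intro x hx hx'
    exact hDE ((comp_eq_of_mem (Finset.mem_inter.1 hx).2).symm.trans
      (comp_eq_of_mem (Finset.mem_inter.1 hx').2))

end Graph

end MWIS

/-! ### The branching procedure as a program -/

namespace MWIS

open RAM

/-- Array `a` holds, from index `b` on, the characteristic vector of `A`. -/
def Holds {n : ℕ} (s : Store) (a b : ℕ) (A : Finset (Fin n)) : Prop :=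
  ∀ v : Fin n, s.arr a (b + v) ≠ 0 ↔ v ∈ A

open Classical in
/-- The part of the store that stays the same during the whole run. -/
structure Env {n : ℕ} (G : SimpleGraph (Fin n)) (w : Fin n → ℕ) (s : Store) : Prop where
  size : s.reg 0 = n
  one : s.reg 3 = 1
  stride : s.reg 6 = n + 1
  adj : ∀ u v : Fin n, s.arr 0 (n * u + v) = if G.Adj u v then 1 else 0
  weight : ∀ v : Fin n, s.arr 1 v = w v

/-- Registers `0`, `3`, `6` hold the constants `n`, `1`, `n + 1`, and arrays `0`, `1` the input; no
part of the recursion writes them. The side conditions are closed facts about lists and are settled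
by `decide`. -/
theorem Env.frame {n : ℕ} {G : SimpleGraph (Fin n)} {w : Fin n → ℕ} {s s' : Store} {W S : List ℕ}
    (h : Env G w s) (hf : Frame W S s s') (h0 : 0 ∉ W := by decide) (h3 : 3 ∉ W := by decide)
    (h6 : 6 ∉ W := by decide) (ha : 0 ∉ S := by decide) (hb : 1 ∉ S := by decide) :
    Env G w s' :=
  ⟨by rw [hf.reg 0 h0, h.size], by rw [hf.reg 3 h3, h.one], by rw [hf.reg 6 h6, h.stride],
    fun u v => by rw [hf.arr 0 ha, h.adj], fun v => by rw [hf.arr 1 hb, h.weight]⟩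

/-- Fill the cells `b + v`, `v < n`, of array `dst` with the values that `P` computes in register
`15`, where `b` is the content of register `breg` and `v` that of register `9`. -/
def fill (dst breg : ℕ) (P : Cmd) : Cmd :=
  .seq (.copy 9 0) (forDown 9 (.seq P (.seq (.add 13 breg 9) (.store dst 13 15))))

variable {subs : List Cmd} {n : ℕ}

/-- While cell `b + v` is being computed, that cell and everything outside the block still have
their old content. This is what lets `P` read a set stored elsewhere in the destination array, or
the old value of the very cell to be overwritten. -/
theorem runs_fill {s : Store} {dst breg b T : ℕ} {P : Cmd} {B : Finset (Fin n)}
    (hP : P.callFree = true) (h9 : 9 ∉ P.writes) (h3 : 3 ∉ P.writes) (hb : breg ∉ P.writes)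
    (hb9 : breg ≠ 9) (hb13 : breg ≠ 13) (hS : P.stores = [])
    (s0 : s.reg 0 = n) (s3 : s.reg 3 = 1) (sb : s.reg breg = b)
    (H : ∀ v : Fin n, ∀ s', Frame (9 :: 13 :: P.writes) [dst] s s' → s'.reg 9 = v →
      (∀ i, (i < b ∨ b + n ≤ i ∨ i = b + v) → s'.arr dst i = s.arr dst i) →
      Runs subs P s' T fun s'' => s''.reg 15 ≠ 0 ↔ v ∈ B) :
    Runs subs (fill dst breg P) s (n * (T + 4) + 2) fun s' =>
      Holds s' dst b B ∧ ∀ i, (i < b ∨ b + n ≤ i) → s'.arr dst i = s.arr dst i := by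
  have hfr : Frame [9] [] s ((Cmd.copy 9 0).eval s) := frame_setReg _ _ (by simp)
  refine (Runs.straight_seq (T := n * (T + 4) + 1) rfl ?_).mono (by simp only [Cmd.len]; omega)
    fun _ h => h
  refine (Runs.forDown (T := T + 2) (fun j s' => (∀ v : Fin n, j ≤ v →
      (s'.arr dst (b + v) ≠ 0 ↔ v ∈ B)) ∧
      ∀ i, (i < b + j ∨ b + n ≤ i) → s'.arr dst i = s.arr dst i) ?_ ?_ ?_ (by simp)
      ?_ (m := n) ?_ ?_ (fun _ _ _ h => h) ?_).mono le_rfl ?_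
  · simp [Cmd.callFree, hP]
  · simp [Cmd.writes, h9]
  · simp [Cmd.writes, h3]
  · simp [Cmd.eval, setReg_reg, s3]
  · simp [Cmd.eval, setReg_reg, s0]
  · exact ⟨fun v hv => absurd v.2 (by omega), fun i _ => rfl⟩
  · rintro j hj s' hf hj' ⟨h₁, h₂⟩
    have hf' : Frame (9 :: 13 :: P.writes) [dst] s s' := by
      refine (hfr.mono (by simp) (by simp)).trans (hf.mono ?_ ?_)
      · intro r hr; simp only [Cmd.writes, List.mem_cons, List.mem_append] at hr ⊢; simp at hr; tauto
      · intro r hr; simpa [Cmd.stores, hS] using hr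
    refine ((H ⟨j, hj⟩ s' hf' hj' fun i hi => h₂ i (by simp only at hi; omega)).frame hP).seq ?_
    rintro s'' ⟨h15, hf''⟩
    have e9 : s''.reg 9 = j := by rw [hf''.reg 9 h9, hj']
    have eb : s''.reg breg = b := by
      rw [hf''.reg breg hb, hf'.reg breg (by simp [hb9, hb13, hb]), sb]
    have ed : s''.arr dst = s'.arr dst := hf''.arr _ (by simp [hS])
    refine Runs.straight (P := .seq (.add 13 breg 9) (.store dst 13 15)) rfl ⟨?_, ?_⟩
    · intro v hv
      simp only [Cmd.eval, setArr_arr, setReg_reg, setReg_arr, true_and, if_true, e9, eb, ed]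
      by_cases hvj : (v : ℕ) = j
      · rw [if_pos (by omega), if_neg (by omega), h15]
        rw [show v = ⟨j, hj⟩ from Fin.ext hvj]
      · rw [if_neg (by omega), h₁ v (by omega)]
    · intro i hi
      simp only [Cmd.eval, setArr_arr, setReg_reg, setReg_arr, true_and, if_true, e9, eb, ed]
      rw [if_neg (by omega), h₂ i (by omega)]
  · rintro s' ⟨h₁, h₂⟩
    exact ⟨fun v => h₁ v (Nat.zero_le _), fun i hi => h₂ i (by omega)⟩

/-- Put the adjacency of the vertices held by the registers `x` and `y` into register `12`. -/
def adjC (x y : ℕ) : Cmd :=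
  .seq (.seq (.const 19 0) (.copy 18 x)) (.seq (forDown 18 (.add 19 19 0))
    (.seq (.add 19 19 y) (.load 12 0 19)))

open Classical in
-- Without multiplication the address `n * u + v` costs `u` additions of `n`, whence a linear time
-- bound for one adjacency query. The loop invariant is written as a sum to avoid truncated
-- subtraction.
theorem runs_adjC {G : SimpleGraph (Fin n)} {w : Fin n → ℕ} {s : Store} (hE : Env G w s)
    {x y : ℕ} (hx : x ∉ [12, 18, 19]) (hy : y ∉ [12, 18, 19]) {u v : Fin n} (hu : s.reg x = u)
    (hv : s.reg y = v) :
    Runs subs (adjC x y) s (3 * n + 5) fun s' =>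
      (s'.reg 12 = if G.Adj u v then 1 else 0) ∧ Frame [12, 18, 19] [] s s' := by
  simp only [List.mem_cons, List.not_mem_nil, or_false, not_or] at hx hy
  have hmain : Runs subs (adjC x y) s (3 * n + 5) fun s' =>
      s'.reg 12 = if G.Adj u v then 1 else 0 := by
    refine (Runs.straight_seq (T := (u * 3 + 1) + 2) rfl ?_).mono
      (by simp only [Cmd.len]; omega) fun _ h => h
    refine ((Runs.forDown (T := 1) (fun j s' => s'.reg 19 + n * j = n * u) rfl (by simp [Cmd.writes])
      (by simp [Cmd.writes]) (by simp) ?_ (m := u) ?_ ?_ ?_ ?_).frame rfl).seq ?_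
    · simp [Cmd.eval, setReg_reg, hE.one]
    · simp [Cmd.eval, setReg_reg, hx, hu]
    · simp [Cmd.eval, setReg_reg]
    · rintro j s' x' h; simpa [setReg_reg] using h
    · rintro j hj s' hf hj' h
      refine Runs.straight (P := .add 19 19 0) rfl ?_
      have : s'.reg 0 = n := by
        rw [hf.reg 0 (by decide)]; simp [Cmd.eval, setReg_reg, hE.size]
      simp only [Cmd.eval, setReg_reg, if_true, this]
      rw [← h]; ring
    · rintro s' ⟨h, hf⟩
      refine Runs.straight (P := .seq (.add 19 19 y) (.load 12 0 19)) rfl ?_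
      have e1 : s'.reg y = v := by
        rw [hf.reg y (by simp [forDown, Cmd.writes, hy])]; simp [Cmd.eval, setReg_reg, hy, hv]
      have e2 : s'.arr = s.arr := by
        funext a; rw [hf.arr a (by simp [forDown, Cmd.stores])]; simp [Cmd.eval]
      simp only [Cmd.eval, setReg_reg, if_true, setReg_arr, e1, e2]
      rw [← hE.adj u v, ← h]; simp
  refine (hmain.frame rfl).mono le_rfl fun s' h => ⟨h.1, h.2.mono ?_ (by simp [adjC, forDown, Cmd.stores])⟩
  simp [adjC, forDown, Cmd.writes]

end MWIS

/-! ### Subroutines for deleting a closed neighbourhood and for restricting to low degree. -/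

namespace MWIS

open RAM

variable {subs : List Cmd} {n : ℕ} {G : SimpleGraph (Fin n)} {w : Fin n → ℕ}

theorem Holds.of_eq {s s' : Store} {a b : ℕ} {A : Finset (Fin n)} (h : Holds s a b A)
    (he : ∀ i, b ≤ i → i < b + n → s'.arr a i = s.arr a i) : Holds s' a b A := fun v => by
  rw [he _ (by omega) (by omega)]; exact h v

/-- Put `A \ N[u]` into the child cells, where register `7` holds `u`. -/
def delC : Cmd :=
  fill 3 8 (.seq (.seq (.add 13 5 9) (.load 15 3 13)) (.seq (adjC 7 9)
    (.seq (.ite 12 (.const 15 0) .skip) (.seq (.sub 12 7 9) (.seq (.sub 13 9 7)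
      (.seq (.add 12 12 13) (.ite 12 .skip (.const 15 0))))))))

theorem runs_delC {s : Store} (hE : Env G w s) {base cb : ℕ} (h5 : s.reg 5 = base)
    (h8 : s.reg 8 = cb) (hcb : cb + n ≤ base) {u : Fin n} (h7 : s.reg 7 = u)
    {A : Finset (Fin n)} (hA : Holds s 3 base A) :
    Runs subs delC s (30 * (n + 1) ^ 2) fun s' => Holds s' 3 cb (del G A u) ∧
      ∀ i, (i < cb ∨ cb + n ≤ i) → s'.arr 3 i = s.arr 3 i := by
  refine (runs_fill (b := cb) (B := del G A u) (T := 3 * n + 25) rfl (by decide) (by decide)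
    (by decide) (by decide) (by decide) (by decide) hE.size hE.one h8 ?_).mono ?_ fun _ h => h
  · intro v s' hf h9 hi
    have hE' := hE.frame hf
    refine (Runs.straight_seq (T := 3 * n + 20) rfl ?_).mono (by simp only [Cmd.len]; omega)
      fun _ h => h
    set s₁ := Cmd.eval (.seq (.add 13 5 9) (.load 15 3 13)) s' with hs₁
    have hf₁ : Frame [13, 15] [] s' s₁ :=
      (frame_setReg _ _ (by simp)).trans (frame_setReg _ _ (by simp))
    have h15 : s₁.reg 15 ≠ 0 ↔ v ∈ A := by
      rw [hs₁]
      simp only [Cmd.eval, setReg_reg, setReg_arr, if_true]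
      rw [hf.reg 5 (by decide), h5, h9, hi _ (by omega)]
      exact hA v
    have h7' : s₁.reg 7 = u := by rw [hf₁.reg 7 (by decide), hf.reg 7 (by decide), h7]
    have h9' : s₁.reg 9 = v := by rw [hf₁.reg 9 (by decide), h9]
    refine ((runs_adjC (hE'.frame hf₁) (by decide) (by decide) h7' h9').seq (T' := 15) ?_)
    rintro s₂ ⟨h12, hf₂⟩
    have h15' : s₂.reg 15 ≠ 0 ↔ v ∈ A := by rw [hf₂.reg 15 (by decide), h15]
    have h7'' : s₂.reg 7 = u := by rw [hf₂.reg 7 (by decide), h7']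
    have h9'' : s₂.reg 9 = v := by rw [hf₂.reg 9 (by decide), h9']
    refine (Runs.straight rfl ?_).mono (by simp only [Cmd.len]; omega) fun _ h => h
    rw [mem_del, ← h15', ne_eq v u, Fin.ext_iff]
    by_cases had : G.Adj u v
    · simp [Cmd.eval, setReg_reg, ite_reg, h12, had, h7'', h9'']
    · by_cases huv : (v : ℕ) = u
      · simp [Cmd.eval, setReg_reg, h12, had, h7'', h9'', huv]
      -- With truncated subtraction, `(u - v) + (v - u)` vanishes exactly when `u = v`; this is the
      -- equality test used by the program.
      · have : ¬ ((u : ℕ) - v = 0 ∧ (v : ℕ) - u = 0) := by omega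
        simp [Cmd.eval, setReg_reg, h12, had, h7'', h9'', huv, this]
  · nlinarith

/-- Put the members of `A` with at most `u` neighbours in `A` into the child cells, where register
`7` holds `u`. -/
def degC : Cmd :=
  fill 3 8 (.seq (.seq (.add 13 5 9) (.load 15 3 13)) (.ite 15
    (.seq (.seq (.add 16 7 3) (.copy 10 0)) (.seq (forDown 10
      (.seq (.seq (.add 13 5 10) (.load 14 3 13))
        (.ite 14 (.seq (adjC 9 10) (.sub 16 16 12)) .skip))) (.copy 15 16))) .skip))

open Classical in
theorem card_filter_step (A : Finset (Fin n)) (p : Fin n → Prop) {j : ℕ} (hj : j < n) :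
    (A.filter fun y : Fin n => j ≤ (y : ℕ) ∧ p y).card =
      (A.filter fun y : Fin n => j + 1 ≤ (y : ℕ) ∧ p y).card +
        if (⟨j, hj⟩ : Fin n) ∈ A ∧ p ⟨j, hj⟩ then 1 else 0 := by
  simp only [Finset.card_filter]
  rw [show (if (⟨j, hj⟩ : Fin n) ∈ A ∧ p ⟨j, hj⟩ then 1 else 0) =
      ∑ y ∈ A, if y = ⟨j, hj⟩ ∧ p ⟨j, hj⟩ then 1 else 0 by
    by_cases hp : p ⟨j, hj⟩ <;> simp [hp], ← Finset.sum_add_distrib]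
  refine Finset.sum_congr rfl fun y _ => ?_
  by_cases hy : y = ⟨j, hj⟩
  · subst hy; simp
  · have : (y : ℕ) ≠ j := fun h => hy (Fin.ext h)
    simp only [hy, false_and, if_false, add_zero]
    congr 1
    simp only [eq_iff_iff, and_congr_left_iff]
    intro _; omega

/-- The counter starts at `u + 1` and loses one for each neighbour in `A`. Truncation holds it at
`0` from then on, so it ends nonzero exactly when there are at most `u` neighbours. -/
theorem runs_degC {s : Store} (hE : Env G w s) {base cb : ℕ} (h5 : s.reg 5 = base)
    (h8 : s.reg 8 = cb) (hcb : cb + n ≤ base) {u : ℕ} (h7 : s.reg 7 = u)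
    {A : Finset (Fin n)} (hA : Holds s 3 base A) :
    Runs subs degC s (30 * (n + 1) ^ 3) fun s' => Holds s' 3 cb (lowDeg G A u) ∧
      ∀ i, (i < cb ∨ cb + n ≤ i) → s'.arr 3 i = s.arr 3 i := by
  classical
  refine (runs_fill (b := cb) (B := lowDeg G A u) (T := (n * (3 * n + 15) + 10)) rfl (by decide)
    (by decide) (by decide) (by decide) (by decide) (by decide) hE.size hE.one h8 ?_).mono ?_
    fun _ h => h
  · intro v s' hf h9 hi
    have hE' := hE.frame hf
    refine (Runs.straight_seq (T := n * (3 * n + 15) + 8) rfl ?_).mono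
      (by simp only [Cmd.len]; omega) fun _ h => h
    set s₁ := Cmd.eval (.seq (.add 13 5 9) (.load 15 3 13)) s' with hs₁
    have hf₁ : Frame [13, 15] [] s' s₁ :=
      (frame_setReg _ _ (by simp)).trans (frame_setReg _ _ (by simp))
    have h5' : s₁.reg 5 = base := by rw [hf₁.reg 5 (by decide), hf.reg 5 (by decide), h5]
    have hA₁ : Holds s₁ 3 base A := hA.of_eq fun i h _ => by
      rw [hf₁.arr 3 (by decide), hi _ (by omega)]
    have h15 : s₁.reg 15 ≠ 0 ↔ v ∈ A := by
      rw [hs₁]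
      simp only [Cmd.eval, setReg_reg, setReg_arr, if_true]
      rw [hf.reg 5 (by decide), h5, h9, hi _ (by omega)]
      exact hA v
    refine Runs.ite (T := n * (3 * n + 15) + 7) (fun h => ?_) fun h => ?_
    · have hv : v ∈ A := h15.1 h
      have hf₂ : Frame [16, 10] [] s₁ (Cmd.eval (.seq (.add 16 7 3) (.copy 10 0)) s₁) :=
        (frame_setReg _ _ (by simp)).trans (frame_setReg _ _ (by simp))
      refine (Runs.straight_seq (T := n * (3 * n + 15) + 2) rfl ?_).mono
        (by simp only [Cmd.len]; omega) fun _ h => h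
      have hE₂ := (hE'.frame hf₁).frame hf₂
      refine Runs.mono (T := n * ((3 * n + 10) + 2) + 1 + 1) (Runs.seq (T' := 1)
        (Q := fun s' => s'.reg 16 = u + 1 - (A.filter fun y : Fin n => 0 ≤ (y : ℕ) ∧ G.Adj v y).card)
        (Runs.forDown (T := 3 * n + 10) (m := n) (fun j s' =>
          s'.reg 16 = u + 1 - (A.filter fun y : Fin n => j ≤ (y : ℕ) ∧ G.Adj v y).card) rfl
        (by decide) (by decide) (by decide) hE₂.one ?_ ?_ ?_ ?_) ?_) (by ring_nf; omega)
        fun _ h => h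
      · simp [Cmd.eval, setReg_reg, (hE'.frame hf₁).size]
      · have e0 : (A.filter fun y : Fin n => n ≤ (y : ℕ) ∧ G.Adj v y).card = 0 := by
          rw [Finset.card_eq_zero, Finset.filter_eq_empty_iff]
          intro y _ h; have := y.2; omega
        rw [e0]
        have : s₁.reg 7 = u := by rw [hf₁.reg 7 (by decide), hf.reg 7 (by decide), h7]
        simp [Cmd.eval, setReg_reg, this, (hE'.frame hf₁).one]
      · intro j s' x h; simpa [setReg_reg] using h
      · intro j hj s₃ hf₃ h10 h16
        have hE₃ := hE₂.frame hf₃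
        refine (Runs.straight_seq (T := 3 * n + 7) rfl ?_).mono
          (by simp only [Cmd.len]; omega) fun _ h => h
        set s₄ := Cmd.eval (.seq (.add 13 5 10) (.load 14 3 13)) s₃ with hs₄
        have hf₄ : Frame [13, 14] [] s₃ s₄ :=
          (frame_setReg _ _ (by simp)).trans (frame_setReg _ _ (by simp))
        have h14 : s₄.reg 14 ≠ 0 ↔ (⟨j, hj⟩ : Fin n) ∈ A := by
          rw [hs₄]
          simp only [Cmd.eval, setReg_reg, setReg_arr, if_true]
          rw [hf₃.reg 5 (by decide), hf₂.reg 5 (by decide), h5', h10, hf₃.arr 3 (by decide),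
            hf₂.arr 3 (by decide)]
          exact hA₁ ⟨j, hj⟩
        have h16' : s₄.reg 16 = u + 1 - (A.filter fun y : Fin n => j + 1 ≤ (y : ℕ) ∧ G.Adj v y).card := by
          rw [hf₄.reg 16 (by decide), h16]
        refine Runs.ite (T := 3 * n + 6) (fun h => ?_) fun h => ?_
        · have h9' : s₄.reg 9 = v := by
            rw [hf₄.reg 9 (by decide), hf₃.reg 9 (by decide), hf₂.reg 9 (by decide),
              hf₁.reg 9 (by decide), h9]
          have h10' : s₄.reg 10 = (⟨j, hj⟩ : Fin n) := by rw [hf₄.reg 10 (by decide), h10]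
          refine ((runs_adjC (hE₃.frame hf₄) (by decide) (by decide) h9' h10').seq (T' := 1) ?_)
          rintro s₅ ⟨h12, hf₅⟩
          refine Runs.straight (P := .sub 16 16 12) rfl ?_
          simp only [Cmd.eval, setReg_reg, if_true, h12, hf₅.reg 16 (by decide), h16']
          rw [card_filter_step A _ hj]
          simp only [h14.1 h, true_and]
          omega
        · refine (Runs.straight (P := .skip) rfl ?_).mono (by simp [Cmd.len]) fun _ h => h
          simp only [Cmd.eval, h16']
          rw [card_filter_step A _ hj, if_neg (fun h' => h14.2 h'.1 h), add_zero]
      · intro s₃ h16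
        refine Runs.straight (P := .copy 15 16) rfl ?_
        simp only [Cmd.eval, setReg_reg, if_true, h16, lowDeg, Finset.mem_filter, hv, true_and,
          Nat.zero_le]
        have : (A.filter fun y : Fin n => G.Adj v y).card = (A.filter (G.Adj v)).card := by congr
        omega
    · refine (Runs.straight (P := .skip) rfl ?_).mono (by simp [Cmd.len]) fun _ h => h
      simp only [Cmd.eval]
      exact ⟨fun h' => absurd h h', fun h' => absurd (h15.2 (lowDeg_subset _ _ h')) (by simp [h])⟩
  · nlinarith [Nat.zero_le (n ^ 3), Nat.zero_le (n ^ 2)]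

end MWIS

/-! ### Subroutine for the component of a vertex. -/

namespace MWIS

open RAM

variable {subs : List Cmd} {n : ℕ} {G : SimpleGraph (Fin n)} {w : Fin n → ℕ}

/-- If register `9` holds a vertex of the child cells and register `10` a neighbour of it in the
current set, put that neighbour into the child cells. -/
def growC : Cmd :=
  .seq (.seq (.add 13 8 9) (.load 15 3 13)) (.ite 15
    (.seq (.seq (.add 13 5 10) (.load 15 3 13)) (.ite 15
      (.seq (adjC 9 10) (.ite 12 (.seq (.add 13 8 10) (.store 3 13 3)) .skip)) .skip)) .skip)

/-- The child cells hold a set between `D` and `C`, and other cells of array `3` are as in `s`. -/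
def Between (s : Store) (cb : ℕ) (D C : Finset (Fin n)) (p : Finset (Fin n) → Prop)
    (s' : Store) : Prop :=
  (∃ D', Holds s' 3 cb D' ∧ D ⊆ D' ∧ D' ⊆ C ∧ p D') ∧
    ∀ i, (i < cb ∨ cb + n ≤ i) → s'.arr 3 i = s.arr 3 i

theorem runs_growC {s : Store} (hE : Env G w s) {base cb : ℕ} (h5 : s.reg 5 = base)
    (h8 : s.reg 8 = cb) {x y : Fin n} (h9 : s.reg 9 = x)
    (h10 : s.reg 10 = y) {A C D : Finset (Fin n)} (hA : Holds s 3 base A) (hD : Holds s 3 cb D)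
    (hDC : D ⊆ C) (hC : ∀ x ∈ C, ∀ y ∈ A, G.Adj x y → y ∈ C) :
    Runs subs growC s (3 * n + 20)
      (Between s cb D C fun D' => x ∈ D → y ∈ A → G.Adj x y → y ∈ D') := by
  refine (Runs.straight_seq (T := 3 * n + 15) rfl ?_).mono (by simp only [Cmd.len]; omega)
    fun _ h => h
  set s₁ := Cmd.eval (.seq (.add 13 8 9) (.load 15 3 13)) s with hs₁
  have hf₁ : Frame [13, 15] [] s s₁ :=
    (frame_setReg _ _ (by simp)).trans (frame_setReg _ _ (by simp))
  have hx : s₁.reg 15 ≠ 0 ↔ x ∈ D := by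
    rw [hs₁]
    simp only [Cmd.eval, setReg_reg, setReg_arr, if_true]
    rw [h8, h9]
    exact hD x
  have stay : ∀ s', s'.arr = s.arr → (x ∈ D → y ∈ A → G.Adj x y → False) →
      Between s cb D C (fun D' => x ∈ D → y ∈ A → G.Adj x y → y ∈ D') s' := fun s' he hn =>
    ⟨⟨D, fun v => by rw [he]; exact hD v, subset_rfl, hDC, fun h₁ h₂ h₃ => (hn h₁ h₂ h₃).elim⟩,
      fun _ _ => by rw [he]⟩
  have ha₁ : s₁.arr = s.arr := rfl
  refine Runs.ite (T := 3 * n + 14) (fun h => ?_) fun h => ?_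
  swap
  · refine (Runs.straight (P := .skip) rfl ?_).mono (by simp [Cmd.len]) fun _ h => h
    exact stay _ rfl fun h' => absurd (hx.2 h') (by simp [h])
  have hxD := hx.1 h
  refine (Runs.straight_seq (T := 3 * n + 12) rfl ?_).mono (by simp only [Cmd.len]; omega)
    fun _ h => h
  set s₂ := Cmd.eval (.seq (.add 13 5 10) (.load 15 3 13)) s₁ with hs₂
  have hf₂ : Frame [13, 15] [] s s₂ := hf₁.trans
    ((frame_setReg _ _ (by simp)).trans (frame_setReg _ _ (by simp)))
  have hy : s₂.reg 15 ≠ 0 ↔ y ∈ A := by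
    rw [hs₂]
    simp only [Cmd.eval, setReg_reg, setReg_arr, if_true]
    rw [hf₁.reg 5 (by decide), hf₁.reg 10 (by decide), h5, h10]
    exact hA y
  refine Runs.ite (T := 3 * n + 11) (fun h => ?_) fun h => ?_
  swap
  · refine (Runs.straight (P := .skip) rfl ?_).mono (by simp [Cmd.len]) fun _ h => h
    exact stay _ rfl fun _ h' => absurd (hy.2 h') (by simp [h])
  have hyA := hy.1 h
  refine ((runs_adjC (u := x) (v := y) (hE.frame hf₂) (by decide) (by decide)
    (by rw [hf₂.reg 9 (by decide), h9]) (by rw [hf₂.reg 10 (by decide), h10])).seq (T' := 4) ?_).mono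
      (by omega) fun _ h => h
  rintro s₃ ⟨h12, hf₃'⟩
  have hf₃ : Frame [12, 13, 15, 18, 19] [] s s₃ :=
    (hf₂.mono (by simp) (by simp)).trans (hf₃'.mono (by simp) (by simp))
  have ha₃ : s₃.arr = s.arr := by funext a; exact hf₃.arr a (by simp)
  refine Runs.ite (T := 3) (fun h => ?_) fun h => ?_
  swap
  · exact (Runs.straight (P := .skip) rfl
      (stay _ ha₃ fun _ _ h' => by rw [if_pos h', h] at h12; cases h12)).mono
      (by simp [Cmd.len]) fun _ h => h
  have hxy : G.Adj x y := by
    by_contra hn; rw [if_neg hn] at h12; exact h h12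
  refine (Runs.straight (P := .seq (.add 13 8 10) (.store 3 13 3)) rfl
    ⟨⟨insert y D, fun v => ?_, Finset.subset_insert _ _, ?_, fun _ _ _ =>
      Finset.mem_insert_self _ _⟩, fun i hi => ?_⟩).mono (by simp [Cmd.len]) fun _ h => h
  · simp only [Cmd.eval, setArr_arr, setReg_reg, setReg_arr, true_and, if_true,
      hf₃.reg 8 (by decide), hf₃.reg 10 (by decide), hf₃.reg 3 (by decide), h8, h10, hE.one, ha₃,
      Finset.mem_insert]
    by_cases hvy : v = y
    · simp [hvy]
    · rw [if_neg (fun h => hvy (Fin.ext (by omega)))]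
      simp [hvy, hD v]
  · exact Finset.insert_subset (hC x (hDC hxD) y hyA hxy) hDC
  · simp only [Cmd.eval, setArr_arr, setReg_reg, setReg_arr, true_and, if_true,
      hf₃.reg 8 (by decide), hf₃.reg 10 (by decide), h8, h10, ha₃]
    rw [if_neg (by omega)]

/-- Add to the child cells all neighbours, in the current set, of vertices in the child cells. -/
def roundC : Cmd :=
  .seq (.copy 9 0) (forDown 9 (.seq (.copy 10 0) (forDown 10 growC)))

/-- A vertex added during the round may itself be expanded later in the same round, so the resulting
set depends on the order of the vertices. It is therefore only bracketed: it contains all neighbours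
in `A` of the old set and stays inside any closed set `C` around it. -/
theorem runs_roundC {s : Store} (hE : Env G w s) {base cb : ℕ} (h5 : s.reg 5 = base)
    (h8 : s.reg 8 = cb) (hcb : cb + n ≤ base) {A C D : Finset (Fin n)} (hA : Holds s 3 base A)
    (hD : Holds s 3 cb D) (hDC : D ⊆ C) (hC : ∀ x ∈ C, ∀ y ∈ A, G.Adj x y → y ∈ C) :
    Runs subs roundC s (n * (n * (3 * n + 22) + 4) + 2)
      (Between s cb D C fun D' => ∀ x ∈ D, ∀ y ∈ A, G.Adj x y → y ∈ D') := by
  have hf₀ : Frame [9] [] s ((Cmd.copy 9 0).eval s) := frame_setReg _ _ (by simp)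
  refine (Runs.straight_seq (T := n * (n * (3 * n + 22) + 2 + 2) + 1) rfl ?_).mono
    (by simp only [Cmd.len, add_assoc, Nat.reduceAdd]; omega) fun _ h => h
  refine (Runs.forDown (T := n * (3 * n + 22) + 2) (m := n) (fun j => Between s cb D C fun D' =>
    ∀ x : Fin n, j ≤ x → x ∈ D → ∀ y ∈ A, G.Adj x y → y ∈ D') rfl (by decide) (by decide)
    (by decide) (hE.frame hf₀).one ?_ ?_ (fun _ _ _ h => h) ?_).mono le_rfl ?_
  · simp [Cmd.eval, setReg_reg, hE.size]
  · exact ⟨⟨D, hD, subset_rfl, hDC, fun x hx => absurd x.2 (by omega)⟩, fun _ _ => rfl⟩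
  · rintro j hj s₁ hf₁' h9 ⟨⟨D₁, hD₁, hDD₁, hDC₁, hx₁⟩, hi₁⟩
    have hf₁ := (hf₀.mono (W' := 9 :: (Cmd.seq (.copy 10 0) (forDown 10 growC)).writes)
      (S' := (Cmd.seq (.copy 10 0) (forDown 10 growC)).stores) (by simp) (by simp)).trans hf₁'
    have hf₂' : Frame [10] [] s₁ ((Cmd.copy 10 0).eval s₁) := frame_setReg _ _ (by simp)
    have hf₂ := hf₁.trans (hf₂'.mono (by decide) (by decide))
    have hE₂ := hE.frame hf₂
    refine (Runs.straight_seq (T := n * (3 * n + 20 + 2) + 1) rfl ?_).mono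
      (by simp only [Cmd.len, add_assoc, Nat.reduceAdd]; omega) fun _ h => h
    refine (Runs.forDown (T := 3 * n + 20) (m := n) (fun l => Between s cb D₁ C fun D' =>
      ∀ y : Fin n, l ≤ y → (⟨j, hj⟩ : Fin n) ∈ D₁ → y ∈ A → G.Adj ⟨j, hj⟩ y → y ∈ D') rfl (by decide)
      (by decide) (by decide) hE₂.one ?_ ?_ (fun _ _ _ h => h) ?_).mono le_rfl ?_
    · simp [Cmd.eval, setReg_reg, (hE.frame hf₁).size]
    · exact ⟨⟨D₁, hD₁, subset_rfl, hDC₁, fun y hy => absurd y.2 (by omega)⟩, hi₁⟩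
    · rintro l hl s₃ hf₃' h10 ⟨⟨D₃, hD₃, hDD₃, hDC₃, hx₃⟩, hi₃⟩
      have hf₃ := hf₂.trans (hf₃'.mono (by decide) (by decide))
      refine (runs_growC (x := ⟨j, hj⟩) (y := ⟨l, hl⟩) (hE.frame hf₃) (base := base) (cb := cb)
        (by rw [hf₃.reg 5 (by decide), h5]) (by rw [hf₃.reg 8 (by decide), h8]) ?_ h10
        (hA.of_eq fun i h _ => hi₃ i (by omega)) hD₃ hDC₃ hC).mono le_rfl ?_
      · rw [hf₃'.reg 9 (by decide), hf₂'.reg 9 (by decide), h9]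
      · rintro s₄ ⟨⟨D₄, hD₄, hDD₄, hDC₄, hx₄⟩, hi₄⟩
        refine ⟨⟨D₄, hD₄, hDD₃.trans hDD₄, hDC₄, fun y hy hjD hyA hjy => ?_⟩,
          fun i hi => (hi₄ i hi).trans (hi₃ i hi)⟩
        by_cases hyl : y = ⟨l, hl⟩
        · subst hyl; exact hx₄ (hDD₃ hjD) hyA hjy
        · have : (y : ℕ) ≠ l := fun h => hyl (Fin.ext h)
          exact hDD₄ (hx₃ y (by omega) hjD hyA hjy)
    · rintro s₃ ⟨⟨D₃, hD₃, hDD₃, hDC₃, hx₃⟩, hi₃⟩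
      refine ⟨⟨D₃, hD₃, hDD₁.trans hDD₃, hDC₃, fun x hx hxD y hyA hxy => ?_⟩, hi₃⟩
      by_cases hxj : x = ⟨j, hj⟩
      · subst hxj; exact hx₃ y (Nat.zero_le _) (hDD₁ hxD) hyA hxy
      · have : (x : ℕ) ≠ j := fun h => hxj (Fin.ext h)
        exact hDD₃ (hx₁ x (by omega) hxD y hyA hxy)
  · rintro s' ⟨⟨D', h₁, h₂, h₃, h₄⟩, h₅⟩
    exact ⟨⟨D', h₁, h₂, h₃, fun x => h₄ x (Nat.zero_le _)⟩, h₅⟩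

/-- Put the component of `u` in `A` into the child cells, where register `7` holds `u`. -/
def compC : Cmd :=
  .seq (fill 3 8 (.seq (.sub 12 7 9) (.seq (.sub 13 9 7) (.seq (.add 12 12 13)
    (.ite 12 (.const 15 0) (.seq (.add 13 5 9) (.load 15 3 13)))))))
    (.seq (.copy 11 0) (forDown 11 roundC))

/-- Starting from `{u} ∩ A`, each round leaves a closed set or adds at least one vertex. After `n`
rounds the second alternative would give `n + 1` vertices, so the set is closed, and a closed set
between `{u} ∩ A` and the component is the component. If `u ∉ A`, the set is empty and closed from
the start. -/
theorem runs_compC {s : Store} (hE : Env G w s) {base cb : ℕ} (h5 : s.reg 5 = base)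
    (h8 : s.reg 8 = cb) (hcb : cb + n ≤ base) {u : Fin n} (h7 : s.reg 7 = u)
    {A : Finset (Fin n)} (hA : Holds s 3 base A) :
    Runs subs compC s (40 * (n + 1) ^ 4) fun s' => Holds s' 3 cb (comp G A u) ∧
      ∀ i, (i < cb ∨ cb + n ≤ i) → s'.arr 3 i = s.arr 3 i := by
  have hC : ∀ x ∈ comp G A u, ∀ y ∈ A, G.Adj x y → y ∈ comp G A u :=
    fun x hx y hy hxy => comp_closed hx hy hxy
  refine Runs.mono (T := (n * (8 + 4) + 2) + (1 + (n * ((n * (n * (3 * n + 22) + 4) + 2) + 2) + 1)))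
    (Runs.seq ((runs_fill (b := cb) (B := A.filter (· = u)) (T := 8) rfl (by decide) (by decide)
    (by decide) (by decide) (by decide) (by decide) hE.size hE.one h8 ?_).frame rfl) ?_) ?_
    fun _ h => h
  · intro v s' hf h9 hi
    refine (Runs.straight rfl ?_).mono (by simp only [Cmd.len]; omega) fun _ h => h
    have e7 : s'.reg 7 = u := by rw [hf.reg 7 (by decide), h7]
    have e5 : s'.reg 5 = base := by rw [hf.reg 5 (by decide), h5]
    rw [Finset.mem_filter, Fin.ext_iff, ← hA v]
    by_cases huv : (v : ℕ) = u
    · simp [Cmd.eval, setReg_reg, e7, e5, h9, huv, hi (base + u) (by omega)]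
    · have : ¬ ((u : ℕ) - v = 0 ∧ (v : ℕ) - u = 0) := by omega
      simp [Cmd.eval, setReg_reg, e7, h9, huv, this]
  · rintro s₁ ⟨⟨hD, hi₁⟩, hf₁⟩
    refine (Runs.straight_seq rfl ?_).mono (by simp only [Cmd.len]; exact le_rfl) fun _ h => h
    have hf₂' : Frame [11] [] s₁ ((Cmd.copy 11 0).eval s₁) := frame_setReg _ _ (by simp)
    have hf₂ := (hf₁.mono (W' := 11 :: compC.writes) (S' := compC.stores) (by decide)
      (by decide)).trans (hf₂'.mono (by decide) (by decide))
    refine (Runs.forDown (T := n * (n * (3 * n + 22) + 4) + 2) (m := n)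
      (fun j => Between s cb (A.filter (· = u)) (comp G A u) fun D' =>
        (∀ x ∈ D', ∀ y ∈ A, G.Adj x y → y ∈ D') ∨ (n - j) + 1 ≤ D'.card) rfl (by decide) (by decide)
      (by decide) (hE.frame hf₂).one ?_ ?_ (fun _ _ _ h => h) ?_).mono le_rfl ?_
    · simp [Cmd.eval, setReg_reg, (hE.frame hf₁).size]
    · refine ⟨⟨_, hD, subset_rfl, ?_, ?_⟩, hi₁⟩
      · intro x hx
        obtain ⟨hxA, rfl⟩ := Finset.mem_filter.1 hx
        exact mem_comp_self hxA
      · by_cases hu : u ∈ A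
        · right
          have : u ∈ A.filter (· = u) := by simp [hu]
          have := Finset.card_pos.2 ⟨u, this⟩
          omega
        · left
          intro x hx
          obtain ⟨hxA, rfl⟩ := Finset.mem_filter.1 hx
          exact absurd hxA hu
    · rintro j hj s₃ hf₃' h11 ⟨⟨D, hD, huD, hDC, hx⟩, hi₃⟩
      have hf₃ := hf₂.trans (hf₃'.mono (by decide) (by decide))
      refine (runs_roundC (hE.frame hf₃) (base := base) (cb := cb)
        (by rw [hf₃.reg 5 (by decide), h5]) (by rw [hf₃.reg 8 (by decide), h8]) hcb
        (hA.of_eq fun i h _ => hi₃ i (by omega)) hD hDC hC).mono le_rfl ?_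
      rintro s₄ ⟨⟨D', hD', hDD', hDC', hx'⟩, hi₄⟩
      refine ⟨⟨D', hD', huD.trans hDD', hDC', ?_⟩, fun i hi => (hi₄ i hi).trans (hi₃ i hi)⟩
      by_cases he : D' = D
      · left; subst he; exact hx'
      · rcases hx with hx | hx
        · by_cases hcl : ∀ x ∈ D', ∀ y ∈ A, G.Adj x y → y ∈ D'
          · exact .inl hcl
          -- If the set was closed before the round, it already was the whole component, so it
          -- cannot have grown.
          · exfalso
            have huA : u ∈ A := by
              by_contra hu
              refine hcl fun x hx => ?_
              rw [comp_empty_of_notMem hu] at hDC'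
              exact absurd (hDC' hx) (by simp)
            have := comp_subset_of_closed (u := u) (fun h => huD (by simp [h])) hx
            exact he (subset_antisymm (hDC'.trans this) hDD')
        · right
          have := Finset.card_lt_card (hDD'.ssubset_of_ne (Ne.symm he))
          omega
    · rintro s₃ ⟨⟨D, hD, huD, hDC, hx⟩, hi₃⟩
      refine ⟨?_, hi₃⟩
      rcases hx with hx | hx
      · rw [subset_antisymm (comp_subset_of_closed (fun h => huD (by simp [h])) hx) hDC]
        exact hD
      · have := Finset.card_le_univ D
        rw [Fintype.card_fin] at this
        omega
  · ring_nf; nlinarith [Nat.zero_le (n ^ 4), Nat.zero_le (n ^ 3), Nat.zero_le (n ^ 2)]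

end MWIS

/-! ### Weights and the best set of a level. -/

namespace MWIS

open RAM

variable {subs : List Cmd} {n : ℕ} {G : SimpleGraph (Fin n)} {w : Fin n → ℕ}

/-- Put the weight of the set in array `2` into register `17`. -/
def weightC : Cmd :=
  .seq (.seq (.const 17 0) (.copy 9 0)) (forDown 9 (.seq (.load 15 2 9)
    (.ite 15 (.seq (.load 15 1 9) (.add 17 17 15)) .skip)))

theorem sum_filter_step (R : Finset (Fin n)) (f : Fin n → ℕ) {j : ℕ} (hj : j < n) :
    ∑ y ∈ R.filter (fun y : Fin n => j ≤ (y : ℕ)), f y =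
      ∑ y ∈ R.filter (fun y : Fin n => j + 1 ≤ (y : ℕ)), f y +
        if (⟨j, hj⟩ : Fin n) ∈ R then f ⟨j, hj⟩ else 0 := by
  simp only [Finset.sum_filter]
  rw [show (if (⟨j, hj⟩ : Fin n) ∈ R then f ⟨j, hj⟩ else 0) =
      ∑ y ∈ R, if y = ⟨j, hj⟩ then f y else 0 by simp, ← Finset.sum_add_distrib]
  refine Finset.sum_congr rfl fun y _ => ?_
  by_cases hy : y = ⟨j, hj⟩
  · subst hy; simp
  · have : (y : ℕ) ≠ j := fun h => hy (Fin.ext h)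
    simp only [hy, if_false, add_zero]
    congr 1
    simp only [eq_iff_iff]
    omega

theorem runs_weightC {s : Store} (hE : Env G w s) {R : Finset (Fin n)} (hR : Holds s 2 0 R) :
    Runs subs weightC s (n * 7 + 3) fun s' => s'.reg 17 = ∑ v ∈ R, w v := by
  have hf₀ : Frame [17, 9] [] s ((Cmd.seq (.const 17 0) (.copy 9 0)).eval s) :=
    (frame_setReg _ _ (by simp)).trans (frame_setReg _ _ (by simp))
  refine (Runs.straight_seq (T := n * (5 + 2) + 1) rfl ?_).mono
    (by simp only [Cmd.len]; omega) fun _ h => h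
  refine (Runs.forDown (T := 5) (m := n) (fun j s' =>
    s'.reg 17 = ∑ y ∈ R.filter (fun y : Fin n => j ≤ (y : ℕ)), w y) rfl (by decide) (by decide)
    (by decide) (hE.frame hf₀).one ?_ ?_ ?_ ?_).mono le_rfl ?_
  · simp [Cmd.eval, setReg_reg, hE.size]
  · have : R.filter (fun y : Fin n => n ≤ (y : ℕ)) = ∅ :=
      Finset.filter_eq_empty_iff.2 fun y _ h => absurd y.2 (by omega)
    rw [this]
    simp [Cmd.eval, setReg_reg]
  · intro j s' x h; simpa [setReg_reg] using h
  · intro j hj s₁ hf₁ h9 h17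
    refine (Runs.straight rfl ?_).mono (by simp only [Cmd.len]; omega) fun _ h => h
    have e := hR ⟨j, hj⟩
    have e2 : s₁.arr 2 = s.arr 2 := by rw [hf₁.arr 2 (by decide), hf₀.arr 2 (by decide)]
    have e1 : s₁.arr 1 = s.arr 1 := by rw [hf₁.arr 1 (by decide), hf₀.arr 1 (by decide)]
    have e1' := hE.weight ⟨j, hj⟩
    simp only at e1'
    rw [zero_add] at e
    simp only at e
    rw [sum_filter_step R w hj, ← h17]
    by_cases hjR : (⟨j, hj⟩ : Fin n) ∈ R
    · have := e.2 hjR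
      simp [Cmd.eval, setReg_reg, h9, e2, this, hjR, e1, e1']
    · have : s.arr 2 j = 0 := by
        by_contra h; exact hjR (e.1 h)
      simp [Cmd.eval, setReg_reg, h9, e2, this, hjR]
  · intro s' h
    simpa using h

/-- Replace the best set of the current level by the set in array `2` if the latter is heavier. -/
def considerC : Cmd :=
  .seq weightC (.seq (.seq (.load 16 7 5) (.sub 16 17 16)) (.ite 16
    (.seq (.store 7 5 17) (fill 5 5 (.load 15 2 9))) .skip))

/-- The store in the course of the recursion at level `k + 1`: the cells of the current level hold
the input set as in `s₀`, the best set found, its weight, and the union of the solved components.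
Cells of higher levels are as in `s₀`. -/
structure Mid (G : SimpleGraph (Fin n)) (w : Fin n → ℕ) (s₀ : Store) (k u : ℕ)
    (B C : Finset (Fin n)) (s : Store) : Prop where
  env : Env G w s
  fuel : s.reg 4 = k + 1
  base : s.reg 5 = (k + 1) * (n + 1)
  child : s.reg 8 = k * (n + 1)
  vertex : s.reg 7 = u
  input : ∀ i, (k + 1) * (n + 1) ≤ i → s.arr 3 i = s₀.arr 3 i
  high : ∀ a ∈ [4, 5, 6, 7], ∀ i, (k + 2) * (n + 1) ≤ i → s.arr a i = s₀.arr a i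
  best : Holds s 5 ((k + 1) * (n + 1)) B
  weight : s.arr 7 ((k + 1) * (n + 1)) = ∑ v ∈ B, w v
  acc : Holds s 6 ((k + 1) * (n + 1)) C

/-- Every level of the recursion owns one block of `n + 1` cells in each of the arrays `3` to `7`,
nonempty even for `n = 0`, and lower fuel means lower addresses. Subroutines that prepare a child
set only touch array `3` below the current block, which is the condition `h3`. -/
theorem Mid.frame {s₀ s s' : Store} {k u : ℕ} {best acc : Finset (Fin n)} {W S : List ℕ}
    (h : Mid G w s₀ k u best acc s) (hf : Frame W S s s')
    (h3 : ∀ i, (k + 1) * (n + 1) ≤ i → s'.arr 3 i = s.arr 3 i)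
    (hW : ∀ r ∈ [0, 3, 4, 5, 6, 7, 8], r ∉ W := by decide)
    (hS : ∀ a ∈ [0, 1, 4, 5, 6, 7], a ∉ S := by decide) : Mid G w s₀ k u best acc s' where
  env := h.env.frame hf (hW _ (by simp)) (hW _ (by simp)) (hW _ (by simp)) (hS _ (by simp))
    (hS _ (by simp))
  fuel := by rw [hf.reg _ (hW _ (by simp)), h.fuel]
  base := by rw [hf.reg _ (hW _ (by simp)), h.base]
  child := by rw [hf.reg _ (hW _ (by simp)), h.child]
  vertex := by rw [hf.reg _ (hW _ (by simp)), h.vertex]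
  input i hi := by rw [h3 i hi, h.input i hi]
  high a ha i hi := by
    rw [hf.arr a (hS a (by simp at ha ⊢; tauto)), h.high a ha i hi]
  best := h.best.of_eq fun _ _ _ => by rw [hf.arr _ (hS _ (by simp))]
  weight := by rw [hf.arr _ (hS _ (by simp)), h.weight]
  acc := h.acc.of_eq fun _ _ _ => by rw [hf.arr _ (hS _ (by simp))]

theorem level_succ (k n : ℕ) : (k + 1) * (n + 1) = k * (n + 1) + (n + 1) := by ring

/-- The weight of the best set is kept in array `7`, so the comparison is one truncated difference,
nonzero exactly for a strict improvement. The best weight never decreases, hence guarantees from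
earlier branches survive. -/
theorem runs_considerC {s₀ s : Store} {k u : ℕ} {best acc R : Finset (Fin n)}
    (h : Mid G w s₀ k u best acc s) (hR : Holds s 2 0 R) :
    Runs subs considerC s (12 * n + 20) fun s' => s'.arr 3 = s.arr 3 ∧ s'.arr 4 = s.arr 4 ∧
      ∃ best', (best' = R ∨ best' = best) ∧ ∑ v ∈ R, w v ≤ ∑ v ∈ best', w v ∧
        ∑ v ∈ best, w v ≤ ∑ v ∈ best', w v ∧ Mid G w s₀ k u best' acc s' := by
  have key : Runs subs considerC s (12 * n + 20) fun s' =>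
      ∃ best', (best' = R ∨ best' = best) ∧ ∑ v ∈ R, w v ≤ ∑ v ∈ best', w v ∧
        ∑ v ∈ best, w v ≤ ∑ v ∈ best', w v ∧ Mid G w s₀ k u best' acc s' := by
    refine (((runs_weightC h.env hR).frame rfl).seq (T' := n * 5 + 10) ?_).mono (by omega)
      fun _ h => h
    rintro s₁ ⟨h17, hf₁⟩
    have hM₁ := h.frame hf₁ (fun i _ => by rw [hf₁.arr 3 (by decide)])
    refine (Runs.straight_seq (T := n * 5 + 5) rfl ?_).mono (by simp only [Cmd.len]; omega)
      fun _ h => h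
    have hf₂ : Frame [16] [] s₁ ((Cmd.seq (.load 16 7 5) (.sub 16 17 16)).eval s₁) :=
      (frame_setReg _ _ (by simp)).trans (frame_setReg _ _ (by simp))
    have hM₂ := hM₁.frame hf₂ (fun i _ => by rw [hf₂.arr 3 (by decide)])
    have h16 : ((Cmd.seq (.load 16 7 5) (.sub 16 17 16)).eval s₁).reg 16 =
        ∑ v ∈ R, w v - ∑ v ∈ best, w v := by
      simp [Cmd.eval, setReg_reg, h17, hM₁.base, hM₁.weight]
    generalize (Cmd.seq (.load 16 7 5) (.sub 16 17 16)).eval s₁ = s₂ at hf₂ hM₂ h16 ⊢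
    have h17₂ : s₂.reg 17 = ∑ v ∈ R, w v := by rw [hf₂.reg 17 (by decide), h17]
    have hR₂ : Holds s₂ 2 0 R := hR.of_eq fun _ _ _ => by
      rw [hf₂.arr 2 (by decide), hf₁.arr 2 (by decide)]
    refine Runs.ite (T := n * 5 + 4) (fun hr => ?_) fun hr => ?_
    swap
    · refine (Runs.straight (P := .skip) rfl ?_).mono (by simp [Cmd.len]) fun _ h => h
      exact ⟨best, .inr rfl, by omega, le_rfl, hM₂⟩
    refine (Runs.straight_seq (P := .store 7 5 17) (T := n * 5 + 2) rfl ?_).mono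
      (by simp only [Cmd.len]; omega) fun _ h => h
    have hf₃ : Frame [] [7] s₂ ((Cmd.store 7 5 17).eval s₂) := frame_setArr _ _ _ (by simp)
    have h7 : ∀ i, ((Cmd.store 7 5 17).eval s₂).arr 7 i =
        if i = (k + 1) * (n + 1) then ∑ v ∈ R, w v else s₂.arr 7 i := by
      intro i
      simp [Cmd.eval, setArr_arr, hM₂.base, h17₂]
    generalize (Cmd.store 7 5 17).eval s₂ = s₃ at hf₃ h7
    refine ((runs_fill (b := (k + 1) * (n + 1)) (B := R) (T := 1) rfl (by decide) (by decide)
      (by decide) (by decide) (by decide) (by decide) (hM₂.env.frame hf₃).size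
      (hM₂.env.frame hf₃).one ?_ ?_).frame rfl).mono (by omega) ?_
    · rw [hf₃.reg 5 (by decide), hM₂.base]
    · intro v s₄ hf₄ h9 hi
      refine (Runs.straight (P := .load 15 2 9) rfl ?_).mono (by simp [Cmd.len]) fun _ h => h
      simp only [Cmd.eval, setReg_reg, if_true, h9, hf₄.arr 2 (by decide), hf₃.arr 2 (by decide)]
      have := hR₂ v
      rwa [zero_add] at this
    · rintro s₄ ⟨⟨h5, h5'⟩, hf₄⟩
      have hf := hf₃.mono (W' := [9, 13, 15]) (S' := [5, 7]) (by simp) (by simp) |>.trans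
        (hf₄.mono (by decide) (by decide))
      have e7 : s₄.arr 7 = s₃.arr 7 := hf₄.arr 7 (by decide)
      refine ⟨R, .inl rfl, le_rfl, by omega, ?_⟩
      constructor
      · exact hM₂.env.frame hf
      · rw [hf.reg _ (by decide), hM₂.fuel]
      · rw [hf.reg _ (by decide), hM₂.base]
      · rw [hf.reg _ (by decide), hM₂.child]
      · rw [hf.reg _ (by decide), hM₂.vertex]
      · intro i hi; rw [hf.arr 3 (by decide), hM₂.input i hi]
      · intro a ha i hi
        have hk : (k + 2) * (n + 1) = (k + 1) * (n + 1) + (n + 1) := level_succ (k + 1) n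
        rw [← hM₂.high a ha i hi]
        simp only [List.mem_cons, List.not_mem_nil, or_false] at ha
        rcases ha with rfl | rfl | rfl | rfl
        · rw [hf.arr 4 (by decide)]
        · rw [h5' i (.inr (by omega)), hf₃.arr 5 (by decide)]
        · rw [hf.arr 6 (by decide)]
        · rw [e7, h7, if_neg (by omega)]
      · exact h5
      · rw [e7, h7, if_pos rfl]
      · exact hM₂.acc.of_eq fun _ _ _ => by rw [hf.arr 6 (by decide)]
  exact (key.frame rfl).mono le_rfl fun s' h' =>
    ⟨h'.2.arr 3 (by decide), h'.2.arr 4 (by decide), h'.1⟩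

end MWIS

/-! ### The recursive call and the handling of its result. -/

namespace MWIS

open RAM

variable {subs : List Cmd} {n : ℕ} {G : SimpleGraph (Fin n)} {w : Fin n → ℕ}

/-- Solve the child cells by a recursive call and restore the registers of the current level. -/
def recC : Cmd :=
  .seq (.seq (.sub 4 4 3) (.copy 5 8)) (.seq (.call 0)
    (.seq (.add 4 4 3) (.seq (.add 5 5 6) (.seq (.load 7 4 5) (.sub 8 5 6)))))

/-- If the current vertex belongs to the current set, put it into array `2`. -/
def addC : Cmd := .seq (.seq (.add 13 5 7) (.load 15 3 13)) (.ite 15 (.store 2 7 3) .skip)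

/-- Replace the part of the union of solved components inside the child cells by array `2`. -/
def mergeC : Cmd :=
  fill 6 5 (.seq (.seq (.add 13 8 9) (.load 15 3 13)) (.ite 15 (.load 15 2 9)
    (.seq (.add 13 5 9) (.load 15 6 13))))

/-- The three kinds of branches for one vertex. -/
def branchC : Cmd :=
  .seq (.seq (.sub 7 7 3) (.store 4 5 7)) (.seq delC (.seq recC (.seq addC (.seq considerC
    (.seq degC (.seq recC (.seq considerC (.seq compC (.seq recC mergeC)))))))))

/-- Initialize a level. -/
def initC : Cmd :=
  .seq (.seq (.sub 8 5 6) (.seq (.const 12 0) (.store 7 5 12))) (.seq (fill 5 5 (.const 15 0))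
    (.seq (fill 6 5 (.const 15 0)) (.copy 7 0)))

/-- Copy a set from array `src` at the current level to array `2`. -/
def copyC (src : ℕ) : Cmd :=
  .seq (.const 14 0) (fill 2 14 (.seq (.add 13 5 9) (.load 15 src 13)))

/-- Consider the union of the solved components, and return the best set. -/
def finishC : Cmd := .seq (copyC 6) (.seq considerC (copyC 5))

/-- The branching procedure: with fuel `k` in register `4` and `k * (n + 1)` in register `5`, solve
the set in the cells of array `3` from there on, and put the result into array `2`. -/
def solveC : Cmd :=
  .ite 4 (.seq initC (.seq (.loop 7 branchC) finishC))
    (.seq (.const 14 0) (fill 2 14 (.const 15 0)))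

/-- The outcome of the branching procedure. -/
structure Solved (G : SimpleGraph (Fin n)) (w : Fin n → ℕ) (k : ℕ) (A : Finset (Fin n))
    (s s' : Store) : Prop where
  env : Env G w s'
  fuel : s'.reg 4 = k
  base : s'.reg 5 = k * (n + 1)
  input : ∀ i, k * (n + 1) ≤ i → s'.arr 3 i = s.arr 3 i
  high : ∀ a ∈ [4, 5, 6, 7], ∀ i, (k + 1) * (n + 1) ≤ i → s'.arr a i = s.arr a i
  sol : ∃ R, Sol G w k A R ∧ Holds s' 2 0 R

/-- The recursive call with fuel `k` is correct and takes at most `T` steps. -/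
def CallOK (G : SimpleGraph (Fin n)) (w : Fin n → ℕ) (subs : List Cmd) (k T : ℕ) : Prop :=
  ∀ (A : Finset (Fin n)) (s : Store), Env G w s → s.reg 4 = k → s.reg 5 = k * (n + 1) →
    Holds s 3 (k * (n + 1)) A → Runs subs (.call 0) s T (Solved G w k A s)

/-- The call uses the same registers, so the current vertex has to be parked in array `4` at the
address of the current level. The callee leaves arrays `4` to `7` alone from that address on, and
the other registers come back by adding the stride to the callee's base. -/
theorem runs_recC {k T : ℕ} (hT : CallOK G w subs k T) {s₀ s : Store} {u : ℕ}
    {best acc B : Finset (Fin n)} (h : Mid G w s₀ k u best acc s)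
    (h4 : s.arr 4 ((k + 1) * (n + 1)) = u) (hB : Holds s 3 (k * (n + 1)) B) :
    Runs subs recC s (T + 6) fun s' => Mid G w s₀ k u best acc s' ∧
      s'.arr 4 ((k + 1) * (n + 1)) = u ∧ (∀ i, k * (n + 1) ≤ i → s'.arr 3 i = s.arr 3 i) ∧
      ∃ R, Sol G w k B R ∧ Holds s' 2 0 R := by
  have hk := level_succ k n
  have hk' : (k + 2) * (n + 1) = (k + 1) * (n + 1) + (n + 1) := level_succ (k + 1) n
  refine (Runs.straight_seq (T := T + 4) rfl ?_).mono (by simp only [Cmd.len]; omega) fun _ h => h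
  have hf₁ : Frame [4, 5] [] s ((Cmd.seq (.sub 4 4 3) (.copy 5 8)).eval s) :=
    (frame_setReg _ _ (by simp)).trans (frame_setReg _ _ (by simp))
  have e4 : ((Cmd.seq (.sub 4 4 3) (.copy 5 8)).eval s).reg 4 = k := by
    simp [Cmd.eval, setReg_reg, h.fuel, h.env.one]
  have e5 : ((Cmd.seq (.sub 4 4 3) (.copy 5 8)).eval s).reg 5 = k * (n + 1) := by
    simp [Cmd.eval, setReg_reg, h.child]
  generalize (Cmd.seq (.sub 4 4 3) (.copy 5 8)).eval s = s₁ at hf₁ e4 e5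
  refine (hT B s₁ (h.env.frame hf₁) e4 e5 (hB.of_eq fun _ _ _ => by
    rw [hf₁.arr 3 (by decide)])).seq ?_
  intro s₂ hs₂
  refine (Runs.straight rfl ?_).mono (by simp only [Cmd.len]; omega) fun _ h => h
  have ha : ∀ a ∈ [4, 5, 6, 7], ∀ i, (k + 1) * (n + 1) ≤ i → s₂.arr a i = s.arr a i :=
    fun a ha i hi => by rw [hs₂.high a ha i hi, hf₁.arr a (by simp)]
  have h3 : ∀ i, k * (n + 1) ≤ i → s₂.arr 3 i = s.arr 3 i :=
    fun i hi => by rw [hs₂.input i hi, hf₁.arr 3 (by simp)]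
  set s₃ := (Cmd.seq (.add 4 4 3) (.seq (.add 5 5 6) (.seq (.load 7 4 5) (.sub 8 5 6)))).eval s₂
    with hs₃
  have hf₃ : Frame [4, 5, 7, 8] [] s₂ s₃ := by
    refine (frame_setReg _ _ (by simp)).trans ((frame_setReg _ _ (by simp)).trans
      ((frame_setReg _ _ (by simp)).trans (frame_setReg _ _ (by simp))))
  have ea : s₃.arr = s₂.arr := rfl
  have r4 : s₃.reg 4 = k + 1 := by simp [hs₃, Cmd.eval, setReg_reg, hs₂.fuel, hs₂.env.one]
  have r5 : s₃.reg 5 = (k + 1) * (n + 1) := by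
    simp [hs₃, Cmd.eval, setReg_reg, hs₂.base, hs₂.env.stride, hk]
  have r8 : s₃.reg 8 = k * (n + 1) := by
    simp [hs₃, Cmd.eval, setReg_reg, hs₂.base, hs₂.env.stride]
  have r7 : s₃.reg 7 = u := by
    simp [hs₃, Cmd.eval, setReg_reg, hs₂.base, hs₂.env.stride, ← hk,
      ha 4 (by simp) _ le_rfl, h4]
  refine ⟨⟨hs₂.env.frame hf₃, r4, r5, r8, r7, ?_, ?_, ?_, ?_, ?_⟩, ?_, ?_, ?_⟩
  · intro i hi; rw [ea, h3 i (by omega), h.input i hi]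
  · intro a ha' i hi; rw [ea, ha a ha' i (by omega), h.high a ha' i hi]
  · exact h.best.of_eq fun i hi _ => by rw [ea, ha _ (by simp) i hi]
  · rw [ea, ha _ (by simp) _ le_rfl, h.weight]
  · exact h.acc.of_eq fun i hi _ => by rw [ea, ha _ (by simp) i hi]
  · rw [ea, ha _ (by simp) _ le_rfl, h4]
  · intro i hi; rw [ea, h3 i hi]
  · exact hs₂.sol

theorem runs_addC {s₀ s : Store} {k : ℕ} {u : Fin n} {best acc A R : Finset (Fin n)}
    (h : Mid G w s₀ k u best acc s) (hA : Holds s 3 ((k + 1) * (n + 1)) A) (hR : Holds s 2 0 R) :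
    Runs subs addC s 5 fun s' => Mid G w s₀ k u best acc s' ∧ s'.arr 4 = s.arr 4 ∧
      s'.arr 3 = s.arr 3 ∧ Holds s' 2 0 (if u ∈ A then insert u R else R) := by
  refine ((Runs.straight (Q := fun s' => Holds s' 2 0 (if u ∈ A then insert u R else R)) rfl
    ?_).frame rfl).mono (by simp [addC, Cmd.len]) ?_
  · have hu := hA u
    intro v
    have hv := hR v
    rw [zero_add] at hv ⊢
    by_cases huA : u ∈ A
    · have hu' := hu.2 huA
      simp only [addC, Cmd.eval, setReg_reg, setReg_arr, h.base, h.vertex, if_true, hu', if_false,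
        setArr_arr, true_and, huA, Finset.mem_insert, Fin.ext_iff]
      by_cases hvu : (v : ℕ) = u
      · simp [hvu, h.env.one]
      · simp [hvu, hv]
    · have hu' : s.arr 3 ((k + 1) * (n + 1) + u) = 0 := by
        by_contra hn; exact huA (hu.1 hn)
      simp only [addC, Cmd.eval, setReg_reg, setReg_arr, h.base, h.vertex, if_true, hu', huA, if_false]
      exact hv
  · rintro s' ⟨h', hf⟩
    exact ⟨h.frame hf fun i _ => by rw [hf.arr 3 (by decide)], hf.arr 4 (by decide),
      hf.arr 3 (by decide), h'⟩

/-- The part inside `D` is replaced rather than enlarged: each component is solved once for every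
one of its vertices, and uniting two different solutions could destroy independence. -/
theorem runs_mergeC {s₀ s : Store} {k u : ℕ} {best acc D R : Finset (Fin n)}
    (h : Mid G w s₀ k u best acc s) (hD : Holds s 3 (k * (n + 1)) D) (hR : Holds s 2 0 R)
    (hRD : R ⊆ D) :
    Runs subs mergeC s (n * 11 + 2) fun s' =>
      Mid G w s₀ k u best (R ∪ acc \ D) s' := by
  have hk := level_succ k n
  have hk' : (k + 2) * (n + 1) = (k + 1) * (n + 1) + (n + 1) := level_succ (k + 1) n
  refine ((runs_fill (b := (k + 1) * (n + 1)) (B := R ∪ acc \ D) (T := 6) rfl (by decide)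
    (by decide) (by decide) (by decide) (by decide) (by decide) h.env.size h.env.one h.base
    ?_).frame rfl).mono (by omega) ?_
  · intro v s₁ hf h9 hi
    refine (Runs.straight rfl ?_).mono (by simp [Cmd.len]) fun _ h => h
    have hv := hD v
    have hv₂ := hR v
    have hv₃ := h.acc v
    rw [zero_add] at hv₂
    simp only [Finset.mem_union, Finset.mem_sdiff]
    have r8 : s₁.reg 8 = k * (n + 1) := by rw [hf.reg 8 (by decide), h.child]
    have r5 : s₁.reg 5 = (k + 1) * (n + 1) := by rw [hf.reg 5 (by decide), h.base]
    have a3 : s₁.arr 3 = s.arr 3 := hf.arr 3 (by decide)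
    have a2 : s₁.arr 2 = s.arr 2 := hf.arr 2 (by decide)
    have a6 := hi ((k + 1) * (n + 1) + v) (.inr (.inr rfl))
    by_cases hvD : v ∈ D
    · have := hv.2 hvD
      simp [Cmd.eval, setReg_reg, r8, h9, a3, this, a2, hv₂, hvD]
    · have : s.arr 3 (k * (n + 1) + v) = 0 := by
        by_contra hn; exact hvD (hv.1 hn)
      have hvR : v ∉ R := fun h => hvD (hRD h)
      simp [Cmd.eval, setReg_reg, r8, h9, a3, this, a6, r5, hv₃, hvD, hvR]
  · rintro s' ⟨⟨h6, h6'⟩, hf⟩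
    constructor
    · exact h.env.frame hf
    · rw [hf.reg _ (by decide), h.fuel]
    · rw [hf.reg _ (by decide), h.base]
    · rw [hf.reg _ (by decide), h.child]
    · rw [hf.reg _ (by decide), h.vertex]
    · intro i hi; rw [hf.arr 3 (by decide), h.input i hi]
    · intro a ha i hi
      rw [← h.high a ha i hi]
      simp only [List.mem_cons, List.not_mem_nil, or_false] at ha
      rcases ha with rfl | rfl | rfl | rfl
      · rw [hf.arr 4 (by decide)]
      · rw [hf.arr 5 (by decide)]
      · rw [h6' i (.inr (by omega))]
      · rw [hf.arr 7 (by decide)]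
    · exact h.best.of_eq fun _ _ _ => by rw [hf.arr 5 (by decide)]
    · rw [hf.arr 7 (by decide), h.weight]
    · exact h6

end MWIS

/-! ### Correctness and running time of the recursion. -/

namespace MWIS

open RAM

variable {subs : List Cmd} {n : ℕ} {G : SimpleGraph (Fin n)} {w : Fin n → ℕ}

/-- The guarantees that hold once the branches for all vertices `≥ j` have been made. -/
structure Progress (G : SimpleGraph (Fin n)) (w : Fin n → ℕ) (k j : ℕ)
    (A best acc : Finset (Fin n)) : Prop where
  sub : best ⊆ A
  indep : Indep G best
  take : ∀ u : Fin n, j ≤ u →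
    val G w k (del G A u) + (if u ∈ A then w u else 0) ≤ ∑ v ∈ best, w v
  low : ∀ u : Fin n, j ≤ u → val G w k (lowDeg G A u) ≤ ∑ v ∈ best, w v
  acc_sub : acc ⊆ A
  acc_indep : ∀ v : Fin n, j ≤ v → v ∈ A → Indep G (acc ∩ comp G A v)
  acc_val : ∀ v : Fin n, j ≤ v → v ∈ A →
    val G w k (comp G A v) ≤ ∑ x ∈ acc ∩ comp G A v, w x

theorem Sol.insert {k : ℕ} {A R : Finset (Fin n)} {u : Fin n} (h : Sol G w k (del G A u) R) :
    (if u ∈ A then insert u R else R) ⊆ A ∧ Indep G (if u ∈ A then insert u R else R) ∧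
      val G w k (del G A u) + (if u ∈ A then w u else 0) ≤
        ∑ v ∈ (if u ∈ A then insert u R else R), w v := by
  obtain ⟨h₁, h₂, h₃⟩ := h
  have hu : u ∉ R := fun hu => (mem_del.1 (h₁ hu)).2.1 rfl
  split_ifs with huA
  · refine ⟨Finset.insert_subset huA (h₁.trans (del_subset _ _)), ?_, ?_⟩
    · intro x hx y hy hxy
      rcases Finset.mem_insert.1 hx with rfl | hx'
      · rcases Finset.mem_insert.1 hy with rfl | hy'
        · exact G.loopless.irrefl _ hxy
        · exact (mem_del.1 (h₁ hy')).2.2 hxy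
      · rcases Finset.mem_insert.1 hy with rfl | hy'
        · exact (mem_del.1 (h₁ hx')).2.2 hxy.symm
        · exact h₂ x hx' y hy' hxy
    · rw [Finset.sum_insert hu]; omega
  · exact ⟨h₁.trans (del_subset _ _), h₂, by simpa using h₃⟩

/-- The new guarantees for `j` come from the three calls, and the old ones persist because the best
weight only grows. In the union of solved components, the component of `j` now carries `R₃`, while
components not containing `j` are disjoint from it and unchanged. -/
theorem Progress.step {k j : ℕ} (hj : j < n) {A best acc best₁ best₂ R₁ R₂ R₃ : Finset (Fin n)}
    (h : Progress G w k (j + 1) A best acc)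
    (h₁ : Sol G w k (del G A ⟨j, hj⟩) R₁) (h₂ : Sol G w k (lowDeg G A j) R₂)
    (h₃ : Sol G w k (comp G A ⟨j, hj⟩) R₃)
    (hb₁ : best₁ = (if ⟨j, hj⟩ ∈ A then insert ⟨j, hj⟩ R₁ else R₁) ∨ best₁ = best)
    (hw₁ : ∑ v ∈ (if ⟨j, hj⟩ ∈ A then insert ⟨j, hj⟩ R₁ else R₁), w v ≤ ∑ v ∈ best₁, w v)
    (hw₁' : ∑ v ∈ best, w v ≤ ∑ v ∈ best₁, w v)
    (hb₂ : best₂ = R₂ ∨ best₂ = best₁) (hw₂ : ∑ v ∈ R₂, w v ≤ ∑ v ∈ best₂, w v)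
    (hw₂' : ∑ v ∈ best₁, w v ≤ ∑ v ∈ best₂, w v) :
    Progress G w k j A best₂ (R₃ ∪ acc \ comp G A ⟨j, hj⟩) := by
  obtain ⟨i₁, i₂, i₃⟩ := h₁.insert
  have hle : ∀ u : Fin n, j ≤ u → u = ⟨j, hj⟩ ∨ j + 1 ≤ (u : ℕ) := fun u hu => by
    by_cases h : (u : ℕ) = j
    · exact .inl (Fin.ext h)
    · right; omega
  have hb : best₂ ⊆ A ∧ Indep G best₂ := by
    rcases hb₂ with rfl | rfl
    · exact ⟨h₂.1.trans (lowDeg_subset _ _), h₂.2.1⟩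
    · rcases hb₁ with rfl | rfl
      · exact ⟨i₁, i₂⟩
      · exact ⟨h.sub, h.indep⟩
  have hacc : ∀ v : Fin n, j ≤ v → v ∈ A →
      Indep G ((R₃ ∪ acc \ comp G A ⟨j, hj⟩) ∩ comp G A v) ∧ val G w k (comp G A v) ≤
        ∑ x ∈ (R₃ ∪ acc \ comp G A ⟨j, hj⟩) ∩ comp G A v, w x := by
    intro v hv hvA
    by_cases hvj : v ∈ comp G A ⟨j, hj⟩
    · have : (R₃ ∪ acc \ comp G A ⟨j, hj⟩) ∩ comp G A ⟨j, hj⟩ = R₃ := by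
        ext x
        simp only [Finset.mem_inter, Finset.mem_union, Finset.mem_sdiff]
        exact ⟨fun h => by tauto, fun h => ⟨.inl h, h₃.1 h⟩⟩
      rw [comp_eq_of_mem hvj, this]
      exact h₃.2
    · have : (R₃ ∪ acc \ comp G A ⟨j, hj⟩) ∩ comp G A v = acc ∩ comp G A v := by
        have hd : ∀ x ∈ comp G A v, x ∉ comp G A ⟨j, hj⟩ := fun x hx hx' => by
          rw [← comp_eq_of_mem hx', comp_eq_of_mem hx] at hvj
          exact hvj (mem_comp_self hvA)
        ext x
        simp only [Finset.mem_inter, Finset.mem_union, Finset.mem_sdiff]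
        constructor
        · rintro ⟨h | h, hx⟩
          · exact absurd (h₃.1 h) (hd x hx)
          · exact ⟨h.1, hx⟩
        · rintro ⟨h, hx⟩
          exact ⟨.inr ⟨h, hd x hx⟩, hx⟩
      rw [this]
      have hv' : j + 1 ≤ (v : ℕ) := by
        rcases hle v hv with rfl | h
        · exact absurd (mem_comp_self hvA) hvj
        · exact h
      exact ⟨h.acc_indep v hv' hvA, h.acc_val v hv' hvA⟩
  refine ⟨hb.1, hb.2, ?_, ?_, ?_, fun v hv hvA => (hacc v hv hvA).1,
    fun v hv hvA => (hacc v hv hvA).2⟩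
  · intro u hu
    rcases hle u hu with rfl | hu
    · exact i₃.trans (hw₁.trans hw₂')
    · exact (h.take u hu).trans (hw₁'.trans hw₂')
  · intro u hu
    rcases hle u hu with rfl | hu
    · exact h₂.2.2.trans hw₂
    · exact (h.low u hu).trans (hw₁'.trans hw₂')
  · exact Finset.union_subset (h₃.1.trans (comp_subset _ _))
      (Finset.sdiff_subset.trans h.acc_sub)

/-- At `j = 0` all entries of the maximum defining `val` have been tried. The united component
solutions are independent because no edge of `A` joins two components, and their weight is the sum
over the components. -/
theorem Progress.sol {k : ℕ} {A best acc best' : Finset (Fin n)} (h : Progress G w k 0 A best acc)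
    (hb : best' = acc ∨ best' = best) (h₁ : ∑ v ∈ acc, w v ≤ ∑ v ∈ best', w v)
    (h₂ : ∑ v ∈ best, w v ≤ ∑ v ∈ best', w v) : Sol G w (k + 1) A best' := by
  have hacc : Indep G acc :=
    indep_of_comp h.acc_sub fun v hv => h.acc_indep v (Nat.zero_le _) hv
  have hsub : best' ⊆ A ∧ Indep G best' := by
    rcases hb with rfl | rfl
    · exact ⟨h.acc_sub, hacc⟩
    · exact ⟨h.sub, h.indep⟩
  refine ⟨hsub.1, hsub.2, max_le (Finset.sup_le fun u _ => (h.take u (Nat.zero_le _)).trans h₂)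
    (max_le (Finset.sup_le fun i hi => ?_) (le_trans ?_ h₁))⟩
  · rw [Finset.mem_range, Fintype.card_fin] at hi
    exact (h.low ⟨i, hi⟩ (Nat.zero_le _)).trans h₂
  · rw [← sum_comp (G := G) h.acc_sub w]
    refine Finset.sum_le_sum fun D hD => ?_
    obtain ⟨v, hv, rfl⟩ := Finset.mem_image.1 hD
    exact h.acc_val v (Nat.zero_le _) hv

/-- The factor `3` counts the recursive calls; among the other work the component search dominates
and gives the fourth power. -/
theorem runs_branchC {k T : ℕ} (hT : CallOK G w subs k T) {s₀ s : Store} {j : ℕ} (hj : j < n)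
    {best acc A : Finset (Fin n)} (hA : Holds s₀ 3 ((k + 1) * (n + 1)) A)
    (h : Mid G w s₀ k (j + 1) best acc s) (hp : Progress G w k (j + 1) A best acc) :
    Runs subs branchC s (3 * T + 200 * (n + 1) ^ 4) fun s' =>
      ∃ best' acc', Mid G w s₀ k j best' acc' s' ∧ Progress G w k j A best' acc' := by
  have hk := level_succ k n
  have hk' : (k + 2) * (n + 1) = (k + 1) * (n + 1) + (n + 1) := level_succ (k + 1) n
  have hcb : k * (n + 1) + n ≤ (k + 1) * (n + 1) := by omega
  have holdsA : ∀ {u : ℕ} {b c : Finset (Fin n)} {s : Store}, Mid G w s₀ k u b c s →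
      Holds s 3 ((k + 1) * (n + 1)) A := fun h => hA.of_eq fun i hi _ => h.input i hi
  refine Runs.mono (T := 2 + (30 * (n + 1) ^ 2 + ((T + 6) + (5 + ((12 * n + 20) +
    (30 * (n + 1) ^ 3 + ((T + 6) + ((12 * n + 20) + (40 * (n + 1) ^ 4 + ((T + 6) + (n * 11 + 2)))))))))))
    (Runs.straight_seq rfl ?_) ?_ fun _ h => h
  swap
  · ring_nf; nlinarith [Nat.zero_le (n ^ 4), Nat.zero_le (n ^ 3), Nat.zero_le (n ^ 2)]
  have h₁ : Mid G w s₀ k j best acc ((Cmd.seq (.sub 7 7 3) (.store 4 5 7)).eval s) ∧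
      ((Cmd.seq (.sub 7 7 3) (.store 4 5 7)).eval s).arr 4 ((k + 1) * (n + 1)) = j := by
    have hf : Frame [7] [4] s ((Cmd.seq (.sub 7 7 3) (.store 4 5 7)).eval s) :=
      (frame_setReg _ _ (by simp)).trans (frame_setArr _ _ _ (by simp))
    refine ⟨⟨h.env.frame hf, ?_, ?_, ?_, ?_, ?_, ?_, ?_, ?_, ?_⟩, ?_⟩
    · rw [hf.reg _ (by decide), h.fuel]
    · rw [hf.reg _ (by decide), h.base]
    · rw [hf.reg _ (by decide), h.child]
    · simp [Cmd.eval, setReg_reg, h.vertex, h.env.one]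
    · intro i hi; rw [hf.arr 3 (by decide), h.input i hi]
    · intro a ha i hi
      rw [← h.high a ha i hi]
      simp only [Cmd.eval, setArr_arr, setReg_reg, setReg_arr]
      rw [if_neg]
      rintro ⟨-, hi'⟩
      simp [h.base] at hi'
      omega
    · exact h.best.of_eq fun _ _ _ => by rw [hf.arr 5 (by decide)]
    · rw [hf.arr 7 (by decide), h.weight]
    · exact h.acc.of_eq fun _ _ _ => by rw [hf.arr 6 (by decide)]
    · simp [Cmd.eval, setArr_arr, setReg_reg, h.base, h.vertex, h.env.one]
  generalize (Cmd.seq (.sub 7 7 3) (.store 4 5 7)).eval s = s₁ at h₁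
  obtain ⟨m₁, u₁⟩ := h₁
  refine ((runs_delC (u := ⟨j, hj⟩) m₁.env m₁.base m₁.child hcb m₁.vertex (holdsA m₁)).frame rfl).seq ?_
  rintro s₂ ⟨⟨b₂, i₂⟩, hf₂⟩
  have m₂ := m₁.frame hf₂ fun i hi => i₂ i (.inr (by omega))
  have u₂ : s₂.arr 4 ((k + 1) * (n + 1)) = j := by rw [hf₂.arr 4 (by decide), u₁]
  refine (runs_recC hT m₂ u₂ b₂).seq ?_
  rintro s₃ ⟨m₃, u₃, -, R₁, hR₁, hr₃⟩
  refine (runs_addC (u := ⟨j, hj⟩) m₃ (holdsA m₃) hr₃).seq ?_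
  rintro s₄ ⟨m₄, a₄, -, hr₄⟩
  refine (runs_considerC m₄ hr₄).seq ?_
  rintro s₅ ⟨-, a₅, best₁, hb₁, hw₁, hw₁', m₅⟩
  refine ((runs_degC m₅.env m₅.base m₅.child hcb m₅.vertex (holdsA m₅)).frame rfl).seq ?_
  rintro s₆ ⟨⟨b₆, i₆⟩, hf₆⟩
  have m₆ := m₅.frame hf₆ fun i hi => i₆ i (.inr (by omega))
  have u₆ : s₆.arr 4 ((k + 1) * (n + 1)) = j := by rw [hf₆.arr 4 (by decide), a₅, a₄, u₃]
  refine (runs_recC hT m₆ u₆ b₆).seq ?_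
  rintro s₇ ⟨m₇, u₇, -, R₂, hR₂, hr₇⟩
  refine (runs_considerC m₇ hr₇).seq ?_
  rintro s₈ ⟨-, a₈, best₂, hb₂, hw₂, hw₂', m₈⟩
  refine ((runs_compC (u := ⟨j, hj⟩) m₈.env m₈.base m₈.child hcb m₈.vertex (holdsA m₈)).frame rfl).seq ?_
  rintro s₉ ⟨⟨b₉, i₉⟩, hf₉⟩
  have m₉ := m₈.frame hf₉ fun i hi => i₉ i (.inr (by omega))
  have u₉ : s₉.arr 4 ((k + 1) * (n + 1)) = j := by rw [hf₉.arr 4 (by decide), a₈, u₇]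
  refine (runs_recC hT m₉ u₉ b₉).seq ?_
  rintro s' ⟨m', -, i', R₃, hR₃, hr'⟩
  refine (runs_mergeC m' (b₉.of_eq fun i hi _ => i' i hi) hr' hR₃.1).mono le_rfl ?_
  intro s'' h''
  exact ⟨_, _, h'', hp.step hj hR₁ hR₂ hR₃ hb₁ hw₁ hw₁' hb₂ hw₂ hw₂'⟩

theorem runs_initC {k : ℕ} {s : Store} (hE : Env G w s) (h4 : s.reg 4 = k + 1)
    (h5 : s.reg 5 = (k + 1) * (n + 1)) :
    Runs subs initC s (n * 10 + 8) (Mid G w s k n ∅ ∅) := by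
  have hk := level_succ k n
  have hk' : (k + 2) * (n + 1) = (k + 1) * (n + 1) + (n + 1) := level_succ (k + 1) n
  refine Runs.mono (T := 3 + ((n * (1 + 4) + 2) + ((n * (1 + 4) + 2) + 1)))
    (Runs.straight_seq rfl ?_) (by omega) fun _ h => h
  have hf₁ : Frame [8, 12] [7] s
      ((Cmd.seq (.sub 8 5 6) (.seq (.const 12 0) (.store 7 5 12))).eval s) :=
    (frame_setReg _ _ (by simp)).trans ((frame_setReg _ _ (by simp)).trans
      (frame_setArr _ _ _ (by simp)))
  have e8 : ((Cmd.seq (.sub 8 5 6) (.seq (.const 12 0) (.store 7 5 12))).eval s).reg 8 =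
      k * (n + 1) := by
    simp [Cmd.eval, setReg_reg, h5, hE.stride, hk]
  have a7 : ∀ i, ((Cmd.seq (.sub 8 5 6) (.seq (.const 12 0) (.store 7 5 12))).eval s).arr 7 i =
      if i = (k + 1) * (n + 1) then 0 else s.arr 7 i := by
    intro i
    simp [Cmd.eval, setArr_arr, setReg_reg, h5]
  generalize (Cmd.seq (.sub 8 5 6) (.seq (.const 12 0) (.store 7 5 12))).eval s = s₁ at hf₁ e8 a7
  have zero : ∀ (v : Fin n) (s' : Store),
      Runs subs (.const 15 0) s' 1 fun s'' => s''.reg 15 ≠ 0 ↔ v ∈ (∅ : Finset (Fin n)) :=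
    fun v s' => Runs.straight rfl (by simp [Cmd.eval, setReg_reg])
  have hE₁ := hE.frame hf₁
  refine ((runs_fill (b := (k + 1) * (n + 1)) (B := ∅) (T := 1) rfl (by decide) (by decide)
    (by decide) (by decide) (by decide) (by decide) hE₁.size hE₁.one
    (by rw [hf₁.reg 5 (by decide), h5]) fun v s' _ _ _ => zero v s').frame rfl).seq ?_
  rintro s₂ ⟨⟨b₂, i₂⟩, hf₂'⟩
  have hf₂ := (hf₁.mono (W' := [7, 8, 9, 12, 13, 15]) (S' := [5, 6, 7]) (by simp) (by simp)).trans
    (hf₂'.mono (by decide) (by decide))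
  have hE₂ := hE.frame hf₂
  refine ((runs_fill (b := (k + 1) * (n + 1)) (B := ∅) (T := 1) rfl (by decide) (by decide)
    (by decide) (by decide) (by decide) (by decide) hE₂.size hE₂.one
    (by rw [hf₂.reg 5 (by decide), h5]) fun v s' _ _ _ => zero v s').frame rfl).seq ?_
  rintro s₃ ⟨⟨b₃, i₃⟩, hf₃'⟩
  have hf₃ := hf₂.trans (hf₃'.mono (by decide) (by decide))
  refine (Runs.straight (P := .copy 7 0) rfl ?_).mono (by simp [Cmd.len]) fun _ h => h
  have hf := hf₃.trans (frame_setReg (W := [7, 8, 9, 12, 13, 15]) (S := [5, 6, 7]) s₃ (r := 7)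
    (s₃.reg 0) (by simp))
  change Mid G w s k n ∅ ∅ (s₃.setReg 7 (s₃.reg 0))
  have e7 : (s₃.setReg 7 (s₃.reg 0)).arr 7 = s₁.arr 7 := by
    rw [setReg_arr, hf₃'.arr 7 (by decide), hf₂'.arr 7 (by decide)]
  refine ⟨hE.frame hf, ?_, ?_, ?_, ?_, ?_, ?_, ?_, ?_, ?_⟩
  · rw [hf.reg _ (by decide), h4]
  · rw [hf.reg _ (by decide), h5]
  · rw [setReg_reg, if_neg (by decide), hf₃'.reg 8 (by decide), hf₂'.reg 8 (by decide), e8]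
  · rw [setReg_reg, if_pos rfl, (hE.frame hf₃).size]
  · intro i hi; rw [hf.arr 3 (by decide)]
  · intro a ha i hi
    simp only [List.mem_cons, List.not_mem_nil, or_false] at ha
    rcases ha with rfl | rfl | rfl | rfl
    · rw [hf.arr 4 (by decide)]
    · rw [setReg_arr, hf₃'.arr 5 (by decide), i₂ i (.inr (by omega)), hf₁.arr 5 (by decide)]
    · rw [setReg_arr, i₃ i (.inr (by omega)), hf₂'.arr 6 (by decide), hf₁.arr 6 (by decide)]
    · rw [e7, a7, if_neg (by omega)]
  · exact b₂.of_eq fun _ _ _ => by rw [setReg_arr, hf₃'.arr 5 (by decide)]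
  · rw [e7, a7, if_pos rfl, Finset.sum_empty]
  · exact b₃

theorem runs_copyC {src b : ℕ} (hsrc : src ≠ 2) {s : Store} (hE : Env G w s) (h5 : s.reg 5 = b)
    {B : Finset (Fin n)} (hB : Holds s src b B) :
    Runs subs (copyC src) s
      (n * 6 + 3) fun s' => Holds s' 2 0 B ∧ Frame [9, 13, 14, 15] [2] s s' := by
  have key : Runs subs (copyC src) s
      (n * 6 + 3) fun s' => Holds s' 2 0 B := by
    refine Runs.mono (T := 1 + (n * (2 + 4) + 2)) (Runs.straight_seq (P := .const 14 0) rfl ?_)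
      (by omega) fun _ h => h
    have hf : Frame [14] [] s ((Cmd.const 14 0).eval s) := frame_setReg _ _ (by simp)
    have hE' := hE.frame hf
    refine (runs_fill (b := 0) (B := B) (T := 2) rfl (by simp [Cmd.writes])
      (by simp [Cmd.writes]) (by simp [Cmd.writes]) (by decide) (by decide) (by simp [Cmd.stores])
      hE'.size hE'.one (by simp [Cmd.eval, setReg_reg]) ?_).mono le_rfl fun _ h => h.1
    intro v s' hf' h9 hi
    refine (Runs.straight rfl ?_).mono (by simp [Cmd.len]) fun _ h => h
    have hv := hB v
    have e5 : s'.reg 5 = b := by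
      rw [hf'.reg 5 (by simp [Cmd.writes]), hf.reg 5 (by decide), h5]
    have ea : s'.arr src = s.arr src := by
      rw [hf'.arr src (by simpa using hsrc), hf.arr src (by simp)]
    simpa [Cmd.eval, setReg_reg, e5, h9, ea] using hv
  refine (key.frame rfl).mono le_rfl fun s' h => ⟨h.1, h.2.mono ?_ ?_⟩ <;>
    simp [copyC, Cmd.writes, Cmd.stores, fill, forDown]

theorem runs_solveC_succ {k T : ℕ} (hT : CallOK G w subs k T) {s : Store} {A : Finset (Fin n)}
    (hE : Env G w s) (h4 : s.reg 4 = k + 1) (h5 : s.reg 5 = (k + 1) * (n + 1))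
    (hA : Holds s 3 ((k + 1) * (n + 1)) A) :
    Runs subs solveC s (3 * n * T + 300 * (n + 1) ^ 5) (Solved G w (k + 1) A s) := by
  refine Runs.mono (T := ((n * 10 + 8) + ((n * (3 * T + 200 * (n + 1) ^ 4 + 1) + 1) +
    ((n * 6 + 3) + ((12 * n + 20) + (n * 6 + 3))))) + 1)
    (Runs.ite (fun _ => ?_) fun h0 => absurd h0 (by omega)) ?_ fun _ h => h
  swap
  · ring_nf; nlinarith [Nat.zero_le (n ^ 5), Nat.zero_le (n ^ 4), Nat.zero_le (n ^ 3),
      Nat.zero_le (n ^ 2)]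
  refine (runs_initC hE h4 h5).seq fun s₁ m₁ => ?_
  have hp₁ : Progress G w k n A ∅ ∅ :=
    ⟨Finset.empty_subset _, fun x hx => by simp at hx, fun u hu => absurd u.2 (by omega),
      fun u hu => absurd u.2 (by omega), Finset.empty_subset _, fun u hu => absurd u.2 (by omega),
      fun u hu => absurd u.2 (by omega)⟩
  refine (Runs.loop (fun j s' => j ≤ n ∧ ∃ best acc, Mid G w s k j best acc s' ∧
    Progress G w k j A best acc) ?_ ?_ (m := n) ⟨le_rfl, _, _, m₁, hp₁⟩).seq ?_
  · rintro j s' ⟨-, best, acc, m, -⟩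
    rw [m.vertex]
  · rintro j s' ⟨hj, best, acc, m, hp⟩
    refine (runs_branchC hT (by omega) hA m hp).mono le_rfl fun s'' h => ⟨by omega, h⟩
  rintro s₂ ⟨-, best, acc, m₂, hp⟩
  refine (runs_copyC (by decide) m₂.env m₂.base m₂.acc).seq ?_
  rintro s₃ ⟨h₃, hf₃⟩
  have m₃ := m₂.frame hf₃ fun i _ => by rw [hf₃.arr 3 (by decide)]
  refine (runs_considerC m₃ h₃).seq ?_
  rintro s₄ ⟨-, -, best', hb, hw, hw', m₄⟩
  refine (runs_copyC (by decide) m₄.env m₄.base m₄.best).mono le_rfl ?_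
  rintro s₅ ⟨h₅, hf₅⟩
  have m₅ := m₄.frame hf₅ fun i _ => by rw [hf₅.arr 3 (by decide)]
  exact ⟨m₅.env, m₅.fuel, m₅.base, m₅.input, m₅.high, _, hp.sol hb hw hw', h₅⟩

theorem runs_solveC_zero {s : Store} {A : Finset (Fin n)} (hE : Env G w s) (h4 : s.reg 4 = 0)
    (h5 : s.reg 5 = 0 * (n + 1)) : Runs subs solveC s (n * 5 + 4) (Solved G w 0 A s) := by
  refine Runs.mono (T := (1 + (n * (1 + 4) + 2)) + 1) (Runs.ite (fun h0 => absurd h4 h0)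
    fun _ => Runs.straight_seq (P := .const 14 0) rfl ?_) (by omega) fun _ h => h
  have hf : Frame [14] [] s ((Cmd.const 14 0).eval s) := frame_setReg _ _ (by simp)
  have hE' := hE.frame hf
  refine ((runs_fill (b := 0) (B := ∅) (T := 1) rfl (by decide) (by decide) (by decide)
    (by decide) (by decide) (by decide) hE'.size hE'.one (by simp [Cmd.eval, setReg_reg])
    fun v s' _ _ _ => Runs.straight rfl (by simp [Cmd.eval, setReg_reg])).frame rfl).mono le_rfl ?_
  rintro s' ⟨⟨h₁, -⟩, hf'⟩
  have hf'' := (hf.mono (W' := [9, 13, 14, 15]) (S' := [2]) (by simp) (by simp)).trans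
    (hf'.mono (by decide) (by decide))
  refine ⟨hE.frame hf'', ?_, ?_, ?_, ?_, ∅, ⟨Finset.empty_subset _, ?_, ?_⟩, h₁⟩
  · rw [hf''.reg _ (by decide), h4]
  · rw [hf''.reg _ (by decide), h5]
  · intro i _; rw [hf''.arr 3 (by decide)]
  · intro a ha i _
    rw [hf''.arr a]
    simp at ha ⊢
    omega
  · intro x hx; simp at hx
  · simp [val]

/-- The branching procedure with fuel `k` is correct and takes at most `(320 (n + 1)⁵)ᵏ⁺¹`
steps. -/
theorem callOK (k : ℕ) : CallOK G w [solveC] k ((320 * (n + 1) ^ 5) ^ (k + 1)) := by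
  have h1 : 1 ≤ (n + 1) ^ 4 := Nat.one_le_pow _ _ (Nat.succ_pos n)
  have h5 : (n + 1) ^ 5 = (n + 1) ^ 4 * (n + 1) := pow_succ _ _
  have hM : n + 1 ≤ (n + 1) ^ 5 := by rw [h5]; exact Nat.le_mul_of_pos_left _ h1
  induction k with
  | zero =>
    intro A s hE h4 h5 hA
    refine Runs.call rfl ((runs_solveC_zero hE h4 h5).mono (T' := n * 5 + 4) le_rfl fun _ h => h)
      |>.mono ?_ fun _ h => h
    rw [zero_add, pow_one]
    omega
  | succ k ih =>
    intro A s hE h4 h5' hA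
    refine Runs.call rfl (runs_solveC_succ ih hE h4 h5' hA) |>.mono ?_ fun _ h => h
    -- With `M = (n + 1)⁵` the recurrence is `3nT + 300M + 1 ≤ 320MT`: here `n ≤ M`, and `T ≥ 320M`
    -- absorbs the additive terms.
    have hT : 320 * (n + 1) ^ 5 ≤ (320 * (n + 1) ^ 5) ^ (k + 1) :=
      Nat.le_self_pow (Nat.succ_ne_zero k) _
    rw [pow_succ _ (k + 1)]
    generalize (320 * (n + 1) ^ 5) ^ (k + 1) = T at hT ⊢
    generalize (n + 1) ^ 5 = M at hM hT ⊢
    nlinarith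

end MWIS

/-! ### Initialization, and the computation of the fuel. -/

namespace MWIS

open RAM

variable {subs : List Cmd} {n : ℕ} {G : SimpleGraph (Fin n)} {w : Fin n → ℕ}

/-- With the fuel in register `4`, solve the whole graph. -/
def startC : Cmd :=
  .seq (.seq (.add 6 0 3) (.seq (.const 5 0) (.copy 18 4))) (.seq (forDown 18 (.add 5 5 6))
    (.seq (fill 3 5 (.const 15 1)) (.call 0)))

open Classical in
-- The input describes cells by the existence of an edge with the given address; since `v < n`, the
-- address `n * u + v` determines `u` as a quotient and then `v`.
theorem input_adj (G : SimpleGraph (Fin n)) (w : Fin n → ℕ) (p q : ℕ) (u v : Fin n) :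
    (input G w p q).arr 0 (n * u + v) = if G.Adj u v then 1 else 0 := by
  simp only [input, if_true]
  congr 1
  simp only [eq_iff_iff]
  constructor
  · rintro ⟨u', v', h, he⟩
    have hn : 0 < n := u.pos
    have h1 : (u : ℕ) = u' := by
      have := congrArg (· / n) he
      simpa [Nat.mul_add_div hn, Nat.div_eq_of_lt v.2, Nat.div_eq_of_lt v'.2] using this
    have h2 : (v : ℕ) = v' := by
      rw [h1] at he; omega
    rwa [Fin.ext h1, Fin.ext h2]
  · intro h
    exact ⟨u, v, h, rfl⟩

theorem runs_startC {s : Store} {p q : ℕ} {W : List ℕ} {k : ℕ}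
    (hf : Frame W [] (input G w p q) s) (h0 : 0 ∉ W) (h3 : s.reg 3 = 1)
    (h4 : s.reg 4 = k) :
    Runs [solveC] startC s (3 * k + 5 * n + 6 + (320 * (n + 1) ^ 5) ^ (k + 1)) fun s' =>
      Sol G w k Finset.univ (output n s') := by
  classical
  have r0 : s.reg 0 = n := by rw [hf.reg 0 h0]; simp [input]
  refine Runs.mono (T := 3 + ((k * (1 + 2) + 1) + ((n * (1 + 4) + 2) +
    (320 * (n + 1) ^ 5) ^ (k + 1)))) (Runs.straight_seq rfl ?_) (by omega) fun _ h => h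
  have hf₁ : Frame [6, 5, 18] [] s
      ((Cmd.seq (.add 6 0 3) (.seq (.const 5 0) (.copy 18 4))).eval s) :=
    (frame_setReg _ _ (by simp)).trans ((frame_setReg _ _ (by simp)).trans
      (frame_setReg _ _ (by simp)))
  have e6 : ((Cmd.seq (.add 6 0 3) (.seq (.const 5 0) (.copy 18 4))).eval s).reg 6 = n + 1 := by
    simp [Cmd.eval, setReg_reg, r0, h3]
  have e18 : ((Cmd.seq (.add 6 0 3) (.seq (.const 5 0) (.copy 18 4))).eval s).reg 18 = k := by
    simp [Cmd.eval, setReg_reg, h4]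
  have e5 : ((Cmd.seq (.add 6 0 3) (.seq (.const 5 0) (.copy 18 4))).eval s).reg 5 = 0 := by
    simp [Cmd.eval, setReg_reg]
  generalize (Cmd.seq (.add 6 0 3) (.seq (.const 5 0) (.copy 18 4))).eval s = s₁ at hf₁ e6 e18 e5
  have hE₁ : Env G w s₁ := by
    refine ⟨?_, ?_, e6, fun u v => ?_, fun v => ?_⟩
    · rw [hf₁.reg 0 (by decide), r0]
    · rw [hf₁.reg 3 (by decide), h3]
    · rw [hf₁.arr 0 (by decide), hf.arr 0 (by simp), input_adj]
    · rw [hf₁.arr 1 (by decide), hf.arr 1 (by simp)]; simp [input]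
  refine ((Runs.forDown (T := 1) (m := k) (fun j s' => s'.reg 5 + j * (n + 1) = k * (n + 1)) rfl
    (by decide) (by decide) (by decide) hE₁.one e18 (by rw [e5, zero_add])
    (fun j s' x h => by simpa [setReg_reg] using h) ?_).frame rfl).seq ?_
  · intro j hj s' hf' _ h
    refine Runs.straight (P := .add 5 5 6) rfl ?_
    simp only [Cmd.eval, setReg_reg, if_true]
    rw [hf'.reg 6 (by decide), e6, ← h, level_succ]
    ring
  rintro s₂ ⟨r5, hf₂⟩
  have hE₂ : Env G w s₂ := hE₁.frame hf₂
  have r5' : s₂.reg 5 = k * (n + 1) := by simpa using r5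
  refine ((runs_fill (b := k * (n + 1)) (B := Finset.univ) (T := 1) rfl (by decide) (by decide)
    (by decide) (by decide) (by decide) (by decide) hE₂.size hE₂.one r5'
    fun v s' _ _ _ => Runs.straight rfl (by simp [Cmd.eval, setReg_reg])).frame rfl).seq ?_
  rintro s₃ ⟨⟨hb, -⟩, hf₃⟩
  refine (callOK k _ s₃ (hE₂.frame hf₃) ?_ ?_ hb).mono le_rfl ?_
  · rw [hf₃.reg 4 (by decide), hf₂.reg 4 (by decide), hf₁.reg 4 (by decide), h4]
  · rw [hf₃.reg 5 (by decide), r5']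
  · intro s' h
    obtain ⟨R, hR, hR'⟩ := h.sol
    convert hR
    ext v
    have := hR' v
    rw [zero_add] at this
    simp [output, ← this]

/-- Put the product of the registers `x` and `y` into register `z`. -/
def mulC (z x y : ℕ) : Cmd := .seq (.seq (.const z 0) (.copy 18 y)) (forDown 18 (.add z z x))

theorem runs_mulC {z x y : ℕ} (hz : z ∉ [3, 18, x, y]) (hx : x ≠ 18) {s : Store}
    (h3 : s.reg 3 = 1) {a b : ℕ} (ha : s.reg x = a) (hb : s.reg y = b) :
    Runs subs (mulC z x y) s (b * 3 + 3) fun s' => s'.reg z = a * b ∧ Frame [z, 18] [] s s' := by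
  simp only [List.mem_cons, List.not_mem_nil, or_false, not_or] at hz
  have key : Runs subs (mulC z x y) s (b * 3 + 3) fun s' => s'.reg z = a * b := by
    refine Runs.mono (T := 2 + (b * (1 + 2) + 1)) (Runs.straight_seq rfl ?_) (by omega) fun _ h => h
    refine (Runs.forDown (T := 1) (m := b) (fun j s' => s'.reg z + a * j = a * b) rfl
      (by simp [Cmd.writes, Ne.symm hz.2.1]) (by simp [Cmd.writes, Ne.symm hz.1]) (by decide)
      ?_ ?_ ?_ ?_ ?_).mono le_rfl fun s' h => by simpa using h
    · simp [Cmd.eval, setReg_reg, Ne.symm hz.1, h3]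
    · simp [Cmd.eval, setReg_reg, Ne.symm hz.2.2.2, hb]
    · simp [Cmd.eval, setReg_reg, hz.2.1]
    · intro j s' v h; simpa [setReg_reg, hz.2.1] using h
    · intro j hj s' hf _ h
      refine Runs.straight (P := .add z z x) rfl ?_
      simp only [Cmd.eval, setReg_reg, if_true]
      have : s'.reg x = a := by
        rw [hf.reg x (by simp [Cmd.writes, hx, Ne.symm hz.2.2.1])]
        simp [Cmd.eval, setReg_reg, hx, Ne.symm hz.2.2.1, ha]
      rw [this, ← h]; ring
  refine (key.frame rfl).mono le_rfl fun s' h => ⟨h.1, h.2.mono ?_ ?_⟩ <;>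
    simp [mulC, Cmd.writes, Cmd.stores, forDown]

/-! ### The fuel -/

/-- Fuel for an exact solution. -/
noncomputable def exactFuel (t n : ℕ) : ℕ := ⌈Real.sqrt n⌉₊ * (8 * t + 12)

/-- This turns the real ceiling into a comparison with perfect squares, which the machine can
perform. -/
theorem ceil_sqrt_le_iff (n m : ℕ) : ⌈Real.sqrt n⌉₊ ≤ m ↔ n ≤ m * m := by
  rw [Nat.ceil_le, Real.sqrt_le_left (Nat.cast_nonneg m), sq]
  exact_mod_cast Iff.rfl

/-- Compute `exactFuel t n` in register `4`. -/
def exactFuelC (t : ℕ) : Cmd :=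
  .seq (.seq (.const 3 1) (.seq (.const 20 0) (.seq (.const 21 0) (.seq (.const 22 1)
    (.seq (.copy 24 0) (.const 25 2)))))) (.seq
    (.loop 24 (.seq (.add 21 21 22) (.seq (.add 22 22 25) (.seq (.add 20 20 3) (.sub 24 0 21)))))
    (.seq (.const 29 (8 * t + 12)) (mulC 4 20 29)))

theorem runs_exactFuelC (t : ℕ) (G : SimpleGraph (Fin n)) (w : Fin n → ℕ) (p q : ℕ) :
    Runs subs (exactFuelC t) (input G w p q) (5 * ⌈Real.sqrt n⌉₊ + 3 * (8 * t + 12) + 11) fun s' =>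
      s'.reg 4 = exactFuel t n ∧ s'.reg 3 = 1 ∧
        Frame [3, 4, 18, 20, 21, 22, 24, 25, 29] [] (input G w p q) s' := by
  have key : Runs subs (exactFuelC t) (input G w p q)
      (5 * ⌈Real.sqrt n⌉₊ + 3 * (8 * t + 12) + 11) fun s' =>
      s'.reg 4 = exactFuel t n ∧ s'.reg 3 = 1 := by
    have hm := ceil_sqrt_le_iff n
    rw [exactFuel]
    generalize ⌈Real.sqrt n⌉₊ = m at hm
    refine Runs.mono (T := 6 + ((m * (4 + 1) + 1) + (1 + ((8 * t + 12) * 3 + 3))))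
      (Runs.straight_seq rfl ?_) (by omega) fun _ h => h
    -- After `i = m - j` rounds the registers hold `i`, `i²` and the next odd number `2i + 1`.
    -- Squares arise as sums of odd numbers, and the loop stops at the first `i` with `n ≤ i²`.
    refine (Runs.loop (T := 4) (fun j s' => j ≤ m ∧ s'.reg 0 = n ∧ s'.reg 3 = 1 ∧ s'.reg 25 = 2 ∧
      s'.reg 20 = m - j ∧ s'.reg 21 = (m - j) * (m - j) ∧ s'.reg 22 = 2 * (m - j) + 1 ∧
      s'.reg 24 = n - (m - j) * (m - j)) ?_ ?_ (m := m) ?_).seq ?_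
    · rintro j s' ⟨hj, -, -, -, -, -, -, h⟩
      rw [h, Nat.sub_eq_zero_iff_le, ← hm]
      omega
    · rintro j s' ⟨hj, h0, h3, h25, h20, h21, h22, h24⟩
      refine Runs.straight rfl ?_
      obtain ⟨i, rfl⟩ : ∃ i, m = i + (j + 1) := ⟨m - (j + 1), by omega⟩
      rw [Nat.add_sub_cancel] at h20 h21 h22 h24
      rw [show i + (j + 1) - j = i + 1 by omega]
      have e : i * i + (2 * i + 1) = (i + 1) * (i + 1) := by ring
      simp [Cmd.eval, setReg_reg, h0, h3, h25, h20, h21, h22, e]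
      omega
    · simp [Cmd.eval, setReg_reg, input]
    · rintro s' ⟨-, h0, h3, h25, h20, -, -, -⟩
      refine Runs.straight_seq (P := .const 29 (8 * t + 12)) rfl ?_
      refine (runs_mulC (a := m) (b := 8 * t + 12) (by decide) (by decide) ?_ ?_ ?_).mono le_rfl ?_
      · simp [Cmd.eval, setReg_reg, h3]
      · simp [Cmd.eval, setReg_reg, h20]
      · simp [Cmd.eval, setReg_reg]
      · rintro s'' ⟨h, hf⟩
        exact ⟨h, by rw [hf.reg 3 (by decide)]; simp [Cmd.eval, setReg_reg, h3]⟩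
  refine (key.frame rfl).mono le_rfl fun s' h => ⟨h.1.1, h.1.2, h.2.mono ?_ ?_⟩
  · simp [exactFuelC, mulC, Cmd.writes, forDown]
  · simp [exactFuelC, mulC, Cmd.stores, forDown]

/-- Fuel for an approximate solution with accuracy `p / q`. -/
def approxFuel (t n p q : ℕ) : ℕ :=
  Nat.clog 2 (n + 1) * Nat.clog 2 (n + 1) * Nat.clog 2 (n + 1) * ((q + (p - 1)) / p) * (2 * t + 1)

/-- Compute `approxFuel t n p q` in register `4`. -/
def approxFuelC (t : ℕ) : Cmd :=
  .seq (.seq (.const 3 1) (.seq (.const 20 0) (.copy 21 2))) (.seq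
    (.loop 21 (.seq (.sub 21 21 1) (.add 20 20 3))) (.seq
    (.seq (.const 22 0) (.seq (.const 23 1) (.seq (.add 25 0 3) (.sub 24 25 23)))) (.seq
    (.loop 24 (.seq (.add 23 23 23) (.seq (.add 22 22 3) (.sub 24 25 23)))) (.seq
    (mulC 26 22 22) (.seq (mulC 27 26 22) (.seq (mulC 28 27 20) (.seq (.const 29 (2 * t + 1))
    (mulC 4 28 29))))))))

theorem runs_approxFuelC (t : ℕ) (G : SimpleGraph (Fin n)) (w : Fin n → ℕ) {p q : ℕ} (hp : 0 < p) :
    Runs subs (approxFuelC t) (input G w p q)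
      (6 * ((q + (p - 1)) / p) + 10 * Nat.clog 2 (n + 1) + 3 * (2 * t + 1) + 22) fun s' =>
      s'.reg 4 = approxFuel t n p q ∧ s'.reg 3 = 1 ∧
        Frame [3, 4, 18, 20, 21, 22, 23, 24, 25, 26, 27, 28, 29] [] (input G w p q) s' := by
  have key : Runs subs (approxFuelC t) (input G w p q)
      (6 * ((q + (p - 1)) / p) + 10 * Nat.clog 2 (n + 1) + 3 * (2 * t + 1) + 22) fun s' =>
      s'.reg 4 = approxFuel t n p q ∧ s'.reg 3 = 1 := by
    have hb : ∀ i, (q + (p - 1)) / p ≤ i ↔ q ≤ i * p := fun i => by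
      rw [← Nat.lt_succ_iff, Nat.div_lt_iff_lt_mul hp, Nat.succ_mul]; omega
    have hl : ∀ i, Nat.clog 2 (n + 1) ≤ i ↔ n + 1 ≤ 2 ^ i := fun i =>
      Nat.clog_le_iff_le_pow (by norm_num)
    rw [approxFuel]
    generalize (q + (p - 1)) / p = b at hb
    generalize Nat.clog 2 (n + 1) = l at hl
    refine Runs.mono (T := 3 + ((b * (2 + 1) + 1) + (4 + ((l * (3 + 1) + 1) + ((l * 3 + 3) +
      ((l * 3 + 3) + ((b * 3 + 3) + (1 + ((2 * t + 1) * 3 + 3)))))))))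
      (Runs.straight_seq rfl ?_) (by omega) fun _ h => h
    -- Repeated subtraction of `p` from `q` takes exactly `⌈q / p⌉` rounds to reach zero.
    refine (Runs.loop (T := 2) (fun j s' => j ≤ b ∧ s'.reg 0 = n ∧ s'.reg 3 = 1 ∧ s'.reg 1 = p ∧
      s'.reg 20 = b - j ∧ s'.reg 21 = q - (b - j) * p) ?_ ?_ (m := b) ?_).seq ?_
    · rintro j s' ⟨hj, -, -, -, -, h⟩
      rw [h, Nat.sub_eq_zero_iff_le, ← hb]
      omega
    · rintro j s' ⟨hj, h0, h3, h1, h20, h21⟩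
      refine Runs.straight rfl ?_
      obtain ⟨i, rfl⟩ : ∃ i, b = i + (j + 1) := ⟨b - (j + 1), by omega⟩
      rw [Nat.add_sub_cancel] at h20 h21
      rw [show i + (j + 1) - j = i + 1 by omega, Nat.succ_mul]
      simp [Cmd.eval, setReg_reg, h0, h3, h1, h20, h21]
      omega
    · simp [Cmd.eval, setReg_reg, input]
    rintro s₁ ⟨-, h0, h3, -, h20, -⟩
    refine Runs.straight_seq rfl ?_
    -- Repeated doubling: the loop stops at the first `i` with `n + 1 ≤ 2 ^ i`, which is `Nat.clog 2
    -- (n + 1)`.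
    refine (Runs.loop (T := 3) (fun j s' => j ≤ l ∧ s'.reg 3 = 1 ∧ s'.reg 25 = n + 1 ∧
      s'.reg 20 = b ∧ s'.reg 22 = l - j ∧ s'.reg 23 = 2 ^ (l - j) ∧
      s'.reg 24 = n + 1 - 2 ^ (l - j)) ?_ ?_ (m := l) ?_).seq ?_
    · rintro j s' ⟨hj, -, -, -, -, -, h⟩
      rw [h, Nat.sub_eq_zero_iff_le, ← hl]
      omega
    · rintro j s' ⟨hj, h3, h25, h20, h22, h23, h24⟩
      refine Runs.straight rfl ?_
      obtain ⟨i, rfl⟩ : ∃ i, l = i + (j + 1) := ⟨l - (j + 1), by omega⟩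
      rw [Nat.add_sub_cancel] at h22 h23 h24
      rw [show i + (j + 1) - j = i + 1 by omega, pow_succ]
      simp [Cmd.eval, setReg_reg, h3, h25, h20, h22, h23, ← mul_two]
      omega
    · simp [Cmd.eval, setReg_reg, h0, h3, h20]
    rintro s₂ ⟨-, h3, -, h20, h22, -, -⟩
    rw [Nat.sub_zero] at h22
    refine (runs_mulC (a := l) (b := l) (by decide) (by decide) h3 h22 h22).seq ?_
    rintro s₃ ⟨h26, hf₃⟩
    refine (runs_mulC (a := l * l) (b := l) (by decide) (by decide)
      (by rw [hf₃.reg 3 (by decide), h3]) h26 (by rw [hf₃.reg 22 (by decide), h22])).seq ?_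
    rintro s₄ ⟨h27, hf₄⟩
    refine (runs_mulC (a := l * l * l) (b := b) (by decide) (by decide)
      (by rw [hf₄.reg 3 (by decide), hf₃.reg 3 (by decide), h3]) h27
      (by rw [hf₄.reg 20 (by decide), hf₃.reg 20 (by decide), h20])).seq ?_
    rintro s₅ ⟨h28, hf₅⟩
    have h3' : s₅.reg 3 = 1 := by
      rw [hf₅.reg 3 (by decide), hf₄.reg 3 (by decide), hf₃.reg 3 (by decide), h3]
    refine Runs.straight_seq (P := .const 29 (2 * t + 1)) rfl ?_
    refine (runs_mulC (a := l * l * l * b) (b := 2 * t + 1) (by decide) (by decide) ?_ ?_ ?_).mono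
      le_rfl ?_
    · simp [Cmd.eval, setReg_reg, h3']
    · simp [Cmd.eval, setReg_reg, h28]
    · simp [Cmd.eval, setReg_reg]
    · rintro s'' ⟨h, hf⟩
      exact ⟨h, by rw [hf.reg 3 (by decide)]; simp [Cmd.eval, setReg_reg, h3']⟩
  refine (key.frame rfl).mono le_rfl fun s' h => ⟨h.1.1, h.1.2, h.2.mono ?_ ?_⟩
  · simp [approxFuelC, mulC, Cmd.writes, forDown]
  · simp [approxFuelC, mulC, Cmd.stores, forDown]

/-- The exact algorithm. -/
def exactProgram (t : ℕ) : Program := ⟨.seq (exactFuelC t) startC, [solveC]⟩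

/-- The approximation scheme. -/
def approxProgram (t : ℕ) : Program := ⟨.seq (approxFuelC t) startC, [solveC]⟩

theorem exactProgram_halts (t : ℕ) (G : SimpleGraph (Fin n)) (w : Fin n → ℕ) :
    ∃ k s, (exactProgram t).HaltsIn (input G w 0 0) k s ∧
      k ≤ (5 * ⌈Real.sqrt n⌉₊ + 3 * (8 * t + 12) + 11) + (3 * exactFuel t n + 5 * n + 6 +
        (320 * (n + 1) ^ 5) ^ (exactFuel t n + 1)) ∧
      Sol G w (exactFuel t n) Finset.univ (output n s) :=
  (runs_exactFuelC t G w 0 0).seq fun _ h => runs_startC h.2.2 (by decide) h.2.1 h.1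

theorem approxProgram_halts (t : ℕ) (G : SimpleGraph (Fin n)) (w : Fin n → ℕ) {p q : ℕ}
    (hp : 0 < p) :
    ∃ k s, (approxProgram t).HaltsIn (input G w p q) k s ∧
      k ≤ (6 * ((q + (p - 1)) / p) + 10 * Nat.clog 2 (n + 1) + 3 * (2 * t + 1) + 22) +
        (3 * approxFuel t n p q + 5 * n + 6 +
        (320 * (n + 1) ^ 5) ^ (approxFuel t n p q + 1)) ∧
      Sol G w (approxFuel t n p q) Finset.univ (output n s) :=
  (runs_approxFuelC t G w hp).seq fun _ h => runs_startC h.2.2 (by decide) h.2.1 h.1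

end MWIS

/-! ### Balanced separators in graphs without long induced cycles -/

namespace MWIS

open Relation

set_option linter.unusedSectionVars false

section Separator

variable {V : Type*} [Fintype V] [DecidableEq V] {G : SimpleGraph V}

/-- Only pairs `i < j` have to be checked, where the cyclic adjacency reads `j = i + 1` or `{i, j} =
{0, N - 1}`, so no modular arithmetic is left to the applications. -/
theorem cycleGraph_isIndContained {N : ℕ} (hN : 3 ≤ N) (f : ℕ → V)
    (hf : ∀ i j, i < j → j < N →
      f i ≠ f j ∧ (G.Adj (f i) (f j) ↔ j = i + 1 ∨ (i = 0 ∧ j + 1 = N))) :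
    (SimpleGraph.cycleGraph N).IsIndContained G := by
  have hinj : ∀ u v : Fin N, f u = f v → u = v := by
    intro u v h
    rcases lt_trichotomy (u : ℕ) v with h' | h' | h'
    · exact absurd h (hf _ _ h' v.2).1
    · exact Fin.ext h'
    · exact absurd h.symm (hf _ _ h' u.2).1
  have hlt : ∀ u v : Fin N, u < v → (G.Adj (f u) (f v) ↔ (SimpleGraph.cycleGraph N).Adj u v) := by
    intro u v huv
    have huv' : (u : ℕ) < v := huv
    rw [(hf _ _ huv' v.2).2, SimpleGraph.cycleGraph_adj']
    have h1 : (v - u).val = v - u := by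
      rw [Fin.sub_val_of_le huv.le]
    have h2 : (u - v).val = N - (v - u) := by
      rw [Fin.sub_def]
      simp only
      rw [show N - (v : ℕ) + u = N - (v - u) by omega, Nat.mod_eq_of_lt (by omega)]
    rw [h1, h2]
    omega
  refine ⟨⟨⟨fun i : Fin N => f i, fun u v h => hinj u v h⟩, fun {u v} => ?_⟩⟩
  change G.Adj (f u) (f v) ↔ _
  rcases lt_trichotomy u v with h | rfl | h
  · exact hlt u v h
  · simp
  · rw [G.adj_comm, (SimpleGraph.cycleGraph N).adj_comm]
    exact hlt v u h

/-- The vertices `q 0, …, q (l - 1)` of `S` form a walk from a neighbour of `x` to a neighbour of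
`y`. -/
def IsLink (G : SimpleGraph V) (S : Finset V) (x y : V) (l : ℕ) (q : ℕ → V) : Prop :=
  0 < l ∧ (∀ i < l, q i ∈ S) ∧ (∀ i, i + 1 < l → G.Adj (q i) (q (i + 1))) ∧ G.Adj x (q 0) ∧
    G.Adj y (q (l - 1))

theorem exists_isLink {S : Finset V} {x y a b : V} (ha : a ∈ S) (h : ReflTransGen (AdjIn G S) a b)
    (hx : G.Adj x a) (hy : G.Adj y b) : ∃ l q, IsLink G S x y l q := by
  induction h using ReflTransGen.head_induction_on generalizing x with
  | refl => exact ⟨1, fun _ => b, by simp, by simp [ha], by simp, hx, hy⟩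
  | head hac hcb ih =>
    rename_i a c
    obtain ⟨l, q, h₁, h₂, h₃, h₄, h₅⟩ := ih hac.2.1 hac.2.2
    refine ⟨l + 1, fun i => if i = 0 then a else q (i - 1), by omega, ?_, ?_, ?_, ?_⟩
    · intro i hi
      by_cases h0 : i = 0
      · simpa [h0] using ha
      · simpa [h0] using h₂ (i - 1) (by omega)
    · intro i hi
      by_cases h0 : i = 0
      · simpa [h0] using h₄
      · have := h₃ (i - 1) (by omega)
        rw [Nat.sub_add_cancel (by omega)] at this
        simpa [h0] using this
    · simpa using hx
    · have : l ≠ 0 := by omega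
      simpa [this] using h₅

/-- A shortest link is an induced path with no further neighbours of the two ends. -/
theorem exists_induced_link {S : Finset V} {x y : V} (h : ∃ l q, IsLink G S x y l q) :
    ∃ l q, IsLink G S x y l q ∧
      (∀ i j, i < j → j < l → q i ≠ q j ∧ (G.Adj (q i) (q j) ↔ j = i + 1)) ∧
      (∀ i < l, (G.Adj x (q i) ↔ i = 0)) ∧ ∀ i < l, (G.Adj y (q i) ↔ i + 1 = l) := by
  classical
  obtain ⟨q, hq⟩ := Nat.find_spec h
  have hmin : ∀ l' < Nat.find h, ∀ q', ¬ IsLink G S x y l' q' := fun l' hl' q' h' =>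
    Nat.find_min h hl' ⟨q', h'⟩
  generalize Nat.find h = l at hq hmin
  obtain ⟨h₁, h₂, h₃, h₄, h₅⟩ := hq
  have hx : ∀ i < l, (G.Adj x (q i) ↔ i = 0) := by
    intro i hi
    refine ⟨fun ha => ?_, fun h => h ▸ h₄⟩
    by_contra h0
    refine hmin (l - i) (by omega) (fun z => q (z + i)) ⟨by omega, fun z hz => h₂ _ (by omega),
      fun z hz => ?_, by simpa using ha, ?_⟩
    · have := h₃ (z + i) (by omega)
      rwa [show z + i + 1 = z + 1 + i by omega] at this
    · beta_reduce
      rw [show l - i - 1 + i = l - 1 by omega]; exact h₅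
  have hy : ∀ i < l, (G.Adj y (q i) ↔ i + 1 = l) := by
    intro i hi
    refine ⟨fun ha => ?_, fun h => by rwa [show i = l - 1 by omega]⟩
    by_contra h0
    exact hmin (i + 1) (by omega) q ⟨by omega, fun z hz => h₂ _ (by omega),
      fun z hz => h₃ z (by omega), h₄, by simpa using ha⟩
  -- A chord would allow `d` vertices of the link to be skipped, against minimality.
  have cut : ∀ i d, 1 ≤ d → i + 1 + d < l → ¬ G.Adj (q i) (q (i + 1 + d)) := by
    intro i d hd hi ha
    refine hmin (l - d) (by omega) (fun z => if z ≤ i then q z else q (z + d))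
      ⟨by omega, fun z hz => ?_, fun z hz => ?_, by simpa using h₄, ?_⟩
    · simp only
      split_ifs <;> exact h₂ _ (by omega)
    · simp only
      by_cases hzi : z < i
      · rw [if_pos (by omega), if_pos (by omega)]; exact h₃ z (by omega)
      · by_cases hzi' : z = i
        · subst hzi'
          rw [if_pos le_rfl, if_neg (by omega)]; exact ha
        · rw [if_neg (by omega), if_neg (by omega), show z + 1 + d = z + d + 1 by omega]
          exact h₃ _ (by omega)
    · beta_reduce
      rw [if_neg (by omega), show l - d - 1 + d = l - 1 by omega]; exact h₅
  refine ⟨l, q, ⟨h₁, h₂, h₃, h₄, h₅⟩, fun i j hij hj => ⟨fun he => ?_, fun ha => ?_, ?_⟩, hx, hy⟩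
  -- A repeated vertex is also excluded by minimality: `q i` would inherit the neighbour `y` or `q
  -- (j + 1)` of `q j`, and the link could be shortened.
  · by_cases hjl : j + 1 = l
    · have := (hy j hj).2 hjl
      rw [← he, hy i (by omega)] at this
      omega
    · have := h₃ j (by omega)
      rw [← he] at this
      refine cut i (j - i) (by omega) (by omega) ?_
      rwa [show i + 1 + (j - i) = j + 1 by omega]
  · by_contra hne
    refine cut i (j - i - 1) (by omega) (by omega) ?_
    rwa [show i + 1 + (j - i - 1) = j by omega]
  · rintro rfl; exact h₃ i hj

/-- An induced path whose ends, but no inner vertices, have neighbours in a connected set closes up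
to an induced cycle. -/
theorem exists_long_cycle {a : ℕ} (ha : 1 ≤ a) (p : ℕ → V)
    (hp : ∀ i j, i < j → j ≤ a → p i ≠ p j ∧ (G.Adj (p i) (p j) ↔ j = i + 1)) {S : Finset V}
    (hS : ∀ x ∈ S, ∀ y ∈ S, ReflTransGen (AdjIn G S) x y) (hpS : ∀ i ≤ a, p i ∉ S)
    (h0 : ∃ x ∈ S, G.Adj (p 0) x) (h1 : ∃ x ∈ S, G.Adj (p a) x)
    (hmid : ∀ i, 0 < i → i < a → ∀ x ∈ S, ¬ G.Adj (p i) x) :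
    ∃ N, a + 2 ≤ N ∧ (SimpleGraph.cycleGraph N).IsIndContained G := by
  obtain ⟨x, hx, hpx⟩ := h0
  obtain ⟨y, hy, hpy⟩ := h1
  obtain ⟨l, q, ⟨h₁, h₂, -, -, -⟩, hq, hqa, hq0⟩ :=
    exists_induced_link (exists_isLink hy (hS y hy x hx) hpy hpx)
  -- The cycle runs along the path from `p 0` to `p a` and returns through `S` along the link; a
  -- link has at least one vertex, which gives length at least `a + 2`.
  refine ⟨a + 1 + l, by omega, cycleGraph_isIndContained (by omega)
    (fun i => if i ≤ a then p i else q (i - (a + 1))) fun i j hij hj => ?_⟩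
  by_cases hja : j ≤ a
  · rw [if_pos (by omega), if_pos hja, (hp i j hij hja).2]
    exact ⟨(hp i j hij hja).1, by omega⟩
  · rw [if_neg hja]
    by_cases hia : i ≤ a
    · rw [if_pos hia]
      have hqS := h₂ (j - (a + 1)) (by omega)
      refine ⟨fun he => hpS i hia (he ▸ hqS), ?_⟩
      by_cases hi0 : i = 0
      · subst hi0
        rw [hq0 _ (by omega)]
        omega
      · by_cases hia' : i = a
        · subst hia'
          rw [hqa _ (by omega)]
          omega
        · refine ⟨fun h => absurd h (hmid i (by omega) (by omega) _ hqS), ?_⟩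
          omega
    · rw [if_neg hia, (hq _ _ (by omega) (by omega)).2]
      exact ⟨(hq _ _ (by omega) (by omega)).1, by omega⟩

open Classical in
/-- The closed neighbourhood of a set. -/
noncomputable def nbs (G : SimpleGraph V) (X : Finset V) : Finset V :=
  Finset.univ.filter fun v => ∃ x ∈ X, v = x ∨ G.Adj x v

theorem mem_nbs {X : Finset V} {v : V} : v ∈ nbs G X ↔ ∃ x ∈ X, v = x ∨ G.Adj x v := by
  simp [nbs]

theorem exists_step_of_reach {r : V → V → Prop} {p : V → Prop} {a b : V} (h : ReflTransGen r a b)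
    (ha : p a) (hb : ¬ p b) : ∃ x y, r x y ∧ p x ∧ ¬ p y := by
  induction h with
  | refl => exact absurd ha hb
  | tail _ h ih =>
    rename_i c d _
    by_cases hc : p c
    · exact ⟨c, d, h, hc, hb⟩
    · exact ih hc

theorem reach_mono {A B : Finset V} (h : A ⊆ B) {x y : V} (hxy : ReflTransGen (AdjIn G A) x y) :
    ReflTransGen (AdjIn G B) x y :=
  ReflTransGen.mono (r := AdjIn G A)
    (fun x y (hxy : AdjIn G A x y) => (⟨h hxy.1, h hxy.2.1, hxy.2.2⟩ : AdjIn G B x y)) _ _ hxy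

theorem comp_connected (A : Finset V) (u : V) :
    ∀ x ∈ comp G A u, ∀ y ∈ comp G A u, ReflTransGen (AdjIn G (comp G A u)) x y := by
  have key : ∀ y ∈ comp G A u, ReflTransGen (AdjIn G (comp G A u)) u y := by
    intro y hy
    obtain ⟨-, hu, h⟩ := mem_comp.1 hy
    clear hy
    induction h with
    | refl => exact .refl
    | tail hux hxy ih =>
      have hx := mem_comp.2 ⟨hxy.1, hu, hux⟩
      exact ih.tail ⟨hx, comp_closed hx hxy.2.1 hxy.2.2, hxy.2.2⟩
  intro x hx y hy
  exact (reach_symm (key x hx)).trans (key y hy)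

/-- An induced path `v 0, …, v m` in `A` together with a large component `D` of the complement of
the closed neighbourhood of `v 0, …, v (m - 1)`, such that `v m` sees `D`. -/
structure PathState (G : SimpleGraph V) (A : Finset V) (m : ℕ) (v : ℕ → V) (D : Finset V) :
    Prop where
  mem : ∀ i ≤ m, v i ∈ A
  path : ∀ i j, i < j → j ≤ m → v i ≠ v j ∧ (G.Adj (v i) (v j) ↔ j = i + 1)
  sub : D ⊆ A
  conn : ∀ x ∈ D, ∀ y ∈ D, ReflTransGen (AdjIn G D) x y
  avoid : ∀ d ∈ D, ∀ i < m, d ≠ v i ∧ ¬ G.Adj (v i) d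
  large : A.card < 2 * D.card
  sees : ∃ d ∈ D, d = v m ∨ G.Adj (v m) d

/-- Let `C` be the large component left by the closed neighbourhood of the last `t` path vertices.
If `C` misses the closed neighbourhoods of all path vertices, the path is prolonged by a vertex of
`D` next to `C`, and `C` is the new large component. Otherwise `C` reaches the neighbourhood of a
path vertex at distance at least `t` from the end, and a detour through `D ∪ C` closes an induced
cycle of length at least `t + 2`. -/
theorem PathState.step {t : ℕ} (ht : 1 ≤ t) (hG : HoleFree t G) {A : Finset V}
    (hA : ∀ X ⊆ A, X.card ≤ t → ∃ u, A.card < 2 * (comp G (A \ nbs G X) u).card)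
    {m : ℕ} {v : ℕ → V} {D : Finset V} (h : PathState G A m v D) :
    ∃ v' D', PathState G A (m + 1) v' D' := by
  -- The subtraction is truncated: while the path has fewer than `t` vertices, all of them are used.
  obtain ⟨u, hu⟩ := hA ((Finset.Icc (m + 1 - t) m).image v) (by
      intro x hx
      obtain ⟨i, hi, rfl⟩ := Finset.mem_image.1 hx
      exact h.mem i (Finset.mem_Icc.1 hi).2) (by
      refine Finset.card_image_le.trans ?_
      rw [Nat.card_Icc]; omega)
  have hnb : ∀ y, y ∈ nbs G ((Finset.Icc (m + 1 - t) m).image v) ↔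
      ∃ i, m + 1 - t ≤ i ∧ i ≤ m ∧ (y = v i ∨ G.Adj (v i) y) := by
    intro y
    simp [mem_nbs, and_assoc]
  generalize nbs G ((Finset.Icc (m + 1 - t) m).image v) = Y at hu hnb
  set C := comp G (A \ Y) u with hC
  have hCA : ∀ c ∈ C, c ∈ A ∧ c ∉ Y := fun c hc => Finset.mem_sdiff.1 (comp_subset _ _ hc)
  have hCY : ∀ c ∈ C, ∀ i, m + 1 - t ≤ i → i ≤ m → c ≠ v i ∧ ¬ G.Adj (v i) c := by
    intro c hc i hi hi'
    have := (hCA c hc).2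
    rw [hnb] at this
    push Not at this
    exact this i hi hi'
  -- Both sets contain more than half of `A`.
  obtain ⟨e, he⟩ : (C ∩ D).Nonempty := by
    rw [← Finset.card_pos]
    have h₁ := Finset.card_union_add_card_inter C D
    have h₂ := Finset.card_le_card (Finset.union_subset (fun c hc => (hCA c hc).1) h.sub)
    have h₃ := h.large
    omega
  obtain ⟨heC, heD⟩ := Finset.mem_inter.1 he
  obtain ⟨d, hdD, hd⟩ := h.sees
  by_cases hcase : ∀ c ∈ C, ∀ i ≤ m, c ≠ v i ∧ ¬ G.Adj (v i) c
  · have hdC : d ∉ C := fun hdC => by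
      have := hcase d hdC m le_rfl
      tauto
    -- A walk in `D` from `C ∩ D` to `d` leaves `C` at `y`, which must lie in the deleted
    -- neighbourhood. As `D` avoids the neighbourhoods of all earlier path vertices, only `v m` can
    -- be responsible, so `y` extends the induced path.
    obtain ⟨x, y, ⟨hxD, hyD, hxy⟩, hx, hy⟩ := exists_step_of_reach (p := (· ∈ C))
      (h.conn e heD d hdD) heC hdC
    have hyA := h.sub hyD
    have hyY : y ∈ Y := by
      by_contra hyY
      exact hy (comp_closed hx (Finset.mem_sdiff.2 ⟨hyA, hyY⟩) hxy)
    have hvy : G.Adj (v m) y := by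
      obtain ⟨i, -, hi, hiy⟩ := (hnb y).1 hyY
      rcases hi.lt_or_eq with hi | rfl
      · have := h.avoid y hyD i hi
        tauto
      · rcases hiy with rfl | hiy
        · exact absurd hxy.symm (hcase x hx i le_rfl).2
        · exact hiy
    have hold : ∀ i ≤ m, Function.update v (m + 1) y i = v i := fun i hi =>
      Function.update_of_ne (by omega) _ _
    refine ⟨Function.update v (m + 1) y, C, ?_, ?_, fun c hc => (hCA c hc).1, comp_connected _ _,
      ?_, hu, x, hx, .inr ?_⟩
    · intro i hi
      rcases hi.lt_or_eq with hi | rfl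
      · rw [hold i (by omega)]; exact h.mem i (by omega)
      · simpa using hyA
    · intro i j hij hj
      rcases hj.lt_or_eq with hj | rfl
      · rw [hold i (by omega), hold j (by omega)]; exact h.path i j hij (by omega)
      · rw [hold i (by omega), Function.update_self]
        rcases (Nat.lt_succ_iff.1 hij).lt_or_eq with him | rfl
        · have := h.avoid y hyD i him
          exact ⟨this.1.symm, fun h => absurd h this.2, fun h => by omega⟩
        · exact ⟨hvy.ne, fun _ => rfl, fun _ => hvy⟩
    · intro c hc i hi
      rw [hold i (by omega)]; exact hcase c hc i (by omega)
    · simpa using hxy.symm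
  · exfalso
    push Not at hcase
    obtain ⟨c, hcC, i₀, hi₀, hci₀⟩ := hcase
    have hi₀t : i₀ + t ≤ m := by
      by_contra hlt
      have := hCY c hcC i₀ (by omega) hi₀
      tauto
    -- Here `m ≥ 1`, and `v m` is a neighbour of `v (m - 1)`, whose neighbourhood `D` avoids.
    have hvmD : v m ∉ D := fun hv =>
      (h.avoid _ hv (m - 1) (by omega)).2 ((h.path (m - 1) m (by omega) le_rfl).2.2 (by omega))
    have hvd : G.Adj (v m) d := by
      rcases hd with rfl | hd
      · exact absurd hdD hvmD
      · exact hd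
    classical
    -- `Z` is the closed neighbourhood of the old path vertices. Starting at `d`, the search through
    -- `D ∪ C` is stopped at the first vertex `r` in `Z`; the explored part `S₀` together with `r`
    -- serves as the connected set for `exists_long_cycle`.
    let Z : V → Prop := fun x => ∃ i, i + t ≤ m ∧ (x = v i ∨ G.Adj (v i) x)
    have hDZ : ∀ x ∈ D, ¬ Z x := by
      rintro x hx ⟨i, hi, hxi⟩
      have := h.avoid x hx i (by omega)
      tauto
    let U := D ∪ C
    have hreach : ReflTransGen (AdjIn G U) d c :=
      (reach_mono Finset.subset_union_left (h.conn d hdD e heD)).trans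
        (reach_mono Finset.subset_union_right (comp_connected _ _ e heC c hcC))
    let S₀ := comp G (U.filter fun x => ¬ Z x) d
    have hS₀ : ∀ x ∈ S₀, x ∈ U ∧ ¬ Z x := fun x hx => Finset.mem_filter.1 (comp_subset _ _ hx)
    have hdS₀ : d ∈ S₀ := mem_comp_self
      (Finset.mem_filter.2 ⟨Finset.mem_union_left _ hdD, hDZ d hdD⟩)
    obtain ⟨x, r, ⟨-, hrU, hxr⟩, hx, hr⟩ := exists_step_of_reach (p := (· ∈ S₀)) hreach hdS₀
      (fun hc => (hS₀ c hc).2 ⟨i₀, hi₀t, by tauto⟩)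
    have hrZ : Z r := by
      by_contra hrZ
      exact hr (comp_closed hx (Finset.mem_filter.2 ⟨hrU, hrZ⟩) hxr)
    have hrv : ∀ i, i + t ≤ m → r ≠ v i := by
      rintro i hi rfl
      exact (hS₀ x hx).2 ⟨i, hi, .inr hxr.symm⟩
    have hUlate : ∀ z ∈ U, ∀ i, m < i + t → i ≤ m → z ≠ v i ∧ (i < m → ¬ G.Adj (v i) z) := by
      intro z hz i hi hi'
      rcases Finset.mem_union.1 hz with hz | hz
      · rcases hi'.lt_or_eq with hi' | rfl
        · exact ⟨(h.avoid z hz i hi').1, fun _ => (h.avoid z hz i hi').2⟩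
        · exact ⟨fun hzv => hvmD (hzv ▸ hz), fun h => absurd h (lt_irrefl _)⟩
      · have := hCY z hz i (by omega) hi'
        exact ⟨this.1, fun _ => this.2⟩
    obtain ⟨j₀, hj₀, hrj₀⟩ := hrZ
    -- With `j` the last old index adjacent to `r`, the inner vertices of `v j, …, v m` have no
    -- neighbours in `S₀ ∪ {r}`: the old ones by the choice of `j` and of `S₀`, the recent ones
    -- because `D` and `C` both avoid their neighbourhoods.
    let P : ℕ → Prop := fun i => i + t ≤ m ∧ G.Adj (v i) r
    have hPj₀ : P j₀ := ⟨hj₀, hrj₀.resolve_left (hrv j₀ hj₀)⟩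
    have hj := Nat.findGreatest_spec (P := P) (n := m) (show j₀ ≤ m by omega) hPj₀
    have hjmax : ∀ i, Nat.findGreatest P m < i → i ≤ m → ¬ P i := fun i hi hi' =>
      Nat.findGreatest_is_greatest hi hi'
    generalize Nat.findGreatest P m = j at hj hjmax
    obtain ⟨hjt, hjr⟩ := hj
    have hex : ∃ N, m - j + 2 ≤ N ∧ (SimpleGraph.cycleGraph N).IsIndContained G := by
      refine exists_long_cycle (G := G) (a := m - j) (by omega)
        (fun i => v (j + i)) (fun i i' hi hi' => by
          have := h.path (j + i) (j + i') (by omega) (by omega)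
          exact ⟨this.1, this.2.trans (by omega)⟩) (S := insert r S₀) ?_ ?_
        ⟨r, Finset.mem_insert_self _ _, hjr⟩
        ⟨d, Finset.mem_insert_of_mem hdS₀, by rwa [show j + (m - j) = m by omega]⟩ ?_
      · have hsub : S₀ ⊆ insert r S₀ := Finset.subset_insert _ _
        have key : ∀ z ∈ insert r S₀, ReflTransGen (AdjIn G (insert r S₀)) d z := by
          intro z hz
          rcases Finset.mem_insert.1 hz with rfl | hz
          · exact (reach_mono hsub (comp_connected _ _ d hdS₀ x hx)).tail
              ⟨hsub hx, Finset.mem_insert_self _ _, hxr⟩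
          · exact reach_mono hsub (comp_connected _ _ d hdS₀ z hz)
        intro y hy z hz
        exact (reach_symm (key y hy)).trans (key z hz)
      · intro i hi hmem
        rcases Finset.mem_insert.1 hmem with hm | hm
        · by_cases hit : j + i + t ≤ m
          · exact hrv _ hit hm.symm
          · exact (hUlate r hrU (j + i) (by omega) (by omega)).1 hm.symm
        · by_cases hit : j + i + t ≤ m
          · exact (hS₀ _ hm).2 ⟨j + i, hit, .inl rfl⟩
          · exact (hUlate _ (hS₀ _ hm).1 (j + i) (by omega) (by omega)).1 rfl
      · intro i hi him z hz hadj
        rcases Finset.mem_insert.1 hz with rfl | hz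
        · by_cases hit : j + i + t ≤ m
          · exact hjmax (j + i) (by omega) (by omega) ⟨hit, hadj⟩
          · exact (hUlate _ hrU (j + i) (by omega) (by omega)).2 (by omega) hadj
        · by_cases hit : j + i + t ≤ m
          · exact (hS₀ _ hz).2 ⟨j + i, hit, .inr hadj⟩
          · exact (hUlate _ (hS₀ _ hz).1 (j + i) (by omega) (by omega)).2 (by omega) hadj
    obtain ⟨N, hN, hcyc⟩ := hex
    exact hG N (by omega) hcyc

/-- In a graph without induced cycles of length at least `t`, every vertex set `A` has `t` vertices
whose closed neighbourhood splits `A` into components of at most half its size. -/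
theorem exists_separator {t : ℕ} (ht : 1 ≤ t) (hG : HoleFree t G) (A : Finset V) :
    ∃ X ⊆ A, X.card ≤ t ∧ ∀ u, 2 * (comp G (A \ nbs G X) u).card ≤ A.card := by
  by_contra hcon
  push Not at hcon
  have all : ∀ m, ∃ v D, PathState G A m v D := by
    intro m
    induction m with
    | zero =>
      obtain ⟨u, hu⟩ := hcon ∅ (Finset.empty_subset _) (by simp)
      have he : nbs G (∅ : Finset V) = ∅ := by ext; simp [mem_nbs]
      rw [he, Finset.sdiff_empty] at hu
      have huA : u ∈ A := by
        by_contra hn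
        rw [comp_empty_of_notMem hn] at hu
        simp at hu
      refine ⟨fun _ => u, comp G A u, fun _ _ => huA, fun i j _ _ => by omega, comp_subset _ _,
        comp_connected _ _, fun _ _ i hi => absurd hi (Nat.not_lt_zero i), hu, u,
        mem_comp_self huA, .inl rfl⟩
    | succ m ih =>
      obtain ⟨v, D, h⟩ := ih
      exact h.step ht hG hcon
  -- Without a separator there would be a path on `|V| + 1` distinct vertices.
  obtain ⟨v, D, h⟩ := all (Fintype.card V)
  have hinj : Function.Injective fun i : Fin (Fintype.card V + 1) => v i := by
    intro i j hij
    rcases lt_trichotomy (i : ℕ) j with h' | h' | h'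
    · exact absurd hij (h.path i j h' (by omega)).1
    · exact Fin.ext h'
    · exact absurd hij.symm (h.path j i h' (by omega)).1
  have := Fintype.card_le_of_injective _ hinj
  simp only [Fintype.card_fin] at this
  omega

end Separator

end MWIS

/-! ### What the branching procedure guarantees -/

namespace MWIS

set_option linter.unusedSectionVars false

section Guarantee

variable {V : Type*} [Fintype V] [DecidableEq V] {G : SimpleGraph V} {w : V → ℕ}

theorem del_sdiff_nbs (A S : Finset V) (u : V) :
    del G A u \ nbs G S = A \ nbs G (insert u S) := by
  ext v
  simp only [Finset.mem_sdiff, mem_del, mem_nbs, Finset.mem_insert]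
  constructor
  · rintro ⟨⟨hA, hu, hv⟩, hS⟩
    refine ⟨hA, ?_⟩
    rintro ⟨x, rfl | hx, h⟩
    · tauto
    · exact hS ⟨x, hx, h⟩
  · rintro ⟨hA, h⟩
    refine ⟨⟨hA, fun hu => h ⟨u, .inl rfl, .inl hu⟩, fun hu => h ⟨u, .inl rfl, .inr hu⟩⟩, ?_⟩
    rintro ⟨x, hx, h'⟩
    exact h ⟨x, .inr hx, h'⟩

/-- Deleting the closed neighbourhood of `X` costs `|X|` units of fuel. -/
theorem val_sdiff_nbs (k : ℕ) (A X : Finset V) :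
    val G w k (A \ nbs G X) ≤ val G w (k + X.card) A := by
  induction X using Finset.induction_on generalizing A with
  | empty =>
    have : nbs G (∅ : Finset V) = ∅ := by ext; simp [mem_nbs]
    simp [this]
  | insert u S hu ih =>
    rw [← del_sdiff_nbs, Finset.card_insert_of_notMem hu]
    exact (ih (del G A u)).trans ((Nat.le_add_right _ _).trans (val_del _ A u))

/-- Taking the independent set `S` costs `|S|` units of fuel. -/
theorem val_take (k : ℕ) {A S : Finset V} (hS : S ⊆ A) (hI : Indep G S) :
    val G w k (A \ nbs G S) + ∑ v ∈ S, w v ≤ val G w (k + S.card) A := by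
  induction S using Finset.induction_on generalizing A with
  | empty =>
    have : nbs G (∅ : Finset V) = ∅ := by ext; simp [mem_nbs]
    simp [this]
  | insert u S hu ih =>
    rw [← del_sdiff_nbs, Finset.card_insert_of_notMem hu, Finset.sum_insert hu]
    have hS' : S ⊆ del G A u := fun x hx => mem_del.2 ⟨hS (Finset.mem_insert_of_mem hx),
      fun h => hu (h ▸ hx), hI u (Finset.mem_insert_self _ _) x (Finset.mem_insert_of_mem hx)⟩
    have h₁ := ih hS' (hI.mono (G := G) (Finset.subset_insert _ _))
    have h₂ := val_del (G := G) (w := w) (k + S.card) A u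
    rw [if_pos (hS (Finset.mem_insert_self _ _))] at h₂
    rw [← add_assoc k]
    omega

/-- An independent set meets the closed neighbourhood of its subset `S` in `S` alone, so taking `S`
costs `J` nothing. -/
theorem sum_indep_sdiff {J S : Finset V} (hJ : Indep G J) (hS : S ⊆ J) :
    ∑ v ∈ J, w v = ∑ v ∈ S, w v + ∑ v ∈ J \ nbs G S, w v := by
  have : J \ nbs G S = J \ S := by
    ext v
    simp only [Finset.mem_sdiff, mem_nbs, and_congr_right_iff]
    intro hv
    refine not_congr ⟨?_, fun h => ⟨v, h, .inl rfl⟩⟩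
    rintro ⟨x, hx, rfl | h⟩
    · exact hx
    · exact absurd h (hJ x (hS hx) v hv)
  rw [this, add_comm, Finset.sum_sdiff hS]

/-- A guarantee for the components gives one for the whole. -/
theorem le_val_of_comp {k : ℕ} {A J : Finset V} (hJ : J ⊆ A) {c : ℝ}
    (h : ∀ u ∈ A, c * ((∑ v ∈ J ∩ comp G A u, w v : ℕ) : ℝ) ≤ val G w k (comp G A u)) :
    c * ((∑ v ∈ J, w v : ℕ) : ℝ) ≤ val G w (k + 1) A := by
  refine le_trans ?_ (Nat.cast_le.2 (val_split k A))
  rw [← sum_comp (G := G) hJ w, Nat.cast_sum, Nat.cast_sum, Finset.mul_sum]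
  refine Finset.sum_le_sum fun D hD => ?_
  obtain ⟨u, hu, rfl⟩ := Finset.mem_image.1 hD
  exact h u hu

/-! #### Exact solutions -/

open Classical in
/-- The high-degree members of `J` can be used up. -/
theorem exists_high_degree_set (A J : Finset V) (d : ℕ) :
    ∃ S ⊆ J, S.card * (d + 1) ≤ A.card ∧
      ∀ v ∈ J ∩ (A \ nbs G S), ((A \ nbs G S).filter fun y => G.Adj v y).card < d := by
  -- `S` is chosen as large as possible among the sets whose members account for `d + 1` vertices of
  -- `A` each. A member of `J` with `d` remaining neighbours could be added, since it and those
  -- neighbours are not yet covered.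
  have hne : (J.powerset.filter fun S => S.card * (d + 1) ≤ (A ∩ nbs G S).card).Nonempty :=
    ⟨∅, by simp⟩
  obtain ⟨S, hS, hmax⟩ := Finset.exists_max_image _ Finset.card hne
  obtain ⟨hSJ, hSc⟩ := Finset.mem_filter.1 hS
  rw [Finset.mem_powerset] at hSJ
  refine ⟨S, hSJ, hSc.trans (Finset.card_le_card Finset.inter_subset_left), fun v hv => ?_⟩
  by_contra hd
  rw [not_lt] at hd
  obtain ⟨hvJ, hvA⟩ := Finset.mem_inter.1 hv
  have hvS : v ∉ S := fun h => (Finset.mem_sdiff.1 hvA).2 (mem_nbs.2 ⟨v, h, .inl rfl⟩)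
  have hsub : (A ∩ nbs G S) ∪ insert v ((A \ nbs G S).filter fun y => G.Adj v y) ⊆
      A ∩ nbs G (insert v S) := by
    intro x hx
    simp only [Finset.mem_union, Finset.mem_inter, Finset.mem_insert, Finset.mem_filter,
      Finset.mem_sdiff] at hx ⊢
    rcases hx with ⟨h₁, h₂⟩ | rfl | ⟨⟨h₁, -⟩, h₂⟩
    · obtain ⟨z, hz, hzx⟩ := mem_nbs.1 h₂
      exact ⟨h₁, mem_nbs.2 ⟨z, Finset.mem_insert_of_mem hz, hzx⟩⟩
    · exact ⟨(Finset.mem_sdiff.1 hvA).1, mem_nbs.2 ⟨x, Finset.mem_insert_self _ _, .inl rfl⟩⟩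
    · exact ⟨h₁, mem_nbs.2 ⟨v, Finset.mem_insert_self _ _, .inr h₂⟩⟩
  have hdisj : Disjoint (A ∩ nbs G S) (insert v ((A \ nbs G S).filter fun y => G.Adj v y)) := by
    rw [Finset.disjoint_left]
    intro x hx hx'
    rcases Finset.mem_insert.1 hx' with rfl | hx'
    · exact (Finset.mem_sdiff.1 hvA).2 (Finset.mem_inter.1 hx).2
    · exact (Finset.mem_sdiff.1 (Finset.mem_filter.1 hx').1).2 (Finset.mem_inter.1 hx).2
  have hcard := Finset.card_le_card hsub
  rw [Finset.card_union_of_disjoint hdisj, Finset.card_insert_of_notMem (by simp)] at hcard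
  have := hmax (insert v S) (Finset.mem_filter.2
    ⟨Finset.mem_powerset.2 (Finset.insert_subset hvJ hSJ), by
      rw [Finset.card_insert_of_notMem hvS, Nat.succ_mul]; omega⟩)
  rw [Finset.card_insert_of_notMem hvS] at this
  omega

/-- The branches follow `J`: take `S`, restrict to low degree, take `Y = J₁ ∩ N[X]`, delete `N[X]`,
split. All members of `J` survive or are taken, so nothing is lost. A level uses at most `(2t +
3)√|A|` units of fuel and at least halves the set. -/
theorem le_val_exact {t : ℕ} (ht : 1 ≤ t) (hG : HoleFree t G) (A : Finset V) {J : Finset V}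
    (hJA : J ⊆ A) (hJ : Indep G J) {k : ℕ} (hk : (8 * t + 12 : ℝ) * Real.sqrt A.card ≤ k) :
    ∑ v ∈ J, w v ≤ val G w k A := by
  classical
  induction hm : A.card using Nat.strong_induction_on generalizing A J k with
  | _ m ih =>
    subst hm
    rcases A.eq_empty_or_nonempty with rfl | hne
    · rw [Finset.subset_empty.1 hJA]; simp
    have hpos : 1 ≤ A.card := Finset.card_pos.2 hne
    set τ := Nat.sqrt A.card with hτ
    have hτ1 : 1 ≤ τ := Nat.le_sqrt.2 (by omega)
    have hτle : τ * τ ≤ A.card := Nat.sqrt_le _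
    have hτlt : A.card < (τ + 1) * (τ + 1) := Nat.lt_succ_sqrt _
    obtain ⟨S, hSJ, hSc, hdeg⟩ := exists_high_degree_set (G := G) A J τ
    have hSτ : S.card ≤ τ := by
      by_contra hlt
      have : (τ + 1) * (τ + 1) ≤ S.card * (τ + 1) := Nat.mul_le_mul_right _ (by omega)
      omega
    set A₁ := A \ nbs G S with hA₁
    set J₁ := J \ nbs G S with hJ₁
    set A₂ := lowDeg G A₁ (τ - 1) with hA₂
    have hJ₁A₂ : J₁ ⊆ A₂ := by
      intro v hv
      obtain ⟨hvJ, hvS⟩ := Finset.mem_sdiff.1 hv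
      have hvA₁ : v ∈ A₁ := Finset.mem_sdiff.2 ⟨hJA hvJ, hvS⟩
      have := hdeg v (Finset.mem_inter.2 ⟨hvJ, hvA₁⟩)
      exact Finset.mem_filter.2 ⟨hvA₁, by omega⟩
    obtain ⟨X, hXA, hXt, hX⟩ := exists_separator ht hG A₂
    set Y := J₁ ∩ nbs G X with hY
    -- Every `x ∈ X` lies in `A₂` and so has at most `τ - 1` neighbours in `A₁`; its closed
    -- neighbourhood accounts for at most `τ` members of `Y`.
    have hYτ : Y.card ≤ t * τ := by
      have hsub : Y ⊆ X.biUnion fun x => insert x (A₁.filter fun y => G.Adj x y) := by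
        intro y hy
        obtain ⟨hy₁, hy₂⟩ := Finset.mem_inter.1 hy
        obtain ⟨x, hx, hxy⟩ := mem_nbs.1 hy₂
        refine Finset.mem_biUnion.2 ⟨x, hx, ?_⟩
        rcases hxy with rfl | hxy
        · exact Finset.mem_insert_self _ _
        · exact Finset.mem_insert_of_mem
            (Finset.mem_filter.2 ⟨lowDeg_subset _ _ (hJ₁A₂ hy₁), hxy⟩)
      refine (Finset.card_le_card hsub).trans ((Finset.card_biUnion_le_card_mul _ _ τ ?_).trans
        (Nat.mul_le_mul_right _ hXt))
      intro x hx
      have := (Finset.mem_filter.1 (hXA hx)).2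
      refine (Finset.card_insert_le _ _).trans ?_
      omega
    set A₃ := A₂ \ nbs G Y with hA₃
    set J₂ := J₁ \ nbs G Y with hJ₂
    set A₄ := A₃ \ nbs G X with hA₄
    have hJ₂A₄ : J₂ ⊆ A₄ := by
      intro v hv
      obtain ⟨hv₁, hvY⟩ := Finset.mem_sdiff.1 hv
      refine Finset.mem_sdiff.2 ⟨Finset.mem_sdiff.2 ⟨hJ₁A₂ hv₁, hvY⟩, fun hvX => hvY ?_⟩
      exact mem_nbs.2 ⟨v, Finset.mem_inter.2 ⟨hv₁, hvX⟩, .inl rfl⟩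
    have hJ₁I : Indep G J₁ := hJ.mono (G := G) Finset.sdiff_subset
    -- the fuel suffices
    have hs1 : (1 : ℝ) ≤ Real.sqrt A.card := by
      rw [Real.one_le_sqrt]; exact_mod_cast hpos
    have hsτ : (τ : ℝ) ≤ Real.sqrt A.card := by
      apply Real.le_sqrt_of_sq_le
      rw [sq]; exact_mod_cast hτle
    have ht0 : (0 : ℝ) ≤ t := Nat.cast_nonneg t
    have he : ((S.card + 1 + Y.card + X.card + 1 : ℕ) : ℝ) ≤ (2 * t + 3) * Real.sqrt A.card := by
      have h₁ : (S.card : ℝ) ≤ τ := by exact_mod_cast hSτ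
      have h₂ : (Y.card : ℝ) ≤ t * τ := by exact_mod_cast hYτ
      have h₃ : (X.card : ℝ) ≤ t := by exact_mod_cast hXt
      push_cast
      nlinarith [mul_le_mul_of_nonneg_left hsτ ht0, mul_le_mul_of_nonneg_left hs1 ht0]
    obtain ⟨k', rfl⟩ : ∃ k', k = k' + 1 + X.card + Y.card + 1 + S.card := by
      refine ⟨k - (S.card + 1 + Y.card + X.card + 1), ?_⟩
      have : S.card + 1 + Y.card + X.card + 1 ≤ k := by
        have : ((S.card + 1 + Y.card + X.card + 1 : ℕ) : ℝ) ≤ k := by nlinarith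
        exact_mod_cast this
      omega
    -- Halving the size multiplies the root by `√(1/2) ≤ 3/4`, so a quarter of the fuel may be spent
    -- at this level; `8t + 12` is four times `2t + 3`.
    have hk' : (8 * t + 12 : ℝ) * (3 / 4 * Real.sqrt A.card) ≤ k' := by
      push_cast at hk he
      linarith
    have hcomp : ∀ u ∈ A₄, 1 * ((∑ v ∈ J₂ ∩ comp G A₄ u, w v : ℕ) : ℝ) ≤
        val G w k' (comp G A₄ u) := by
      intro u hu
      have h₁ : 2 * (comp G A₄ u).card ≤ A.card := by
        refine le_trans ?_ ((hX u).trans (Finset.card_le_card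
          ((lowDeg_subset _ _).trans Finset.sdiff_subset)))
        refine Nat.mul_le_mul_left _ (Finset.card_le_card (comp_mono ?_ u))
        exact Finset.sdiff_subset_sdiff Finset.sdiff_subset subset_rfl
      rw [one_mul, Nat.cast_le]
      refine ih _ (by omega) (comp G A₄ u) Finset.inter_subset_right (hJ₁I.mono (G := G)
        (Finset.inter_subset_left.trans Finset.sdiff_subset)) (le_trans ?_ hk') rfl
      refine mul_le_mul_of_nonneg_left ?_ (by positivity)
      rw [Real.sqrt_le_left (by positivity), mul_pow, Real.sq_sqrt (Nat.cast_nonneg _)]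
      have : (2 * (comp G A₄ u).card : ℝ) ≤ A.card := by exact_mod_cast h₁
      have h0 : (0 : ℝ) ≤ A.card := Nat.cast_nonneg _
      linarith
    have e₁ : ∑ v ∈ J, w v = ∑ v ∈ S, w v + ∑ v ∈ J₁, w v := sum_indep_sdiff hJ hSJ
    have e₂ : ∑ v ∈ J₁, w v = ∑ v ∈ Y, w v + ∑ v ∈ J₂, w v :=
      sum_indep_sdiff hJ₁I Finset.inter_subset_left
    have v₁ : val G w (k' + 1 + X.card + Y.card + 1) A₁ + ∑ v ∈ S, w v ≤
        val G w (k' + 1 + X.card + Y.card + 1 + S.card) A :=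
      val_take _ (hSJ.trans hJA) (hJ.mono (G := G) hSJ)
    have v₂ : val G w (k' + 1 + X.card + Y.card) A₂ ≤ val G w (k' + 1 + X.card + Y.card + 1) A₁ :=
      val_lowDeg _ _ (by
        have := Nat.sqrt_le_self A.card
        have := Finset.card_le_univ A
        omega)
    have v₃ : val G w (k' + 1 + X.card) A₃ + ∑ v ∈ Y, w v ≤ val G w (k' + 1 + X.card + Y.card) A₂ :=
      val_take _ (Finset.inter_subset_left.trans hJ₁A₂) (hJ₁I.mono (G := G) Finset.inter_subset_left)
    have v₄ : val G w (k' + 1) A₄ ≤ val G w (k' + 1 + X.card) A₃ := val_sdiff_nbs _ _ _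
    have v₅ := le_val_of_comp hJ₂A₄ hcomp
    rw [one_mul, Nat.cast_le] at v₅
    omega

/-! #### Approximate solutions -/

open Classical in
/-- The weight of the closed neighbourhood of `v` in `J`. -/
noncomputable def nbWeight (G : SimpleGraph V) (w : V → ℕ) (J : Finset V) (v : V) : ℕ :=
  ∑ u ∈ J.filter fun u => v = u ∨ G.Adj u v, w u

open Classical in
/-- Few members of `J` dominate most vertices that see more than a `1 / B`-fraction of `J`. -/
theorem exists_dominating (J : Finset V) {B : ℕ} (hB : 1 ≤ B) (i : ℕ) :
    ∃ S ⊆ J, S.card ≤ i ∧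
      (((Finset.univ.filter fun v => ∑ u ∈ J, w u < B * nbWeight G w J v) \ nbs G S).card : ℝ) ≤
        (1 - 1 / B) ^ i * Fintype.card V := by
  induction i with
  | zero =>
    refine ⟨∅, Finset.empty_subset _, by simp, ?_⟩
    rw [pow_zero, one_mul]
    exact_mod_cast Finset.card_le_univ _
  | succ i ih =>
    obtain ⟨S, hSJ, hSc, hS⟩ := ih
    set H := (Finset.univ.filter fun v => ∑ u ∈ J, w u < B * nbWeight G w J v) \ nbs G S with hH
    have hB0 : (0 : ℝ) < B := by exact_mod_cast hB
    have hB1 : (1 : ℝ) / B ≤ 1 := by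
      rw [div_le_one hB0]; exact_mod_cast hB
    by_cases hne : H.Nonempty
    swap
    · refine ⟨S, hSJ, by omega, ?_⟩
      rw [← hH, Finset.not_nonempty_iff_eq_empty.1 hne, Finset.card_empty, Nat.cast_zero]
      have : (0 : ℝ) ≤ 1 - 1 / B := by linarith
      positivity
    -- Averaging with weights `w u`: every `v ∈ H` sees more than a `1 / B` fraction of the weight
    -- of `J`, so by double counting some `u ∈ J` dominates at least a `1 / B` fraction of `H`.
    obtain ⟨u, huJ, hu⟩ : ∃ u ∈ J, H.card ≤ B * (H.filter fun v => v = u ∨ G.Adj u v).card := by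
      by_contra hcon
      push Not at hcon
      have h₁ : ∑ v ∈ H, ∑ u ∈ J, w u < ∑ v ∈ H, B * nbWeight G w J v :=
        Finset.sum_lt_sum_of_nonempty hne fun v hv =>
          (Finset.mem_filter.1 (Finset.mem_sdiff.1 hv).1).2
      have h₂ : ∑ v ∈ H, B * nbWeight G w J v =
          ∑ u ∈ J, w u * (B * (H.filter fun v => v = u ∨ G.Adj u v).card) := by
        simp only [nbWeight, Finset.sum_filter, Finset.card_filter, Finset.mul_sum]
        rw [Finset.sum_comm]
        refine Finset.sum_congr rfl fun u _ => Finset.sum_congr rfl fun v _ => ?_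
        split_ifs <;> ring
      have h₃ : ∑ u ∈ J, w u * (B * (H.filter fun v => v = u ∨ G.Adj u v).card) ≤
          ∑ u ∈ J, w u * H.card :=
        Finset.sum_le_sum fun u hu => Nat.mul_le_mul_left _ (hcon u hu).le
      rw [h₂, Finset.sum_const, smul_eq_mul] at h₁
      rw [← Finset.sum_mul, mul_comm] at h₃
      omega
    refine ⟨insert u S, Finset.insert_subset huJ hSJ, (Finset.card_insert_le _ _).trans (by omega),
      ?_⟩
    have hsub : (Finset.univ.filter fun v => ∑ u ∈ J, w u < B * nbWeight G w J v) \
        nbs G (insert u S) ⊆ H \ (H.filter fun v => v = u ∨ G.Adj u v) := by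
      intro v hv
      obtain ⟨hv₁, hv₂⟩ := Finset.mem_sdiff.1 hv
      rw [mem_nbs] at hv₂
      refine Finset.mem_sdiff.2 ⟨Finset.mem_sdiff.2 ⟨hv₁, fun h => hv₂ ?_⟩, fun h => hv₂ ?_⟩
      · obtain ⟨x, hx, hxv⟩ := mem_nbs.1 h
        exact ⟨x, Finset.mem_insert_of_mem hx, hxv⟩
      · exact ⟨u, Finset.mem_insert_self _ _, (Finset.mem_filter.1 h).2⟩
    have hcard := Finset.card_le_card hsub
    rw [Finset.card_sdiff_of_subset (Finset.filter_subset _ _)] at hcard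
    have hle := Finset.card_le_card (Finset.filter_subset (fun v => v = u ∨ G.Adj u v) H)
    have hcard' : (((Finset.univ.filter fun v => ∑ u ∈ J, w u < B * nbWeight G w J v) \
        nbs G (insert u S)).card : ℝ) ≤
        H.card - (H.filter fun v => v = u ∨ G.Adj u v).card := by
      rw [← Nat.cast_sub hle]; exact_mod_cast hcard
    have hu' : (1 / B : ℝ) * H.card ≤ (H.filter fun v => v = u ∨ G.Adj u v).card := by
      rw [one_div, inv_mul_le_iff₀ hB0]; exact_mod_cast hu
    calc _ ≤ (1 - 1 / B) * (H.card : ℝ) := by linarith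
      _ ≤ (1 - 1 / B) * ((1 - 1 / B) ^ i * Fintype.card V) :=
        mul_le_mul_of_nonneg_left hS (by linarith)
      _ = _ := by rw [pow_succ]; ring

theorem sum_biUnion_le {ι : Type*} (X : Finset ι) (f : ι → Finset V) (w : V → ℕ) :
    ∑ v ∈ X.biUnion f, w v ≤ ∑ x ∈ X, ∑ v ∈ f x, w v := by
  classical
  induction X using Finset.induction_on with
  | empty => simp
  | insert x X hx ih =>
    rw [Finset.biUnion_insert, Finset.sum_insert hx]
    have := Finset.sum_union_inter (s₁ := f x) (s₂ := X.biUnion f) (f := w)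
    omega

/-- Each level pays at most `L + t + 1` units of fuel, for `S`, for `X` and for the split, and loses
at most a `t / B` fraction of the current weight of `J`. Sizes at least halve, so `j` levels suffice
for fewer than `2 ^ j` vertices. -/
theorem le_val_approx {t : ℕ} (ht : 1 ≤ t) (hG : HoleFree t G) {B L : ℕ} (hB : 1 ≤ B)
    (hL : (1 - 1 / B : ℝ) ^ L * Fintype.card V < 1) (j : ℕ) (A : Finset V) (hA : A.card < 2 ^ j)
    {J : Finset V} (hJA : J ⊆ A) (hJ : Indep G J) {k : ℕ} (hk : j * (L + t + 1) ≤ k) :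
    (1 - j * (t / B) : ℝ) * ((∑ v ∈ J, w v : ℕ) : ℝ) ≤ val G w k A := by
  classical
  induction j generalizing A J k with
  | zero =>
    have : A = ∅ := by rw [← Finset.card_eq_zero]; simpa using hA
    subst this
    rw [Finset.subset_empty.1 hJA]; simp
  | succ j ih =>
    have hB0 : (0 : ℝ) < B := by exact_mod_cast hB
    obtain ⟨S, hSJ, hSc, hS⟩ := exists_dominating (G := G) (w := w) J hB L
    -- The number of undominated heavy vertices is an integer below `1`, hence zero.
    have hlight : ∀ v, v ∉ nbs G S → B * nbWeight G w J v ≤ ∑ u ∈ J, w u := by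
      intro v hv
      by_contra hlt
      rw [not_le] at hlt
      have : 0 < ((Finset.univ.filter fun v => ∑ u ∈ J, w u < B * nbWeight G w J v) \
          nbs G S).card :=
        Finset.card_pos.2 ⟨v, Finset.mem_sdiff.2 ⟨Finset.mem_filter.2 ⟨Finset.mem_univ _, hlt⟩, hv⟩⟩
      have : (1 : ℝ) ≤ (((Finset.univ.filter fun v => ∑ u ∈ J, w u < B * nbWeight G w J v) \
          nbs G S).card : ℝ) := by exact_mod_cast this
      linarith
    set A₁ := A \ nbs G S with hA₁
    obtain ⟨X, hXA, hXt, hX⟩ := exists_separator ht hG A₁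
    set A₂ := A₁ \ nbs G X with hA₂
    set J₁ := J \ nbs G S with hJ₁
    set J₂ := J₁ \ nbs G X with hJ₂
    have hJ₂A₂ : J₂ ⊆ A₂ :=
      Finset.sdiff_subset_sdiff (Finset.sdiff_subset_sdiff hJA subset_rfl) subset_rfl
    obtain ⟨k', rfl⟩ : ∃ k', k = k' + 1 + X.card + S.card :=
      ⟨k - (1 + X.card + S.card), by rw [Nat.succ_mul] at hk; omega⟩
    have hk' : j * (L + t + 1) ≤ k' := by rw [Nat.succ_mul] at hk; omega
    have v₁ : val G w (k' + 1 + X.card) A₁ + ∑ v ∈ S, w v ≤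
        val G w (k' + 1 + X.card + S.card) A :=
      val_take _ (hSJ.trans hJA) (hJ.mono (G := G) hSJ)
    have v₂ : val G w (k' + 1) A₂ ≤ val G w (k' + 1 + X.card) A₁ := val_sdiff_nbs _ _ _
    have v₃ : (1 - j * (t / B) : ℝ) * ((∑ v ∈ J₂, w v : ℕ) : ℝ) ≤ val G w (k' + 1) A₂ := by
      refine le_val_of_comp hJ₂A₂ fun u _ => ih _ ?_ Finset.inter_subset_right
        (hJ.mono (G := G) ((Finset.inter_subset_left.trans Finset.sdiff_subset).trans
          Finset.sdiff_subset)) hk'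
      have h₁ := hX u
      have h₂ : A₁.card ≤ A.card := Finset.card_le_card Finset.sdiff_subset
      rw [pow_succ] at hA
      omega
    have e₁ : ∑ v ∈ J, w v = ∑ v ∈ S, w v + ∑ v ∈ J₁, w v := sum_indep_sdiff hJ hSJ
    -- What `J₁` loses lies in `N[X]`, and each of the at most `t` members of `X` is light because
    -- it lies outside `N[S]`.
    have e₂ : B * ∑ v ∈ J₁, w v ≤ B * ∑ v ∈ J₂, w v + t * ∑ v ∈ J, w v := by
      have h₁ : ∑ v ∈ J₁, w v ≤ ∑ v ∈ J₂, w v + ∑ x ∈ X, nbWeight G w J x := by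
        have hsub : J₁ ⊆ J₂ ∪ X.biUnion fun x => J.filter fun u => x = u ∨ G.Adj u x := by
          intro v hv
          by_cases hvX : v ∈ nbs G X
          · obtain ⟨x, hx, hxv⟩ := mem_nbs.1 hvX
            refine Finset.mem_union_right _ (Finset.mem_biUnion.2 ⟨x, hx, Finset.mem_filter.2
              ⟨(Finset.mem_sdiff.1 hv).1, ?_⟩⟩)
            rcases hxv with rfl | h
            · exact .inl rfl
            · exact .inr h.symm
          · exact Finset.mem_union_left _ (Finset.mem_sdiff.2 ⟨hv, hvX⟩)
        refine (Finset.sum_le_sum_of_subset hsub).trans ?_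
        refine le_trans (le_of_le_of_eq (Nat.le_add_right _ _) (Finset.sum_union_inter (f := w))) ?_
        refine Nat.add_le_add_left ?_ _
        exact sum_biUnion_le _ _ _
      have h₂ : ∑ x ∈ X, B * nbWeight G w J x ≤ t * ∑ v ∈ J, w v := by
        refine (Finset.sum_le_card_nsmul _ _ _ fun x hx =>
          hlight x (Finset.mem_sdiff.1 (hXA hx)).2).trans ?_
        rw [smul_eq_mul]
        exact Nat.mul_le_mul_right _ hXt
      rw [← Finset.mul_sum] at h₂
      have := Nat.mul_le_mul_left B h₁
      rw [Nat.mul_add] at this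
      omega
    have hv : ((val G w (k' + 1) A₂ : ℕ) : ℝ) + (∑ v ∈ S, w v : ℕ) ≤
        val G w (k' + 1 + X.card + S.card) A := by exact_mod_cast (by omega)
    refine le_trans ?_ hv
    have e₁' : ((∑ v ∈ J, w v : ℕ) : ℝ) = (∑ v ∈ S, w v : ℕ) + (∑ v ∈ J₁, w v : ℕ) := by
      exact_mod_cast e₁
    have e₂' : (B : ℝ) * (∑ v ∈ J₁, w v : ℕ) ≤
        B * (∑ v ∈ J₂, w v : ℕ) + t * (∑ v ∈ J, w v : ℕ) := by exact_mod_cast e₂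
    generalize ((∑ v ∈ J, w v : ℕ) : ℝ) = x at *
    have hS0 : (0 : ℝ) ≤ ((∑ v ∈ S, w v : ℕ) : ℝ) := Nat.cast_nonneg _
    have h10 : (0 : ℝ) ≤ ((∑ v ∈ J₁, w v : ℕ) : ℝ) := Nat.cast_nonneg _
    have h20 : (0 : ℝ) ≤ ((∑ v ∈ J₂, w v : ℕ) : ℝ) := Nat.cast_nonneg _
    have hv0 : (0 : ℝ) ≤ ((val G w (k' + 1) A₂ : ℕ) : ℝ) := Nat.cast_nonneg _
    generalize ((∑ v ∈ S, w v : ℕ) : ℝ) = a at *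
    generalize ((∑ v ∈ J₁, w v : ℕ) : ℝ) = b at *
    generalize ((∑ v ∈ J₂, w v : ℕ) : ℝ) = c at *
    set γ : ℝ := t / B with hγ
    have hγ0 : 0 ≤ γ := by positivity
    have hbc : b ≤ c + γ * x := by
      have : b * B ≤ (c + γ * x) * B := by
        rw [hγ, add_mul, mul_right_comm, div_mul_cancel₀ _ hB0.ne']
        linarith
      exact le_of_mul_le_mul_right this hB0
    have hx0 : 0 ≤ x := by rw [e₁']; positivity
    have hj0 : (0 : ℝ) ≤ j * γ := by positivity
    push_cast
    -- The induction loses its monotonicity for a negative factor, but then the claimed bound is at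
    -- most zero and trivial.
    by_cases hneg : 1 - (j : ℝ) * γ ≤ 0
    · nlinarith [mul_nonneg hγ0 hx0]
    · rw [not_le] at hneg
      nlinarith [mul_le_mul_of_nonneg_left hbc hneg.le, mul_nonneg hj0 (mul_nonneg hγ0 hx0),
        mul_nonneg hj0 hS0]

end Guarantee

end MWIS

/-! ### Running times -/

namespace MWIS

variable {n : ℕ} {G : SimpleGraph (Fin n)} {w : Fin n → ℕ}

/-- From `320 ≤ e⁶` and `n + 1 ≤ e · exp (log n)`; the second inequality also holds for `n = 0`,
where the logarithm is read as `0`. -/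
theorem level_bound_le_exp (n : ℕ) :
    ((320 * (n + 1) ^ 5 : ℕ) : ℝ) ≤ Real.exp (11 + 5 * Real.log n) := by
  have h1 := Real.exp_one_gt_d9
  have h320 : (320 : ℝ) ≤ Real.exp 1 ^ 6 := by
    refine le_trans ?_ (pow_le_pow_left₀ (by norm_num) (show (2.7 : ℝ) ≤ Real.exp 1 by linarith) 6)
    norm_num
  have hn : (n + 1 : ℝ) ≤ Real.exp 1 * Real.exp (Real.log n) := by
    rcases n.eq_zero_or_pos with rfl | hn
    · simp
    · have hn' : (1 : ℝ) ≤ n := by exact_mod_cast hn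
      rw [Real.exp_log (by linarith)]
      nlinarith
  have e : Real.exp (11 + 5 * Real.log n) =
      Real.exp 1 ^ 6 * (Real.exp 1 * Real.exp (Real.log n)) ^ 5 := by
    rw [← Real.exp_add, ← Real.exp_nat_mul, ← Real.exp_nat_mul, ← Real.exp_add]
    congr 1; push_cast; ring
  rw [e]
  push_cast
  gcongr

theorem pow_level_bound_le_exp (n k : ℕ) {κ : ℝ} (hk : (k : ℝ) ≤ κ) :
    (((320 * (n + 1) ^ 5) ^ (k + 1) : ℕ) : ℝ) ≤ Real.exp ((κ + 1) * (11 + 5 * Real.log n)) := by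
  have h0 : 0 ≤ 11 + 5 * Real.log n := by
    have := Real.log_natCast_nonneg n
    positivity
  have h1 : (((k + 1 : ℕ) : ℝ)) ≤ κ + 1 := by push_cast; linarith
  rw [Nat.cast_pow]
  calc _ ≤ Real.exp (11 + 5 * Real.log n) ^ (k + 1) :=
        pow_le_pow_left₀ (Nat.cast_nonneg _) (level_bound_le_exp n) _
    _ = Real.exp (((k + 1 : ℕ) : ℝ) * (11 + 5 * Real.log n)) := (Real.exp_nat_mul _ _).symm
    _ ≤ _ := Real.exp_le_exp.2 (mul_le_mul_of_nonneg_right h1 h0)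

theorem le_pow_level_bound (n k : ℕ) :
    1 ≤ (320 * (n + 1) ^ 5) ^ (k + 1) ∧ n ≤ (320 * (n + 1) ^ 5) ^ (k + 1) ∧
      k ≤ (320 * (n + 1) ^ 5) ^ (k + 1) := by
  have h1 : 1 ≤ (n + 1) ^ 4 := Nat.one_le_pow _ _ (Nat.succ_pos n)
  have h5 : (n + 1) ^ 5 = (n + 1) ^ 4 * (n + 1) := pow_succ _ _
  have hM : n + 1 ≤ (n + 1) ^ 5 := by rw [h5]; exact Nat.le_mul_of_pos_left _ h1
  have hpow : 320 * (n + 1) ^ 5 ≤ (320 * (n + 1) ^ 5) ^ (k + 1) :=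
    Nat.le_self_pow (Nat.succ_ne_zero k) _
  have hk : k + 1 < (320 * (n + 1) ^ 5) ^ (k + 1) := Nat.lt_pow_self (by omega)
  omega

theorem Sol.isApprox {k : ℕ} {I : Finset (Fin n)} (h : Sol G w k Finset.univ I) {α : ℝ}
    (hα : ∀ J : Finset (Fin n), Indep G J →
      α * ((∑ v ∈ J, w v : ℕ) : ℝ) ≤ val G w k Finset.univ) : IsApprox G w α I :=
  ⟨(isIndepSet_iff G I).2 h.2.1, fun J hJ => (hα J ((isIndepSet_iff G J).1 hJ)).trans
    (Nat.cast_le.2 h.2.2)⟩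

theorem exact_guarantee {t : ℕ} (ht : 1 ≤ t) (hG : HoleFree t G) {I : Finset (Fin n)}
    (h : Sol G w (exactFuel t n) Finset.univ I) : IsApprox G w 1 I := by
  refine h.isApprox fun J hJ => ?_
  rw [one_mul, Nat.cast_le]
  refine le_val_exact ht hG _ (Finset.subset_univ _) hJ ?_
  rw [Finset.card_univ, Fintype.card_fin, exactFuel]
  push_cast
  rw [mul_comm]
  exact mul_le_mul_of_nonneg_right (Nat.le_ceil _) (by positivity)

theorem exp_le_two_rpow {c E x y : ℝ} (hc : 0 ≤ c) (hE : 0 ≤ E) (hx : 1 ≤ x) (hy : 1 / 2 ≤ y) :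
    Real.exp ((c * (x + 1) + 1) * (11 + 5 * y)) ≤
      (2 : ℝ) ^ ((E + 54 * (2 * c + 1)) * (x * y)) := by
  have hxy : 0 ≤ x * y := mul_nonneg (by linarith) (by linarith)
  have h₁ : c * (x + 1) + 1 ≤ (2 * c + 1) * x := by nlinarith
  -- The bound `y ≥ 1/2` is what absorbs the additive constant. Passing to base `2` costs the factor
  -- `1 / log 2 ≤ 2`, whence `54`; `E` is slack, so that one constant can serve as factor and
  -- exponent.
  have h₂ : 11 + 5 * y ≤ 27 * y := by linarith
  have h₃ : (c * (x + 1) + 1) * (11 + 5 * y) ≤ 27 * (2 * c + 1) * (x * y) :=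
    calc _ ≤ ((2 * c + 1) * x) * (27 * y) :=
          mul_le_mul h₁ h₂ (by linarith) (mul_nonneg (by linarith) (by linarith))
      _ = _ := by ring
  rw [Real.rpow_def_of_pos (by norm_num), Real.exp_le_exp]
  have h₄ : (54 * (2 * c + 1)) * (x * y) ≤ (E + 54 * (2 * c + 1)) * (x * y) :=
    mul_le_mul_of_nonneg_right (by linarith) hxy
  have h₅ : 0 ≤ (54 * (2 * c + 1)) * (x * y) := mul_nonneg (by linarith) hxy
  have hlog2 := Real.log_two_gt_d9
  nlinarith

theorem exact_time (t : ℕ) : ∃ C : ℝ, ∀ n k : ℕ,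
    k ≤ (5 * ⌈Real.sqrt n⌉₊ + 3 * (8 * t + 12) + 11) + (3 * exactFuel t n + 5 * n + 6 +
        (320 * (n + 1) ^ 5) ^ (exactFuel t n + 1)) →
      (k : ℝ) ≤ C * (2 : ℝ) ^ (C * (Real.sqrt n * Real.log n)) := by
  obtain ⟨c, hc⟩ : ∃ c, c = 8 * t + 12 := ⟨_, rfl⟩
  -- `D` collects the additive constants `3c + 17` and the `5 + 3 + 5 + 1 = 14` terms bounded by the
  -- main power. `E` additionally covers `n ≤ 1`, where `log n = 0` and the exponential factor is
  -- just `1`.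
  obtain ⟨D, hD⟩ : ∃ D, D = 3 * c + 31 := ⟨_, rfl⟩
  obtain ⟨E, hE⟩ : ∃ E, E = D * 10240 ^ (c + 1) := ⟨_, rfl⟩
  refine ⟨E + 54 * (2 * c + 1), fun n k hk => ?_⟩
  have hceil : ⌈Real.sqrt n⌉₊ ≤ n := (ceil_sqrt_le_iff n n).2 (Nat.le_mul_self n)
  obtain ⟨b₁, b₂, b₃⟩ := le_pow_level_bound n (exactFuel t n)
  have hkD : k ≤ D * (320 * (n + 1) ^ 5) ^ (exactFuel t n + 1) := by
    refine hk.trans ?_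
    rw [← hc]
    generalize (320 * (n + 1) ^ 5) ^ (exactFuel t n + 1) = X at *
    have : 3 * c + 17 ≤ (3 * c + 17) * X := Nat.le_mul_of_pos_right _ b₁
    rw [hD, show 3 * c + 31 = (3 * c + 17) + 14 by ring, Nat.add_mul]
    omega
  have hDE : D ≤ E := by
    rw [hE]
    exact Nat.le_mul_of_pos_right _ (by positivity)
  have hE1 : (E : ℝ) ≤ E + 54 * (2 * c + 1) := by
    have : (0 : ℝ) ≤ 54 * (2 * c + 1) := by positivity
    linarith
  by_cases hn : n ≤ 1
  · have hlog : Real.log n = 0 := by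
      interval_cases n <;> simp
    rw [hlog, mul_zero, mul_zero, Real.rpow_zero, mul_one]
    refine le_trans ?_ hE1
    refine Nat.cast_le.2 (hkD.trans ?_)
    rw [hE]
    refine Nat.mul_le_mul_left _ ?_
    have hf : exactFuel t n ≤ c := by
      rw [exactFuel, ← hc]
      calc _ ≤ 1 * c := Nat.mul_le_mul_right _ (hceil.trans hn)
        _ = c := one_mul c
    calc (320 * (n + 1) ^ 5) ^ (exactFuel t n + 1)
        ≤ (320 * (1 + 1) ^ 5) ^ (exactFuel t n + 1) := by gcongr
      _ ≤ (320 * (1 + 1) ^ 5) ^ (c + 1) := Nat.pow_le_pow_right (by norm_num) (by omega)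
      _ = 10240 ^ (c + 1) := by norm_num
  · have hn2 : (2 : ℝ) ≤ n := by exact_mod_cast (by omega : 2 ≤ n)
    have hx : 1 ≤ Real.sqrt n := by rw [Real.one_le_sqrt]; linarith
    have hy : 1 / 2 ≤ Real.log n := by
      have := Real.log_le_log (by norm_num) hn2
      have := Real.log_two_gt_d9
      linarith
    have hK : ((exactFuel t n : ℕ) : ℝ) ≤ c * (Real.sqrt n + 1) := by
      rw [exactFuel, ← hc, Nat.cast_mul, mul_comm]
      exact mul_le_mul_of_nonneg_left (Nat.ceil_lt_add_one (Real.sqrt_nonneg _)).le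
        (Nat.cast_nonneg c)
    calc (k : ℝ) ≤ D * (((320 * (n + 1) ^ 5) ^ (exactFuel t n + 1) : ℕ) : ℝ) := by
          exact_mod_cast hkD
      _ ≤ (E + 54 * (2 * c + 1)) * (2 : ℝ) ^
            ((E + 54 * (2 * c + 1)) * (Real.sqrt n * Real.log n)) := by
          refine mul_le_mul ((Nat.cast_le.2 hDE).trans hE1) ?_ (Nat.cast_nonneg _)
            ((Nat.cast_nonneg E).trans hE1)
          exact (pow_level_bound_le_exp n _ hK).trans
            (exp_le_two_rpow (Nat.cast_nonneg c) (Nat.cast_nonneg E) hx hy)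

theorem div_ceil_le {p q : ℕ} (hp : 0 < p) :
    q ≤ (q + (p - 1)) / p * p ∧ (((q + (p - 1)) / p : ℕ) : ℝ) ≤ q / p + 1 := by
  have hp' : (0 : ℝ) < p := by exact_mod_cast hp
  constructor
  · have h₁ := Nat.div_add_mod (q + (p - 1)) p
    have h₂ := Nat.mod_lt (q + (p - 1)) hp
    rw [mul_comm]
    omega
  · refine Nat.cast_div_le.trans ?_
    rw [← div_self hp'.ne', ← add_div]
    gcongr
    exact_mod_cast (by omega)

/-- By minimality `2 ^ (l - 1) ≤ n` for a positive value `l` of `Nat.clog`, and `log 2 > 1/2`. -/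
theorem clog_le (n : ℕ) : (Nat.clog 2 (n + 1) : ℝ) ≤ 2 * Real.log n + 2 := by
  have hl0 := Real.log_natCast_nonneg n
  rcases (Nat.clog 2 (n + 1)).eq_zero_or_pos with h | h
  · rw [h]; push_cast; positivity
  · have hlt : ¬ Nat.clog 2 (n + 1) ≤ Nat.clog 2 (n + 1) - 1 := by omega
    rw [Nat.clog_le_iff_le_pow (by norm_num)] at hlt
    have hle : 2 ^ (Nat.clog 2 (n + 1) - 1) ≤ n := by omega
    have hle' : ((2 : ℝ) ^ (Nat.clog 2 (n + 1) - 1)) ≤ n := by exact_mod_cast hle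
    have := Real.log_le_log (by positivity) hle'
    rw [Real.log_pow, Nat.cast_sub h, Nat.cast_one] at this
    have hlog2 := Real.log_two_gt_d9
    have h1 : (1 : ℝ) ≤ Nat.clog 2 (n + 1) := by exact_mod_cast h
    nlinarith

/-- With `l` for the logarithm and `b = ⌈q / p⌉`, the choice `B = t l b` makes the total loss `l · t
/ B = 1 / b ≤ p / q`. Then `L = B l` suffices for domination, because `(1 - 1/B) ^ B ≤ e⁻¹ ≤ 1/2`
and `n < 2 ^ l`. -/
theorem approx_guarantee {t : ℕ} (ht : 1 ≤ t) (hG : HoleFree t G) {p q : ℕ} (hp : 0 < p)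
    (hq : 0 < q) {I : Finset (Fin n)} (h : Sol G w (approxFuel t n p q) Finset.univ I) :
    IsApprox G w (1 - (p : ℝ) / q) I := by
  refine h.isApprox fun J hJ => ?_
  rcases n.eq_zero_or_pos with rfl | hn
  · rw [Finset.eq_empty_of_isEmpty J]; simp
  have hb := (div_ceil_le (q := q) hp).1
  rw [approxFuel]
  have hl : n + 1 ≤ 2 ^ Nat.clog 2 (n + 1) := Nat.le_pow_clog (by norm_num) _
  have hl1 : 1 ≤ Nat.clog 2 (n + 1) := Nat.clog_pos (by norm_num) (by omega)
  generalize Nat.clog 2 (n + 1) = l at hl hl1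
  generalize (q + (p - 1)) / p = b at hb
  have hb1 : 1 ≤ b := by
    rcases b.eq_zero_or_pos with rfl | h
    · omega
    · exact h
  have hB : 1 ≤ t * l * b := Nat.mul_pos (Nat.mul_pos ht hl1) hb1
  have hB' : (1 : ℝ) ≤ (t * l * b : ℕ) := by exact_mod_cast hB
  have hhalf : (1 - 1 / ((t * l * b : ℕ) : ℝ)) ^ (t * l * b) ≤ 1 / 2 := by
    refine (Real.one_sub_div_pow_le_exp_neg hB').trans ?_
    rw [Real.exp_neg, one_div]
    have := Real.exp_one_gt_d9
    exact inv_anti₀ (by norm_num) (by linarith)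
  have h01 : 0 ≤ 1 - 1 / ((t * l * b : ℕ) : ℝ) := by
    rw [sub_nonneg, div_le_one (by linarith)]; exact hB'
  have hL : (1 - 1 / ((t * l * b : ℕ) : ℝ)) ^ (t * l * b * l) * Fintype.card (Fin n) < 1 := by
    rw [Fintype.card_fin, pow_mul]
    have h₁ : ((1 - 1 / ((t * l * b : ℕ) : ℝ)) ^ (t * l * b)) ^ l ≤ (1 / 2) ^ l :=
      pow_le_pow_left₀ (pow_nonneg h01 _) hhalf _
    have h₂ : (n : ℝ) < 2 ^ l := by exact_mod_cast (by omega : n < 2 ^ l)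
    have h₃ : (0 : ℝ) < 2 ^ l := by positivity
    calc _ ≤ (1 / 2 : ℝ) ^ l * n := mul_le_mul_of_nonneg_right h₁ (Nat.cast_nonneg n)
      _ < (1 / 2 : ℝ) ^ l * 2 ^ l := mul_lt_mul_of_pos_left h₂ (by positivity)
      _ = 1 := by rw [← mul_pow]; norm_num
  refine le_trans ?_ (le_val_approx ht hG hB hL l Finset.univ ?_ (Finset.subset_univ J) hJ
    (k := l * l * l * b * (2 * t + 1)) ?_)
  · refine mul_le_mul_of_nonneg_right ?_ (Nat.cast_nonneg _)
    have e : (l : ℝ) * (t / ((t * l * b : ℕ) : ℝ)) = 1 / b := by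
      have h₁ : (t : ℝ) ≠ 0 := by exact_mod_cast (by omega : t ≠ 0)
      have h₂ : (l : ℝ) ≠ 0 := by exact_mod_cast (by omega : l ≠ 0)
      have h₃ : (b : ℝ) ≠ 0 := by exact_mod_cast (by omega : b ≠ 0)
      push_cast
      field_simp
    rw [e]
    refine sub_le_sub_left ?_ _
    rw [div_le_div_iff₀ (by exact_mod_cast hb1) (by exact_mod_cast hq)]
    rw [one_mul, mul_comm]
    exact_mod_cast hb
  · rw [Finset.card_univ, Fintype.card_fin]; omega
  · have h1 : 1 ≤ l * l * b := Nat.mul_pos (Nat.mul_pos hl1 hl1) hb1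
    calc l * (t * l * b * l + t + 1) = l * (t * (l * l * b) + (t + 1) * 1) := by ring
      _ ≤ l * (t * (l * l * b) + (t + 1) * (l * l * b)) := by gcongr
      _ = l * l * l * b * (2 * t + 1) := by ring

open MvPolynomial in
-- The running time is at most a product of three factors: the constant `D`, the term `⌈q / p⌉ + 1`,
-- and the main power. Each is bounded by an exponential, and the three exponents are the summands
-- of the polynomial, with `X 0` for `log n` and `X 1` for `1 / ε`.
theorem approx_time (t : ℕ) : ∃ P : MvPolynomial (Fin 2) ℝ, ∀ n p q k : ℕ, 0 < p →
    k ≤ (6 * ((q + (p - 1)) / p) + 10 * Nat.clog 2 (n + 1) + 3 * (2 * t + 1) + 22) +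
        (3 * approxFuel t n p q + 5 * n + 6 +
        (320 * (n + 1) ^ 5) ^ (approxFuel t n p q + 1)) →
      (k : ℝ) ≤ Real.exp (MvPolynomial.eval ![Real.log n, ((p : ℝ) / q)⁻¹] P) := by
  set D := 6 * t + 60 with hD
  refine ⟨C (D : ℝ) + (X 1 + 1) +
    (C (2 * t + 1 : ℝ) * ((C 2 * X 0 + C 2) ^ 3 * (X 1 + 1)) + 1) * (C 11 + C 5 * X 0),
    fun n p q k hp hk => ?_⟩
  have heval : MvPolynomial.eval ![Real.log n, ((p : ℝ) / q)⁻¹] (C (D : ℝ) + (X 1 + 1) +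
      (C (2 * t + 1 : ℝ) * ((C 2 * X 0 + C 2) ^ 3 * (X 1 + 1)) + 1) * (C 11 + C 5 * X 0)) =
      D + (q / p + 1) + ((2 * t + 1) * ((2 * Real.log n + 2) ^ 3 * (q / p + 1)) + 1) *
        (11 + 5 * Real.log n) := by
    simp [inv_div]
  rw [heval]
  obtain ⟨b₁, b₂, b₃⟩ := le_pow_level_bound n (approxFuel t n p q)
  have hl : Nat.clog 2 (n + 1) ≤ n := by
    rw [Nat.clog_le_iff_le_pow (by norm_num)]
    exact Nat.lt_two_pow_self
  have hb := (div_ceil_le (q := q) hp).2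
  have hlr := clog_le n
  have hK : ((approxFuel t n p q : ℕ) : ℝ) ≤
      (2 * t + 1) * ((2 * Real.log n + 2) ^ 3 * (q / p + 1)) := by
    rw [approxFuel]
    push_cast
    have hl0 : (0 : ℝ) ≤ Nat.clog 2 (n + 1) := Nat.cast_nonneg _
    calc _ = (2 * t + 1 : ℝ) * ((Nat.clog 2 (n + 1) : ℝ) ^ 3 * (((q + (p - 1)) / p : ℕ) : ℝ)) := by
          ring
      _ ≤ _ := by
          refine mul_le_mul_of_nonneg_left ?_ (by positivity)
          exact mul_le_mul (pow_le_pow_left₀ hl0 hlr 3) hb (Nat.cast_nonneg _)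
            (pow_nonneg (hl0.trans hlr) 3)
  have hexp := pow_level_bound_le_exp n _ hK
  have hkD : k ≤ D * ((q + (p - 1)) / p + 1) * (320 * (n + 1) ^ 5) ^ (approxFuel t n p q + 1) := by
    refine hk.trans ?_
    generalize (320 * (n + 1) ^ 5) ^ (approxFuel t n p q + 1) = Y at *
    generalize (q + (p - 1)) / p = b at *
    have h₁ : (b + 1) * 1 ≤ (b + 1) * Y := Nat.mul_le_mul_left _ b₁
    have h₂ : 1 * Y ≤ (b + 1) * Y := Nat.mul_le_mul_right _ (by omega)
    have h₃ : (6 * t) * 1 ≤ (6 * t) * ((b + 1) * Y) := Nat.mul_le_mul_left _ (by omega)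
    rw [hD, mul_assoc, Nat.add_mul]
    omega
  have hD' : (D : ℝ) ≤ Real.exp D := by
    have := Real.add_one_le_exp (D : ℝ); linarith
  have hb' : ((((q + (p - 1)) / p + 1 : ℕ)) : ℝ) ≤ Real.exp (q / p + 1) := by
    have := Real.add_one_le_exp (q / p + 1 : ℝ)
    rw [Nat.cast_add, Nat.cast_one]
    linarith
  rw [Real.exp_add, Real.exp_add]
  calc (k : ℝ) ≤ ((D * ((q + (p - 1)) / p + 1) *
        (320 * (n + 1) ^ 5) ^ (approxFuel t n p q + 1) : ℕ) : ℝ) := Nat.cast_le.2 hkD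
    _ ≤ _ := by
      rw [Nat.cast_mul, Nat.cast_mul]
      exact mul_le_mul (mul_le_mul hD' hb' (Nat.cast_nonneg _) (Real.exp_pos _).le) hexp
        (Nat.cast_nonneg _) (by positivity)

end MWIS

theorem theorem3 (t : ℕ) (ht : 4 ≤ t) :
    (∃ (A : RAM.Program) (P : MvPolynomial (Fin 2) ℝ),
      ∀ (n : ℕ) (G : SimpleGraph (Fin n)) (w : Fin n → ℕ), MWIS.HoleFree t G →
        ∀ p q : ℕ, 0 < p → 0 < q →
          ∃ (k : ℕ) (s : RAM.Store), A.HaltsIn (MWIS.input G w p q) k s ∧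
            (k : ℝ) ≤ Real.exp (MvPolynomial.eval ![Real.log n, ((p : ℝ) / q)⁻¹] P) ∧
            MWIS.IsApprox G w (1 - (p : ℝ) / q) (MWIS.output n s)) ∧
    (∃ (A : RAM.Program) (C : ℝ),
      ∀ (n : ℕ) (G : SimpleGraph (Fin n)) (w : Fin n → ℕ), MWIS.HoleFree t G →
        ∃ (k : ℕ) (s : RAM.Store), A.HaltsIn (MWIS.input G w 0 0) k s ∧
          (k : ℝ) ≤ C * (2 : ℝ) ^ (C * (Real.sqrt n * Real.log n)) ∧
          MWIS.IsApprox G w 1 (MWIS.output n s)) := by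
  obtain ⟨P, hP⟩ := MWIS.approx_time t
  obtain ⟨C, hC⟩ := MWIS.exact_time t
  refine ⟨⟨MWIS.approxProgram t, P, fun n G w hG p q hp hq => ?_⟩,
    ⟨MWIS.exactProgram t, C, fun n G w hG => ?_⟩⟩
  · obtain ⟨k, s, h₁, h₂, h₃⟩ := MWIS.approxProgram_halts t G w (q := q) hp
    exact ⟨k, s, h₁, hP n p q k hp h₂, MWIS.approx_guarantee (by omega) hG hp hq h₃⟩
  · obtain ⟨k, s, h₁, h₂, h₃⟩ := MWIS.exactProgram_halts t G w
    exact ⟨k, s, h₁, hC n k h₂, MWIS.exact_guarantee (by omega) hG h₃⟩
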